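/- **Setting.** Let $M$ be a smooth oriented $n$-dimensional manifold (Hausdorff, second countable, possibly with boundary) with a (pseudo-)Riemannian metric, Hodge star $\ast$ (normalised by $\alpha\wedge\ast\beta=(\alpha,\beta)\,\mathrm{vol}$). Let $(\mathfrak h,\mathfrak g;\alpha,\vartriangleright)$ be a finite-dimensional real or complex differential crossed module with symmetric nondegenerate $G$-invariant bilinear forms $\langle\cdot,\cdot\rangle$ on $\mathfrak g$ and $\mathfrak h$ (invariant under $\exp(\mathrm{ad}\,X)$, resp. $\exp(X\vartriangleright\cdot)$, $X\in\mathfrak g$), and let $k\neq0$ be a constant. Define $\sigma:\mathfrak h\times\mathfrak h\to\mathfrak g$ by $\langle\sigma(Y,Y'),X\rangle=-\langle Y,X\vartriangleright Y'\rangle$ and $\alpha^*:\mathfrak g\to\mathfrak h$ by $\langle Y,\alpha^*(X)\rangle=\langle\alpha(Y),X\rangle$. For a bilinear map $b$ write $\wedge^{b}$ for the exterior product of vector-valued forms with values multiplied by $b$; $\overline\sigma(\beta_1,\beta_2)=\beta_1\wedge^{\sigma}\beta_2$. A generalized $p$-form is a pair $\mathscr M=(a,a')$ of a $p$-form and a $(p+1)$-form,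 with $$\mathbf d(a,a')=(da+(-1)^{p+1}k\,a',\,da'),\qquad \star(a,a')=((-1)^{n-p-1}\ast a',\,\ast a),$$ $$(a,a')\wedge^{b}(c,c')=(a\wedge^{b}c,\;a\wedge^{b}c'+(-1)^q a'\wedge^{b}c)\quad\text{if }(c,c')\text{ has degree }q,$$ $\ll\cdot,\cdot\gg$ being this product for $b=\langle\cdot,\cdot\rangle$ and $\overline\sigma(\cdot,\cdot)$ this product for $b=\sigma$; $\alpha,\alpha^*$ act componentwise; and $\int_{(\partial M,M)}(a,a')=\int_M a'$. (Forms of negative degree are $0$.) Let $\overset1A,\overset2A$ be smooth $\mathfrak g$-valued forms of degrees $1,2$ and $\overset2B,\overset3B$ smooth $\mathfrak h$-valued forms of degrees $2,3$ on $M$; $\mathscr A=(\overset1A,\overset2A)$, $\mathscr B=(\overset2B,\overset3B)$, $$\mathscr F=\mathbf d\mathscr A+\mathscr A\wedge\mathscr A-\alpha(\mathscr B),\qquad \mathscr G=\mathbf d\mathscr B+\mathscr A\wedge^{\vartriangleright}\mathscr B,$$ where $\mathscr A\wedge\mathscr A=\tfrac12\mathscr A\wedge^{[,]}\mathscr A$.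 Put $D=d+\overset1A\wedge^{[,]}$ on $\mathfrak g$-valued and $D=d+\overset1A\wedge^{\vartriangleright}$ on $\mathfrak h$-valued forms, $\mathbb F=d\overset1A+\overset1A\wedge\overset1A-\alpha(\overset2B)$, $\mathbb G=D\overset2B$. Consider the action $$S=\int_{(\partial M,M)}\ll\mathscr F,\star\mathscr F\gg+\ll\mathscr G,\star\mathscr G\gg .$$ Fields are called stationary if for every compact $K\subseteq M$ the derivative at $t=0$ of the action over $K$ vanishes along $t\mapsto$ field $+\,t\,\delta$ for all smooth variations $\delta$ supported in $K$ and in the interior of $M$. **Claim.** (1) $S$ is stationary with respect to $\overset1A$, respectively $\overset2A$, $\overset2B$, $\overset3B$, if and only if the first, respectively second, third, fourth of the following equations holds, and it is stationary under simultaneous variations of all fields if and only if all four hold: $$D\ast(\mathbb F+k\overset2A)+\overset2A\wedge^{[,]}\ast(D\overset2A-\alpha(\overset3B))-\overline\sigma(\ast(\mathbb G-k\overset3B),\overset2B)+(-1)^{n+1}\overline\sigma(\ast(D\overset3B+\overset2A\wedge^{\vartriangleright}\overset2B),\overset3B)=0,$$ $$D\ast(D\overset2A-\alpha(\overset3B))-k\ast(\mathbb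 F+k\overset2A)+\overline\sigma(\ast(D\overset3B+\overset2A\wedge^{\vartriangleright}\overset2B),\overset2B)=0,$$ $$D\ast(\mathbb G-k\overset3B)+\alpha^*(\ast(\mathbb F+k\overset2A))+\overset2A\wedge^{\vartriangleright}\ast(D\overset3B+\overset2A\wedge^{\vartriangleright}\overset2B)=0,$$ $$D\ast(D\overset3B+\overset2A\wedge^{\vartriangleright}\overset2B)-\alpha^*(\ast(D\overset2A-\alpha(\overset3B)))-k\ast(\mathbb G-k\overset3B)=0.$$ (2) These four equations together are equivalent to the two equations $$\mathbf d\star\mathscr F+\mathscr A\wedge^{[,]}\star\mathscr F=\overline\sigma(\star\mathscr G,\mathscr B),\qquad \mathbf d\star\mathscr G+\mathscr A\wedge^{\vartriangleright}\star\mathscr G=-\alpha^*(\star\mathscr F).$$ (3) If $\overset2A=0$ and $\overset3B=0$, the action (over any part of $M$) equals the ordinary 2-form Yang–Mills action $\int\langle\mathbb F,\ast\mathbb F\rangle+\langle\mathbb G,\ast\mathbb G\rangle$; this ordinary action is stationary with respect to $\overset1A$ if and only if $D\ast\mathbb F=\overline\sigma(\ast\mathbb G,\overset2B)$, with respect to $\overset2B$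 if and only if $D\ast\mathbb G=-\alpha^*(\ast\mathbb F)$, and with respect to both simultaneously if and only if both ordinary 2-form Yang–Mills equations hold. In this case the first and third of the four equations become exactly these two ordinary equations, while the second and the fourth become the flatness conditions $\mathbb F=0$ and $\mathbb G=0$. -/

import Mathlib

open scoped Manifold ContDiff Topology Nat
open MeasureTheory Set

noncomputable section

namespace HigherYM

/-! ### Multilinear algebra -/

section Algebra

variable {E V W U : Type*} [NormedAddCommGroup E] [NormedSpace ℝ E]
  [NormedAddCommGroup V] [NormedSpace ℝ V] [NormedAddCommGroup W] [NormedSpace ℝ W]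
  [NormedAddCommGroup U] [NormedSpace ℝ U]

/-- Transport of an alternating map along an equality of degrees. -/
def castDeg {p q : ℕ} (h : p = q) (a : E [⋀^Fin p]→L[ℝ] V) : E [⋀^Fin q]→L[ℝ] V := h ▸ a

/-- `(v₁, …, v_{p+q}) ↦ B (a (v₁, …, v_p)) (b (v_{p+1}, …, v_{p+q}))`. -/
def mulForm (B : V →L[ℝ] W →L[ℝ] U) {p q : ℕ} (a : E [⋀^Fin p]→L[ℝ] V)
    (b : E [⋀^Fin q]→L[ℝ] W) : ContinuousMultilinearMap ℝ (fun _ : Fin (p + q) => E) U where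
  toFun v := B (a fun i => v (Fin.castAdd q i)) (b fun j => v (Fin.natAdd p j))
  map_update_add' := by
    intro inst v i x y
    obtain rfl : inst = instDecidableEqFin (p + q) := Subsingleton.elim _ _
    refine Fin.addCases (fun i => ?_) (fun j => ?_) i
    · have h1 : ∀ z, (fun k => Function.update v (Fin.castAdd q i) z (Fin.castAdd q k))
          = Function.update (fun k => v (Fin.castAdd q k)) i z := by
        intro z; ext1 k
        by_cases hk : k = i
        · subst hk; simp
        · rw [Function.update_of_ne hk, Function.update_of_ne]
          exact fun h => hk (Fin.castAdd_injective p q h)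
      have h2 : ∀ z, (fun k => Function.update v (Fin.castAdd q i) z (Fin.natAdd p k))
          = fun k => v (Fin.natAdd p k) := by
        intro z; ext1 k
        rw [Function.update_of_ne]
        intro h; have := congrArg Fin.val h; simp at this; omega
      simp only [h1, h2, ContinuousAlternatingMap.map_update_add, map_add, add_apply]
    · have h1 : ∀ z, (fun k => Function.update v (Fin.natAdd p j) z (Fin.natAdd p k))
          = Function.update (fun k => v (Fin.natAdd p k)) j z := by
        intro z; ext1 k
        by_cases hk : k = j
        · subst hk; simp
        · rw [Function.update_of_ne hk, Function.update_of_ne]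
          exact fun h => hk (Fin.natAdd_injective q p h)
      have h2 : ∀ z, (fun k => Function.update v (Fin.natAdd p j) z (Fin.castAdd q k))
          = fun k => v (Fin.castAdd q k) := by
        intro z; ext1 k
        rw [Function.update_of_ne]
        intro h; have := congrArg Fin.val h; simp at this; omega
      simp only [h1, h2, ContinuousAlternatingMap.map_update_add, map_add]
  map_update_smul' := by
    intro inst v i c x
    obtain rfl : inst = instDecidableEqFin (p + q) := Subsingleton.elim _ _
    refine Fin.addCases (fun i => ?_) (fun j => ?_) i
    · have h1 : ∀ z, (fun k => Function.update v (Fin.castAdd q i) z (Fin.castAdd q k))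
          = Function.update (fun k => v (Fin.castAdd q k)) i z := by
        intro z; ext1 k
        by_cases hk : k = i
        · subst hk; simp
        · rw [Function.update_of_ne hk, Function.update_of_ne]
          exact fun h => hk (Fin.castAdd_injective p q h)
      have h2 : ∀ z, (fun k => Function.update v (Fin.castAdd q i) z (Fin.natAdd p k))
          = fun k => v (Fin.natAdd p k) := by
        intro z; ext1 k
        rw [Function.update_of_ne]
        intro h; have := congrArg Fin.val h; simp at this; omega
      simp only [h1, h2, ContinuousAlternatingMap.map_update_smul, map_smul, smul_apply]
    · have h1 : ∀ z, (fun k => Function.update v (Fin.natAdd p j) z (Fin.natAdd p k))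
          = Function.update (fun k => v (Fin.natAdd p k)) j z := by
        intro z; ext1 k
        by_cases hk : k = j
        · subst hk; simp
        · rw [Function.update_of_ne hk, Function.update_of_ne]
          exact fun h => hk (Fin.natAdd_injective q p h)
      have h2 : ∀ z, (fun k => Function.update v (Fin.natAdd p j) z (Fin.castAdd q k))
          = fun k => v (Fin.castAdd q k) := by
        intro z; ext1 k
        rw [Function.update_of_ne]
        intro h; have := congrArg Fin.val h; simp at this; omega
      simp only [h1, h2, ContinuousAlternatingMap.map_update_smul, map_smul]
  cont := by
    have h1 : Continuous fun v : Fin (p + q) → E => a fun i => v (Fin.castAdd q i) :=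
      a.cont.comp (by fun_prop)
    have h2 : Continuous fun v : Fin (p + q) → E => b fun j => v (Fin.natAdd p j) :=
      b.cont.comp (by fun_prop)
    exact (B.continuous.comp h1).clm_apply h2

/-- The exterior product of alternating maps, with values paired by the bilinear map `B`:
`(a ∧ b)(v₁, …, v_{p+q}) = 1/(p! q!) ∑_σ sgn σ · B (a (v_{σ1}, …, v_{σp})) (b (v_{σ(p+1)}, …))`. -/
def wedgeAlt (B : V →L[ℝ] W →L[ℝ] U) {p q : ℕ} (a : E [⋀^Fin p]→L[ℝ] V)
    (b : E [⋀^Fin q]→L[ℝ] W) : E [⋀^Fin (p + q)]→L[ℝ] U :=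
  ((p ! * q ! : ℝ)⁻¹) • ContinuousMultilinearMap.alternatization (mulForm B a b)

/-- `contract p θ w = θ (w₁, …, w_p, ·, …, ·)`. -/
def contract {q : ℕ} : (p : ℕ) → (E [⋀^Fin (q + p)]→L[ℝ] V) → (Fin p → E) → E [⋀^Fin q]→L[ℝ] V
  | 0, θ, _ => θ
  | p + 1, θ, w => contract p (θ.curryLeft (w 0)) (Fin.tail w)

end Algebra

/-! ### Differential forms on a manifold

Mathlib identifies the tangent space at `x` with the model space by means of the preferred chart
at `x`. Accordingly the value at `x` of a form is an alternating map on the model space. -/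

/-- The model space `ℝⁿ`. -/
abbrev Euc (n : ℕ) : Type := EuclideanSpace ℝ (Fin n)

/-- (Not necessarily smooth or homogeneous) `V`-valued differential forms: `θ p x` is the
component of degree `p` at the point `x`. -/
abbrev DForm (n : ℕ) (M V : Type*) [NormedAddCommGroup V] [NormedSpace ℝ V] : Type _ :=
  (p : ℕ) → M → (Euc n) [⋀^Fin p]→L[ℝ] V

section Forms

variable {n : ℕ} {H : Type*} [TopologicalSpace H] (I : ModelWithCorners ℝ (Euc n) H)
  {M : Type*} [TopologicalSpace M] [ChartedSpace H M] [IsManifold I ∞ M]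
  {V : Type*} [NormedAddCommGroup V] [NormedSpace ℝ V]

/-- The expression of a form in the chart centred at `x₀`, that is, its pullback under the inverse
of that chart. -/
def inChart {p : ℕ} (θ : M → (Euc n) [⋀^Fin p]→L[ℝ] V) (x₀ : M) (y : Euc n) :
    (Euc n) [⋀^Fin p]→L[ℝ] V :=
  (θ ((extChartAt I x₀).symm y)).compContinuousLinearMap
    (tangentCoordChange I x₀ ((extChartAt I x₀).symm y) ((extChartAt I x₀).symm y))

/-- `IsForm I p θ` says `θ ∈ Λ^p(M, V)`: `θ` is a smooth form, homogeneous of degree `p`.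
For `p < 0` only `θ = 0` qualifies. -/
def IsForm (p : ℤ) (θ : DForm n M V) : Prop :=
  (∀ q : ℕ, (q : ℤ) ≠ p → θ q = 0) ∧
    ∀ (q : ℕ) (x₀ : M), ContDiffOn ℝ ∞ (inChart I (θ q) x₀) (extChartAt I x₀).target

/-- The exterior derivative, computed at each point `x` in the preferred chart at `x`. -/
def d (θ : DForm n M V) : DForm n M V
  | 0, _ => 0
  | p + 1, x => extDerivWithin (inChart I (θ p) x) (range I) (extChartAt I x x)

/-- The support of a form. -/
def supp (θ : DForm n M V) : Set M := closure {x | ∃ p, θ p x ≠ 0}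

end Forms

section Values

variable {𝕜 : Type*} [RCLike 𝕜] {n : ℕ} {M : Type*}
  {V W U : Type*}
  [NormedAddCommGroup V] [NormedSpace ℝ V] [NormedSpace 𝕜 V] [IsScalarTower ℝ 𝕜 V]
  [FiniteDimensional 𝕜 V]
  [NormedAddCommGroup W] [NormedSpace ℝ W] [NormedSpace 𝕜 W] [IsScalarTower ℝ 𝕜 W]
  [FiniteDimensional 𝕜 W]
  [NormedAddCommGroup U] [NormedSpace ℝ U] [NormedSpace 𝕜 U] [IsScalarTower ℝ 𝕜 U]

/-- A `𝕜`-linear map between finite-dimensional spaces as a continuous real-linear map. -/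
def realLinear (f : V →ₗ[𝕜] U) : V →L[ℝ] U :=
  haveI : FiniteDimensional ℝ V := FiniteDimensional.trans ℝ 𝕜 V
  LinearMap.toContinuousLinearMap (f.restrictScalars ℝ)

/-- A `𝕜`-bilinear map on finite-dimensional spaces as a continuous real-bilinear map. -/
def realBilinear (B : V →ₗ[𝕜] W →ₗ[𝕜] U) : V →L[ℝ] W →L[ℝ] U :=
  haveI : FiniteDimensional ℝ V := FiniteDimensional.trans ℝ 𝕜 V
  haveI : FiniteDimensional ℝ W := FiniteDimensional.trans ℝ 𝕜 W
  LinearMap.toContinuousBilinearMap (B.restrictScalars₁₂ ℝ ℝ)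

/-- The exterior product `θ ∧^B η` of vector-valued forms: if `θ = ∑ θᵃ vₐ` and `η = ∑ ηᵇ w_b`, then
`θ ∧^B η = ∑ θᵃ ∧ ηᵇ B(vₐ, w_b)`. -/
def wedge (B : V →ₗ[𝕜] W →ₗ[𝕜] U) (θ : DForm n M V) (η : DForm n M W) : DForm n M U :=
  fun r x => ∑ i : Fin (r + 1),
    castDeg (Nat.add_sub_of_le (Nat.le_of_lt_succ i.2))
      (wedgeAlt (realBilinear B) (θ i x) (η (r - i) x))

/-- A linear map applied to the values of a form. -/
def mapForm (f : V →ₗ[𝕜] U) (θ : DForm n M V) : DForm n M U :=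
  fun p x => (realLinear f).compContinuousAlternatingMap (θ p x)

end Values

/-! ### Metric, orientation, Hodge star, integration -/

section Metric

variable {n : ℕ} {H : Type*} [TopologicalSpace H] (I : ModelWithCorners ℝ (Euc n) H)
  (M : Type*) [TopologicalSpace M] [ChartedSpace H M] [IsManifold I ∞ M]

/-- A smooth (pseudo-)Riemannian metric, of arbitrary signature. -/
structure Metric where
  val : M → Euc n →L[ℝ] Euc n →L[ℝ] ℝ
  symm : ∀ x v w, val x v w = val x w v
  nondegenerate : ∀ x v, (∀ w, val x v w = 0) → v = 0
  smooth : ∀ (x₀ : M) (v w : Euc n), ContDiffOn ℝ ∞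
    (fun y => val ((extChartAt I x₀).symm y)
      (tangentCoordChange I x₀ ((extChartAt I x₀).symm y) ((extChartAt I x₀).symm y) v)
      (tangentCoordChange I x₀ ((extChartAt I x₀).symm y) ((extChartAt I x₀).symm y) w))
    (extChartAt I x₀).target

/-- An orientation of `M`: `sign x = 1` if the coordinate frame at `x` of the preferred chart at `x`
is positively oriented, and `sign x = -1` otherwise. The last field is local constancy. -/
structure Orient where
  sign : M → ℝ
  sign_eq : ∀ x, sign x = 1 ∨ sign x = -1
  locally_constant : ∀ x₀, ∀ᶠ x in 𝓝 x₀,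
    0 < sign x₀ * sign x * LinearMap.det (tangentCoordChange I x₀ x x : Euc n →ₗ[ℝ] Euc n)

end Metric

section Star

variable {n : ℕ} {H : Type*} [TopologicalSpace H] {I : ModelWithCorners ℝ (Euc n) H}
  {M : Type*} [TopologicalSpace M] [ChartedSpace H M] [IsManifold I ∞ M]
  {V : Type*} [NormedAddCommGroup V] [NormedSpace ℝ V]

/-- The standard frame `e₁, …, eₙ` of the model space. -/
def frame (i : Fin n) : Euc n := EuclideanSpace.single i 1

/-- The determinant `(v₁, …, vₙ) ↦ det (v₁, …, vₙ)` as an alternating form. -/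
def detForm (n : ℕ) : (Euc n) [⋀^Fin n]→L[ℝ] ℝ :=
  { (EuclideanSpace.basisFun (Fin n) ℝ).toBasis.det with
    cont := by
      change Continuous fun v : Fin n → Euc n =>
        (EuclideanSpace.basisFun (Fin n) ℝ).toBasis.det v
      simp only [Module.Basis.det_apply]
      refine Continuous.matrix_det ?_
      refine continuous_matrix fun i j => ?_
      simp only [Module.Basis.toMatrix_apply, OrthonormalBasis.coe_toBasis_repr_apply,
        EuclideanSpace.basisFun_repr]
      fun_prop }

/-- The Gram matrix of the frame at `x`. -/
def gram (g : Metric I M) (x : M) : Matrix (Fin n) (Fin n) ℝ :=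
  Matrix.of fun i j => g.val x (frame i) (frame j)

/-- The reciprocal frame `e^i = ∑ⱼ g^{ij} eⱼ` at `x`, characterised by `g(e^i, eⱼ) = δ_{ij}`. -/
def coframe (g : Metric I M) (x : M) (i : Fin n) : Euc n :=
  ∑ j, (gram g x)⁻¹ i j • frame j

/-- The volume form of the oriented manifold. -/
def volForm (g : Metric I M) (o : Orient I M) (x : M) : (Euc n) [⋀^Fin n]→L[ℝ] ℝ :=
  (o.sign x * √|(gram g x).det|) • detForm n

/-- The Hodge dual at `x` of an alternating map `β` of degree `p`:
`(∗β)(v) = 1/p! ∑_{i₁, …, i_p} β(e^{i₁}, …, e^{i_p}) vol(e_{i₁}, …, e_{i_p}, v)`.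
This is the map with `α ∧ ∗β = (α, β) vol` for all `α` of degree `p`. -/
def hodge (g : Metric I M) (o : Orient I M) (x : M) {p q : ℕ} (h : n = q + p)
    (β : (Euc n) [⋀^Fin p]→L[ℝ] V) : (Euc n) [⋀^Fin q]→L[ℝ] V :=
  ∑ f : Fin p → Fin n, ((p ! : ℝ)⁻¹) •
    (contract p (castDeg h (volForm g o x)) (fun k => frame (f k))).smulRight
      (β fun k => coframe g x (f k))

/-- The Hodge star operator on forms. -/
def hodgeStar (g : Metric I M) (o : Orient I M) (θ : DForm n M V) : DForm n M V :=
  fun q x => if h : q ≤ n then hodge g o x (Nat.add_sub_of_le h).symm (θ (n - q) x) else 0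

/-- The volume measure of the chart centred at `x₀`: Lebesgue measure with density
`√|det g_{ij}|` on the image of the chart, transported to `M`. -/
def chartVolume [MeasurableSpace M] (g : Metric I M) (x₀ : M) : Measure M :=
  Measure.map (extChartAt I x₀).symm
    ((volume.restrict (extChartAt I x₀).target).withDensity fun y =>
      ENNReal.ofReal √|(Matrix.of fun i j : Fin n => g.val ((extChartAt I x₀).symm y)
        (tangentCoordChange I x₀ ((extChartAt I x₀).symm y) ((extChartAt I x₀).symm y) (frame i))
        (tangentCoordChange I x₀ ((extChartAt I x₀).symm y) ((extChartAt I x₀).symm y)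
          (frame j))).det|)

/-- The volume measure of the metric: the chart measures agree on overlaps, and their supremum is
the measure on `M` that restricts to each of them. -/
def volMeasure [MeasurableSpace M] (g : Metric I M) : Measure M := ⨆ x₀ : M, chartVolume g x₀

/-- The integral over `K ⊆ M` of the component of degree `n` of `θ`: writing this component as
`f • vol`, it is the integral of `f` with respect to the volume measure. -/
def formIntegral [MeasurableSpace M] (g : Metric I M) (o : Orient I M) (K : Set M)
    (θ : DForm n M V) : V :=
  ∫ x in K, (volForm g o x frame)⁻¹ • θ n x frame ∂(volMeasure g)

end Star

/-! ### Generalized forms of type 1 -/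

/-- A generalized `p`-form is a pair of a `p`-form and a `(p+1)`-form. -/
abbrev GForm (n : ℕ) (M V : Type*) [NormedAddCommGroup V] [NormedSpace ℝ V] : Type _ :=
  DForm n M V × DForm n M V

section Generalized

variable {𝕜 : Type*} [RCLike 𝕜] {n : ℕ} {H : Type*} [TopologicalSpace H]
  {I : ModelWithCorners ℝ (Euc n) H}
  {M : Type*} [TopologicalSpace M] [ChartedSpace H M] [IsManifold I ∞ M]
  {V W U : Type*}
  [NormedAddCommGroup V] [NormedSpace ℝ V] [NormedSpace 𝕜 V] [IsScalarTower ℝ 𝕜 V]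
  [NormedAddCommGroup W] [NormedSpace ℝ W] [NormedSpace 𝕜 W] [IsScalarTower ℝ 𝕜 W]
  [NormedAddCommGroup U] [NormedSpace ℝ U] [NormedSpace 𝕜 U] [IsScalarTower ℝ 𝕜 U]

variable (I) in
/-- The generalized exterior derivative of a generalized `p`-form:
`𝐝(a, a') = (da + (-1)^{p+1} k a', da')`. -/
def gd (k : 𝕜) (p : ℤ) (m : GForm n M V) : GForm n M V :=
  (d I m.1 + ((-1 : 𝕜) ^ (p + 1) * k) • m.2, d I m.2)

/-- The generalized exterior product with a generalized `q`-form, values being paired by `B`: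
`(a, a') ∧ (b, b') = (a ∧ b, a ∧ b' + (-1)^q a' ∧ b)`. -/
def gwedge [FiniteDimensional 𝕜 V] [FiniteDimensional 𝕜 W] (B : V →ₗ[𝕜] W →ₗ[𝕜] U) (q : ℤ)
    (m : GForm n M V) (m' : GForm n M W) : GForm n M U :=
  (wedge B m.1 m'.1, wedge B m.1 m'.2 + (-1 : 𝕜) ^ q • wedge B m.2 m'.1)

/-- A linear map applied to the values of a generalized form. -/
def gmap [FiniteDimensional 𝕜 V] (f : V →ₗ[𝕜] U) (m : GForm n M V) : GForm n M U :=
  (mapForm f m.1, mapForm f m.2)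

/-- The generalized Hodge star of a generalized `p`-form:
`⋆(a, a') = ((-1)^{n-p-1} ∗a', ∗a)`, a generalized `(n-p-1)`-form. -/
def gstar (g : Metric I M) (o : Orient I M) (p : ℤ) (m : GForm n M V) : GForm n M V :=
  ((-1 : ℝ) ^ ((n : ℤ) - p - 1) • hodgeStar g o m.2, hodgeStar g o m.1)

/-- The integral of a generalized `(n-1)`-form `(a, a')` over `(∂M, M)` is `∫_M a'`; here the
integral is taken over a part `K` of `M`. -/
def gintegral [MeasurableSpace M] (g : Metric I M) (o : Orient I M) (K : Set M)
    (m : GForm n M V) : V :=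
  formIntegral g o K m.2

end Generalized

/-! ### Differential crossed modules -/

/-- A differential crossed module `(𝔥, 𝔤; α, ▷)`, with the brackets of both Lie algebras. -/
structure DifferentialCrossedModule (𝕜 𝔤 𝔥 : Type*) [Field 𝕜] [AddCommGroup 𝔤] [Module 𝕜 𝔤]
    [AddCommGroup 𝔥] [Module 𝕜 𝔥] where
  /-- the bracket of `𝔤` -/
  brG : 𝔤 →ₗ[𝕜] 𝔤 →ₗ[𝕜] 𝔤
  brG_self : ∀ X, brG X X = 0
  brG_jacobi : ∀ X Y Z, brG X (brG Y Z) = brG (brG X Y) Z + brG Y (brG X Z)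
  /-- the bracket of `𝔥` -/
  brH : 𝔥 →ₗ[𝕜] 𝔥 →ₗ[𝕜] 𝔥
  brH_self : ∀ Y, brH Y Y = 0
  brH_jacobi : ∀ X Y Z, brH X (brH Y Z) = brH (brH X Y) Z + brH Y (brH X Z)
  /-- the Lie algebra map `α : 𝔥 → 𝔤` -/
  al : 𝔥 →ₗ[𝕜] 𝔤
  al_br : ∀ Y Y', al (brH Y Y') = brG (al Y) (al Y')
  /-- the action `X ▷ Y` of `𝔤` on `𝔥` by derivations -/
  act : 𝔤 →ₗ[𝕜] 𝔥 →ₗ[𝕜] 𝔥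
  act_br : ∀ X X' Y, act (brG X X') Y = act X (act X' Y) - act X' (act X Y)
  act_derivation : ∀ X Y Y', act X (brH Y Y') = brH (act X Y) Y' + brH Y (act X Y')
  al_act : ∀ X Y, al (act X Y) = brG X (al Y)
  peiffer : ∀ Y Y', act (al Y) Y' = brH Y Y'

section Invariant

variable {𝕜 : Type*} [RCLike 𝕜] {𝔤 𝔥 : Type*}
  [NormedAddCommGroup 𝔤] [NormedSpace 𝕜 𝔤] [FiniteDimensional 𝕜 𝔤]
  [NormedAddCommGroup 𝔥] [NormedSpace 𝕜 𝔥] [FiniteDimensional 𝕜 𝔥]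

/-- The operator `exp(T)` of a finite-dimensional space. -/
def expOp (T : 𝔥 →ₗ[𝕜] 𝔥) : 𝔥 →L[𝕜] 𝔥 := NormedSpace.exp (LinearMap.toContinuousLinearMap T)

/-- Symmetric nondegenerate `G`-invariant bilinear forms on `𝔤` and `𝔥`. The elements `exp X`,
`X ∈ 𝔤`, generate the connected gauge group `G`; they act on `𝔤` (adjoint action) by `exp(ad X)` and
on `𝔥` by `exp(X ▷)`. -/
structure InvariantForms (C : DifferentialCrossedModule 𝕜 𝔤 𝔥) where
  formG : LinearMap.BilinForm 𝕜 𝔤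
  formH : LinearMap.BilinForm 𝕜 𝔥
  symmG : ∀ X X', formG X X' = formG X' X
  symmH : ∀ Y Y', formH Y Y' = formH Y' Y
  nondegG : formG.Nondegenerate
  nondegH : formH.Nondegenerate
  invG : ∀ Z X X', formG (expOp (C.brG Z) X) (expOp (C.brG Z) X') = formG X X'
  invH : ∀ Z Y Y', formH (expOp (C.act Z) Y) (expOp (C.act Z) Y') = formH Y Y'

namespace InvariantForms

variable {C : DifferentialCrossedModule 𝕜 𝔤 𝔥} (S : InvariantForms C)

/-- `σ : 𝔥 × 𝔥 → 𝔤`, defined by `⟨σ(Y, Y'), X⟩ = -⟨Y, X ▷ Y'⟩`. -/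
def sigma : 𝔥 →ₗ[𝕜] 𝔥 →ₗ[𝕜] 𝔤 :=
  LinearMap.mk₂ 𝕜
    (fun Y Y' => (S.formG.toDual S.nondegG).symm (-((S.formH Y).comp (C.act.flip Y'))))
    (by intro a b c; rw [← map_add]; congr 1; ext X; simp; ring)
    (by intro r a b; rw [← map_smul]; congr 1; ext X; simp)
    (by intro a b c; rw [← map_add]; congr 1; ext X; simp; ring)
    (by intro r a b; rw [← map_smul]; congr 1; ext X; simp)

theorem sigma_spec (Y Y' : 𝔥) (X : 𝔤) :
    S.formG (S.sigma Y Y') X = -S.formH Y (C.act X Y') := by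
  simp only [sigma, LinearMap.mk₂_apply]
  rw [← LinearMap.BilinForm.toDual_def S.nondegG, LinearEquiv.apply_symm_apply]
  simp

/-- `α* : 𝔤 → 𝔥`, defined by `⟨Y, α*(X)⟩ = ⟨α(Y), X⟩`. -/
def alStar : 𝔤 →ₗ[𝕜] 𝔥 :=
  (S.formH.toDual S.nondegH).symm.toLinearMap ∘ₗ C.al.dualMap ∘ₗ S.formG

theorem alStar_spec (X : 𝔤) (Y : 𝔥) : S.formH Y (S.alStar X) = S.formG (C.al Y) X := by
  rw [S.symmH, S.symmG, ← LinearMap.BilinForm.toDual_def S.nondegH]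
  simp [alStar]

end InvariantForms

end Invariant

/-! ### Curvatures, actions, field equations -/

section YangMills

variable {𝕜 : Type*} [RCLike 𝕜] {𝔤 𝔥 : Type*}
  [NormedAddCommGroup 𝔤] [NormedSpace ℝ 𝔤] [NormedSpace 𝕜 𝔤] [IsScalarTower ℝ 𝕜 𝔤]
  [FiniteDimensional 𝕜 𝔤]
  [NormedAddCommGroup 𝔥] [NormedSpace ℝ 𝔥] [NormedSpace 𝕜 𝔥] [IsScalarTower ℝ 𝕜 𝔥]
  [FiniteDimensional 𝕜 𝔥]
  {n : ℕ} {H : Type*} [TopologicalSpace H] (I : ModelWithCorners ℝ (Euc n) H)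
  {M : Type*} [TopologicalSpace M] [ChartedSpace H M] [IsManifold I ∞ M]
  (C : DifferentialCrossedModule 𝕜 𝔤 𝔥)

/-- The covariant derivative `Dθ = dθ + A¹ ∧^{[,]} θ` of a `𝔤`-valued form. -/
def DG (A₁ θ : DForm n M 𝔤) : DForm n M 𝔤 := d I θ + wedge C.brG A₁ θ

/-- The covariant derivative `Dη = dη + A¹ ∧^▷ η` of an `𝔥`-valued form. -/
def DH (A₁ : DForm n M 𝔤) (η : DForm n M 𝔥) : DForm n M 𝔥 := d I η + wedge C.act A₁ η

/-- The ordinary curvature `𝔽 = dA¹ + A¹ ∧ A¹ - α(B²)`, with `A ∧ A = ½ A ∧^{[,]} A`. -/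
def curvF (A₁ : DForm n M 𝔤) (B₂ : DForm n M 𝔥) : DForm n M 𝔤 :=
  d I A₁ + (1 / 2 : 𝕜) • wedge C.brG A₁ A₁ - mapForm C.al B₂

/-- The ordinary curvature `𝔾 = dB² + A¹ ∧^▷ B²`. -/
def curvG (A₁ : DForm n M 𝔤) (B₂ : DForm n M 𝔥) : DForm n M 𝔥 := DH I C A₁ B₂

/-- The generalized curvature `𝓕 = 𝐝𝓐 + 𝓐 ∧ 𝓐 - α(𝓑)`, with `𝓐 ∧ 𝓐 = ½ 𝓐 ∧^{[,]} 𝓐`. -/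
def gcurvF (k : 𝕜) (A : GForm n M 𝔤) (B : GForm n M 𝔥) : GForm n M 𝔤 :=
  gd I k 1 A + (1 / 2 : 𝕜) • gwedge C.brG 1 A A - gmap C.al B

/-- The generalized curvature `𝓖 = 𝐝𝓑 + 𝓐 ∧^▶ 𝓑`. -/
def gcurvG (k : 𝕜) (A : GForm n M 𝔤) (B : GForm n M 𝔥) : GForm n M 𝔥 :=
  gd I k 2 B + gwedge C.act 2 A B

variable {C I}
variable (S : InvariantForms C) (g : Metric I M) (o : Orient I M)

/-- The generalized 2-form Yang–Mills action `∫ ⟪𝓕, ⋆𝓕⟫ + ⟪𝓖, ⋆𝓖⟫` over the part `K` of `M`, for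
`𝓐 = (A¹, A²)` and `𝓑 = (B², B³)`. -/
def gAction [MeasurableSpace M] (k : 𝕜) (K : Set M) (A₁ A₂ : DForm n M 𝔤) (B₂ B₃ : DForm n M 𝔥) :
    𝕜 :=
  gintegral g o K
    (gwedge S.formG ((n : ℤ) - 3) (gcurvF I C k (A₁, A₂) (B₂, B₃))
        (gstar g o 2 (gcurvF I C k (A₁, A₂) (B₂, B₃))) +
      gwedge S.formH ((n : ℤ) - 4) (gcurvG I C k (A₁, A₂) (B₂, B₃))
        (gstar g o 3 (gcurvG I C k (A₁, A₂) (B₂, B₃))))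

/-- The ordinary 2-form Yang–Mills action `∫ ⟨𝔽, ∗𝔽⟩ + ⟨𝔾, ∗𝔾⟩` over the part `K` of `M`. -/
def ordAction [MeasurableSpace M] (K : Set M) (A₁ : DForm n M 𝔤) (B₂ : DForm n M 𝔥) : 𝕜 :=
  formIntegral g o K
    (wedge S.formG (curvF I C A₁ B₂) (hodgeStar g o (curvF I C A₁ B₂)) +
      wedge S.formH (curvG I C A₁ B₂) (hodgeStar g o (curvG I C A₁ B₂)))

variable (I) in
/-- An admissible variation of a `p`-form over the compact set `K`: a smooth `p`-form
supported in `K` and away from the boundary of `M`. -/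
def IsVariation {V : Type*} [NormedAddCommGroup V] [NormedSpace ℝ V] (K : Set M) (p : ℤ)
    (δ : DForm n M V) : Prop :=
  IsForm I p δ ∧ supp δ ⊆ K ∩ I.interior M

variable (I) in
/-- `θ` is stationary for the functional `F` of `p`-forms: over each compact part `K` of `M`, the
variational derivative of `F` at `θ` exists and vanishes in the direction of each admissible
variation. -/
def Stationary {V : Type*} [NormedAddCommGroup V] [NormedSpace ℝ V] (p : ℤ)
    (F : Set M → DForm n M V → 𝕜) (θ : DForm n M V) : Prop :=
  ∀ K : Set M, IsCompact K → ∀ δ : DForm n M V, IsVariation I K p δ →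
    HasDerivAt (fun t : ℝ => F K (θ + t • δ)) 0 0

/-- Stationarity of the generalized action under simultaneous variations of all four fields. -/
def gStationary [MeasurableSpace M] (k : 𝕜) (A₁ A₂ : DForm n M 𝔤) (B₂ B₃ : DForm n M 𝔥) : Prop :=
  ∀ K : Set M, IsCompact K → ∀ (a₁ a₂ : DForm n M 𝔤) (b₂ b₃ : DForm n M 𝔥),
    IsVariation I K 1 a₁ → IsVariation I K 2 a₂ → IsVariation I K 2 b₂ → IsVariation I K 3 b₃ →
    HasDerivAt (fun t : ℝ =>
      gAction S g o k K (A₁ + t • a₁) (A₂ + t • a₂) (B₂ + t • b₂) (B₃ + t • b₃)) 0 0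

/-- Stationarity of the ordinary action under simultaneous variations of both fields. -/
def ordStationary [MeasurableSpace M] (A₁ : DForm n M 𝔤) (B₂ : DForm n M 𝔥) : Prop :=
  ∀ K : Set M, IsCompact K → ∀ (a₁ : DForm n M 𝔤) (b₂ : DForm n M 𝔥),
    IsVariation I K 1 a₁ → IsVariation I K 2 b₂ →
    HasDerivAt (fun t : ℝ => ordAction S g o K (A₁ + t • a₁) (B₂ + t • b₂)) 0 0

/-- The field equation of `A¹`. -/
def EqA₁ (k : 𝕜) (A₁ A₂ : DForm n M 𝔤) (B₂ B₃ : DForm n M 𝔥) : Prop :=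
  DG I C A₁ (hodgeStar g o (curvF I C A₁ B₂ + k • A₂))
    + wedge C.brG A₂ (hodgeStar g o (DG I C A₁ A₂ - mapForm C.al B₃))
    - wedge S.sigma (hodgeStar g o (curvG I C A₁ B₂ - k • B₃)) B₂
    + (-1 : 𝕜) ^ (n + 1) • wedge S.sigma (hodgeStar g o (DH I C A₁ B₃ + wedge C.act A₂ B₂)) B₃ = 0

/-- The field equation of `A²`. -/
def EqA₂ (k : 𝕜) (A₁ A₂ : DForm n M 𝔤) (B₂ B₃ : DForm n M 𝔥) : Prop :=
  DG I C A₁ (hodgeStar g o (DG I C A₁ A₂ - mapForm C.al B₃))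
    - k • hodgeStar g o (curvF I C A₁ B₂ + k • A₂)
    + wedge S.sigma (hodgeStar g o (DH I C A₁ B₃ + wedge C.act A₂ B₂)) B₂ = 0

/-- The field equation of `B²`. -/
def EqB₂ (k : 𝕜) (A₁ A₂ : DForm n M 𝔤) (B₂ B₃ : DForm n M 𝔥) : Prop :=
  DH I C A₁ (hodgeStar g o (curvG I C A₁ B₂ - k • B₃))
    + mapForm S.alStar (hodgeStar g o (curvF I C A₁ B₂ + k • A₂))
    + wedge C.act A₂ (hodgeStar g o (DH I C A₁ B₃ + wedge C.act A₂ B₂)) = 0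

/-- The field equation of `B³`. -/
def EqB₃ (k : 𝕜) (A₁ A₂ : DForm n M 𝔤) (B₂ B₃ : DForm n M 𝔥) : Prop :=
  DH I C A₁ (hodgeStar g o (DH I C A₁ B₃ + wedge C.act A₂ B₂))
    - mapForm S.alStar (hodgeStar g o (DG I C A₁ A₂ - mapForm C.al B₃))
    - k • hodgeStar g o (curvG I C A₁ B₂ - k • B₃) = 0

/-- The generalized field equation `𝐝⋆𝓕 + 𝓐 ∧^{[,]} ⋆𝓕 = σ̄(⋆𝓖, 𝓑)`. -/
def GEqF (k : 𝕜) (A : GForm n M 𝔤) (B : GForm n M 𝔥) : Prop :=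
  gd I k ((n : ℤ) - 3) (gstar g o 2 (gcurvF I C k A B))
    + gwedge C.brG ((n : ℤ) - 3) A (gstar g o 2 (gcurvF I C k A B))
    = gwedge S.sigma 2 (gstar g o 3 (gcurvG I C k A B)) B

/-- The generalized field equation `𝐝⋆𝓖 + 𝓐 ∧^▶ ⋆𝓖 = -α*(⋆𝓕)`. -/
def GEqG (k : 𝕜) (A : GForm n M 𝔤) (B : GForm n M 𝔥) : Prop :=
  gd I k ((n : ℤ) - 4) (gstar g o 3 (gcurvG I C k A B))
    + gwedge C.act ((n : ℤ) - 4) A (gstar g o 3 (gcurvG I C k A B))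
    = -gmap S.alStar (gstar g o 2 (gcurvF I C k A B))

/-- The ordinary 2-form Yang–Mills equation `D∗𝔽 = σ̄(∗𝔾, B²)`. -/
def OrdEqF (A₁ : DForm n M 𝔤) (B₂ : DForm n M 𝔥) : Prop :=
  DG I C A₁ (hodgeStar g o (curvF I C A₁ B₂)) = wedge S.sigma (hodgeStar g o (curvG I C A₁ B₂)) B₂

/-- The ordinary 2-form Yang–Mills equation `D∗𝔾 = -α*(∗𝔽)`. -/
def OrdEqG (A₁ : DForm n M 𝔤) (B₂ : DForm n M 𝔥) : Prop :=
  DH I C A₁ (hodgeStar g o (curvG I C A₁ B₂)) = -mapForm S.alStar (hodgeStar g o (curvF I C A₁ B₂))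

end YangMills

end HigherYM

end

open HigherYM

set_option linter.unusedSectionVars false

/-! Along a line of variations the action over a compact set is a polynomial in the parameter `t`.
Its derivative at zero is therefore an algebraic coefficient, and the field equations are what is
left of this coefficient after integration by parts.

Componentwise, the generalized curvatures consist of the four ordinary forms `X` = 𝔽 + kA², DA² -
α(B³), 𝔾 - kB³ and DB³ + A² ∧ B² (`gcurvF_eq`, `gcurvG_eq`). The signs in ⋆ and in the generalized
product cancel, so the Lagrangian is the sum of the four terms ⟨X, ∗X⟩ (`gAction_eq`). Under a
variation each `X` becomes X + tX₁ + t²X₂. Since ⟨X, ∗Y⟩ is symmetric (`wedge_hodgeStar_comm`), the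
derivative at zero is the sum of the integrals of 2⟨X₁, ∗X⟩.

Invariance of the forms under exponentials differentiates to skewness of ad and ▷
(`skew_of_exp_invariant`), which gives a covariant Leibniz rule (`wedge_covariant_left`). Together
with the adjunctions defining α* and σ, it rewrites the first variation as exact forms plus one
pairing of each field variation with its Euler expression (`firstVariation_eq`). The exact forms
integrate to zero by Stokes (`formIntegral_d`), because variations have compact support in the
interior. The fundamental lemma `eq_zero_of_forall_variation` turns the vanishing of a pairing for
all variations into an equation.

For the second claim, the difference of the two sides of each component of a generalized equation is
an Euler expression times 1 or a sign. For the third, setting A² = B³ = 0 leaves the ordinary action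
and equations, and the other two equations become k∗𝔽 = 0 and k∗𝔾 = 0, where ∗ is injective and k
can be divided out.

The rest is foundation. The wedge identities and the algebra behind the Leibniz rule come from sums
over permutations. The exterior derivative and Hodge star at a point are computed in the chart
preferred by that point, so both need naturality under change of chart (`inChart_extD`,
`inChart_hodge`) before they can be differentiated or integrated. The volume measure is a supremum
of chart measures and has to be shown to restrict to each of them (`volMeasure_restrict`). -/

noncomputable section

namespace HigherYM

/-! ### Alternating sums over permutations, and signs of block permutations. -/

section AltSum

variable {E U : Type*} [AddCommGroup U] {m n : ℕ}

/-- The alternating sum of a function of `n` variables over all permutations of the variables. -/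
def altSum (F : (Fin n → E) → U) (v : Fin n → E) : U :=
  ∑ σ : Equiv.Perm (Fin n), Equiv.Perm.sign σ • F (v ∘ σ)

/-- The sum is reindexed by `σ ↦ σ * π`. Most signs in the wedge calculus below are this identity
for one explicit permutation. -/
theorem altSum_comp_perm (F : (Fin n → E) → U) (π : Equiv.Perm (Fin n)) :
    altSum (fun v => F (v ∘ π)) = Equiv.Perm.sign π • altSum F := by
  ext v
  simp only [altSum, Pi.smul_apply, Finset.smul_sum]
  refine Fintype.sum_equiv (Equiv.mulRight π) _ _ fun σ => ?_
  simp only [Equiv.coe_mulRight, Equiv.Perm.sign_mul, Equiv.Perm.coe_mul, smul_smul,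
    Function.comp_assoc]
  rw [mul_comm, mul_assoc, Int.units_mul_self, mul_one]

theorem altSum_sum {ι : Type*} (s : Finset ι) (F : ι → (Fin n → E) → U) :
    altSum (fun v => ∑ i ∈ s, F i v) = ∑ i ∈ s, altSum (F i) := by
  ext v
  simp only [altSum, Finset.sum_apply, Finset.smul_sum]
  rw [Finset.sum_comm]

theorem altSum_units_smul (c : ℤˣ) (F : (Fin n → E) → U) :
    altSum (fun v => c • F v) = c • altSum F := by
  ext v
  simp only [altSum, Pi.smul_apply, Finset.smul_sum, smul_smul, mul_comm]

theorem altSum_smul [Module ℝ U] (c : ℝ) (F : (Fin n → E) → U) :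
    altSum (fun v => c • F v) = c • altSum F := by
  ext v
  simp only [altSum, Pi.smul_apply, Finset.smul_sum, smul_comm c]

/-- An inner alternating sum over a block of the variables only contributes a factorial. -/
theorem altSum_block [Module ℝ U] (e : Equiv.Perm (Fin m) → Equiv.Perm (Fin n))
    (he : ∀ τ, Equiv.Perm.sign (e τ) = Equiv.Perm.sign τ) (F : (Fin n → E) → U) :
    altSum (fun v => ∑ τ, Equiv.Perm.sign τ • F (v ∘ e τ)) = (m ! : ℝ) • altSum F := by
  rw [altSum_sum]
  have : ∀ τ, altSum (fun v => Equiv.Perm.sign τ • F (v ∘ e τ)) = altSum F := by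
    intro τ
    rw [altSum_units_smul, altSum_comp_perm, he, smul_smul, Int.units_mul_self, one_smul]
  simp only [this, Finset.sum_const, Finset.card_univ, Fintype.card_perm, Fintype.card_fin]
  ext v
  simp [Nat.cast_smul_eq_nsmul]

theorem altSum_cast (h : m = n) (F : (Fin m → E) → U) (v : Fin n → E) :
    altSum F (v ∘ Fin.cast h) = altSum (fun w => F (w ∘ Fin.cast h)) v := by
  subst h; rfl

/-- A permutation of the first `p` indices. -/
def permLeft (p q : ℕ) (τ : Equiv.Perm (Fin p)) : Equiv.Perm (Fin (p + q)) :=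
  finSumFinEquiv.permCongr (Equiv.Perm.sumCongr τ 1)

/-- A permutation of the last `q` indices. -/
def permRight (p q : ℕ) (τ : Equiv.Perm (Fin q)) : Equiv.Perm (Fin (p + q)) :=
  finSumFinEquiv.permCongr (Equiv.Perm.sumCongr 1 τ)

theorem sign_permLeft (p q : ℕ) (τ : Equiv.Perm (Fin p)) :
    Equiv.Perm.sign (permLeft p q τ) = Equiv.Perm.sign τ := by
  rw [permLeft, Equiv.Perm.sign_permCongr]; simp [Equiv.Perm.sign_sumCongr]

theorem sign_permRight (p q : ℕ) (τ : Equiv.Perm (Fin q)) :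
    Equiv.Perm.sign (permRight p q τ) = Equiv.Perm.sign τ := by
  rw [permRight, Equiv.Perm.sign_permCongr]; simp [Equiv.Perm.sign_sumCongr]

@[simp] theorem permLeft_castAdd (p q : ℕ) (τ : Equiv.Perm (Fin p)) (i : Fin p) :
    permLeft p q τ (Fin.castAdd q i) = Fin.castAdd q (τ i) := by
  simp [permLeft, Equiv.permCongr_apply]

@[simp] theorem permLeft_natAdd (p q : ℕ) (τ : Equiv.Perm (Fin p)) (i : Fin q) :
    permLeft p q τ (Fin.natAdd p i) = Fin.natAdd p i := by
  simp [permLeft, Equiv.permCongr_apply]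

@[simp] theorem permRight_castAdd (p q : ℕ) (τ : Equiv.Perm (Fin q)) (i : Fin p) :
    permRight p q τ (Fin.castAdd q i) = Fin.castAdd q i := by
  simp [permRight, Equiv.permCongr_apply]

@[simp] theorem permRight_natAdd (p q : ℕ) (τ : Equiv.Perm (Fin q)) (i : Fin q) :
    permRight p q τ (Fin.natAdd p i) = Fin.natAdd p (τ i) := by
  simp [permRight, Equiv.permCongr_apply]

/-- The exchange of a block of `p` indices with a block of `q` indices. -/
def permFlip (p q : ℕ) : Equiv.Perm (Fin (q + p)) :=
  finAddFlip.trans (finCongr (Nat.add_comm p q))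

theorem permFlip_castAdd (p q : ℕ) (i : Fin q) :
    permFlip p q (Fin.castAdd p i) = Fin.cast (Nat.add_comm p q) (Fin.natAdd p i) := by
  simp [permFlip]

theorem permFlip_natAdd (p q : ℕ) (i : Fin p) :
    permFlip p q (Fin.natAdd q i) = Fin.cast (Nat.add_comm p q) (Fin.castAdd q i) := by
  simp [permFlip]

/-- On N + 1 = p + q points the block exchange is the `p`-th power of the cyclic rotation, which has
sign (-1)^N. Then Np = pq + p(p - 1), and p(p - 1) is even. The empty index set is treated apart
because it is not of the form N + 1. -/
theorem sign_permFlip (p q : ℕ) : Equiv.Perm.sign (permFlip p q) = (-1) ^ (p * q) := by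
  obtain ⟨N, hN⟩ | h0 : (∃ N, q + p = N + 1) ∨ q + p = 0 := by
    rcases q + p with _ | N
    · right; rfl
    · left; exact ⟨N, rfl⟩
  · have hrot : ∀ (N : ℕ) (k : ℕ) (i : Fin (N + 1)),
        (((finRotate (N + 1)) ^ k) i : ℕ) = (i + k) % (N + 1) := by
      intro N k
      induction k with
      | zero => intro i; simp [Nat.mod_eq_of_lt i.2]
      | succ k ih =>
        intro i
        rw [pow_succ', Equiv.Perm.mul_apply, finRotate_apply, Fin.val_add, ih, Fin.val_one',
          ← Nat.add_mod, add_assoc]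
    have key : permFlip p q = (finCongr hN).symm.permCongr ((finRotate (N + 1)) ^ p) := by
      ext i
      simp only [Equiv.permCongr_apply, finCongr_symm, finCongr_apply, Fin.val_cast,
        hrot]
      refine Fin.addCases (fun i => ?_) (fun i => ?_) i
      · rw [permFlip_castAdd]
        simp only [Fin.val_cast, Fin.val_natAdd, Fin.val_castAdd]
        rw [Nat.mod_eq_of_lt (by omega)]; omega
      · rw [permFlip_natAdd]
        simp only [Fin.val_cast, Fin.val_natAdd, Fin.val_castAdd]
        rw [show q + (i : ℕ) + p = i + (N + 1) by omega, Nat.add_mod_right,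
          Nat.mod_eq_of_lt (by omega)]
    rw [key, Equiv.Perm.sign_permCongr, map_pow, sign_finRotate, ← pow_mul]
    have hN' : N + 1 - 1 = N := rfl
    rw [hN', neg_one_pow_congr]
    have : N = p + q - 1 := by omega
    rcases Nat.eq_zero_or_pos p with rfl | hp
    · simp
    · subst this
      have h1 : Even (p * (p - 1)) := Nat.even_mul_pred_self p
      have h2 : (p + q - 1) * p = p * q + p * (p - 1) := by
        obtain ⟨r, rfl⟩ : ∃ r, p = r + 1 := ⟨p - 1, by omega⟩
        simp only [Nat.add_sub_cancel, show r + 1 + q - 1 = r + q by omega]; ring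
      rw [h2, Nat.even_add]; simp [h1]
  · obtain ⟨rfl, rfl⟩ : q = 0 ∧ p = 0 := by omega
    have : permFlip 0 0 = 1 := Equiv.ext fun i => i.elim0
    simp [this]

end AltSum

/-! ### The exterior product of alternating maps: commutativity, associativity, algebraic Leibniz
rule. -/

section Wedge

variable {E V W U : Type*} [NormedAddCommGroup E] [NormedSpace ℝ E]
  [NormedAddCommGroup V] [NormedSpace ℝ V] [NormedAddCommGroup W] [NormedSpace ℝ W]
  [NormedAddCommGroup U] [NormedSpace ℝ U]

@[simp] theorem castDeg_apply {p q : ℕ} (h : p = q) (a : E [⋀^Fin p]→L[ℝ] V) (v : Fin q → E) :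
    castDeg h a v = a (v ∘ Fin.cast h) := by
  subst h; rfl

@[simp] theorem castDeg_rfl {p : ℕ} (a : E [⋀^Fin p]→L[ℝ] V) : castDeg rfl a = a := rfl

theorem wedgeAlt_apply (B : V →L[ℝ] W →L[ℝ] U) {p q : ℕ} (a : E [⋀^Fin p]→L[ℝ] V)
    (b : E [⋀^Fin q]→L[ℝ] W) (v : Fin (p + q) → E) :
    wedgeAlt B a b v = ((p ! * q ! : ℝ)⁻¹) •
      altSum (fun w => B (a (w ∘ Fin.castAdd q)) (b (w ∘ Fin.natAdd p))) v := by
  simp only [wedgeAlt, ContinuousAlternatingMap.smul_apply,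
    ContinuousMultilinearMap.alternatization_apply_apply, altSum]
  rfl

theorem altSum_alternating {p : ℕ} (a : E [⋀^Fin p]→L[ℝ] V) :
    altSum (fun v => a v) = (p ! : ℝ) • fun v => a v := by
  ext v
  have : ∀ σ : Equiv.Perm (Fin p), a (v ∘ σ) = Equiv.Perm.sign σ • a v := fun σ =>
    a.toAlternatingMap.map_perm v σ
  simp [altSum, this, smul_smul, Fintype.card_perm, Nat.cast_smul_eq_nsmul]

/-- Both sides alternate the same bilinear expression up to the block exchange `permFlip p q`, whose
sign is (-1)^(pq). -/
theorem wedgeAlt_comm (B : V →L[ℝ] W →L[ℝ] U) {p q : ℕ} (a : E [⋀^Fin p]→L[ℝ] V)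
    (b : E [⋀^Fin q]→L[ℝ] W) :
    castDeg (Nat.add_comm p q) (wedgeAlt B a b)
      = (-1 : ℝ) ^ (p * q) • wedgeAlt B.flip b a := by
  ext v
  rw [castDeg_apply, wedgeAlt_apply, ContinuousAlternatingMap.smul_apply, wedgeAlt_apply,
    altSum_cast]
  have h : (fun w : Fin (q + p) → E =>
      B (a ((w ∘ Fin.cast (Nat.add_comm p q)) ∘ Fin.castAdd q))
        (b ((w ∘ Fin.cast (Nat.add_comm p q)) ∘ Fin.natAdd p)))
      = fun w => (fun w => B.flip (b (w ∘ Fin.castAdd p)) (a (w ∘ Fin.natAdd q)))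
        (w ∘ permFlip p q) := by
    ext w
    simp only [ContinuousLinearMap.flip_apply]
    refine congrArg₂ (fun x y => B (a x) (b y)) ?_ ?_
    · ext1 i; simp [permFlip_natAdd]
    · ext1 i; simp [permFlip_castAdd]
  rw [h, altSum_comp_perm (fun w : Fin (q + p) → E =>
    B.flip (b (w ∘ Fin.castAdd p)) (a (w ∘ Fin.natAdd q))), sign_permFlip, Pi.smul_apply,
    smul_smul, mul_comm (p ! : ℝ), mul_comm ((-1 : ℝ) ^ (p * q)), ← smul_smul]
  congr 1
  rcases Nat.even_or_odd (p * q) with h | h <;> simp [h.neg_one_pow]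

variable {V₁ V₂ V₃ V₁₂ V₂₃ : Type*} [NormedAddCommGroup V₁] [NormedSpace ℝ V₁]
  [NormedAddCommGroup V₂] [NormedSpace ℝ V₂] [NormedAddCommGroup V₃] [NormedSpace ℝ V₃]
  [NormedAddCommGroup V₁₂] [NormedSpace ℝ V₁₂] [NormedAddCommGroup V₂₃] [NormedSpace ℝ V₂₃]

/-- Each side is 1/(p! q! r!) times the alternating sum of one trilinear expression: the inner
alternation acts on a block of the variables, so by `altSum_block` it only contributes the factorial
that the outer normalisation divides out. -/
theorem wedgeAlt_assoc (B₁₂ : V₁ →L[ℝ] V₂ →L[ℝ] V₁₂) (B : V₁₂ →L[ℝ] V₃ →L[ℝ] U)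
    (B₂₃ : V₂ →L[ℝ] V₃ →L[ℝ] V₂₃) (B' : V₁ →L[ℝ] V₂₃ →L[ℝ] U)
    (hB : ∀ x y z, B (B₁₂ x y) z = B' x (B₂₃ y z)) {p q r : ℕ} (a : E [⋀^Fin p]→L[ℝ] V₁)
    (b : E [⋀^Fin q]→L[ℝ] V₂) (c : E [⋀^Fin r]→L[ℝ] V₃) :
    castDeg (Nat.add_assoc p q r) (wedgeAlt B (wedgeAlt B₁₂ a b) c)
      = wedgeAlt B' a (wedgeAlt B₂₃ b c) := by
  ext v
  rw [castDeg_apply, wedgeAlt_apply, wedgeAlt_apply]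
  let F : (Fin (p + q + r) → E) → U := fun w =>
    B (B₁₂ (a ((w ∘ Fin.castAdd r) ∘ Fin.castAdd q)) (b ((w ∘ Fin.castAdd r) ∘ Fin.natAdd p)))
      (c (w ∘ Fin.natAdd (p + q)))
  let F' : (Fin (p + (q + r)) → E) → U := fun w =>
    B' (a (w ∘ Fin.castAdd (q + r))) (B₂₃ (b ((w ∘ Fin.natAdd p) ∘ Fin.castAdd r))
      (c ((w ∘ Fin.natAdd p) ∘ Fin.natAdd q)))
  have h1 : (fun w : Fin (p + q + r) → E =>
      B (wedgeAlt B₁₂ a b (w ∘ Fin.castAdd r)) (c (w ∘ Fin.natAdd (p + q))))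
      = fun w => ((p ! * q ! : ℝ)⁻¹) •
        ∑ τ, Equiv.Perm.sign τ • F (w ∘ permLeft (p + q) r τ) := by
    ext w
    simp only [wedgeAlt_apply, altSum, map_smul, map_sum, smul_apply, sum_apply,
      Units.smul_def, map_zsmul, F]
    congr 1
    refine Finset.sum_congr rfl fun τ _ => ?_
    refine congrArg _ (congrArg₂ (fun s t => B s t)
      (congrArg₂ (fun x y => B₁₂ (a x) (b y)) ?_ ?_) (congrArg (fun x => c x) ?_)) <;>
    · ext1 i; simp
  have h2 : (fun w : Fin (p + (q + r)) → E =>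
      B' (a (w ∘ Fin.castAdd (q + r))) (wedgeAlt B₂₃ b c (w ∘ Fin.natAdd p)))
      = fun w => ((q ! * r ! : ℝ)⁻¹) •
        ∑ τ, Equiv.Perm.sign τ • F' (w ∘ permRight p (q + r) τ) := by
    ext w
    simp only [wedgeAlt_apply, altSum, map_smul, map_sum, Units.smul_def, map_zsmul, F']
    congr 1
    refine Finset.sum_congr rfl fun τ _ => ?_
    refine congrArg _ (congrArg₂ (fun s t => B' s t) (congrArg (fun x => a x) ?_)
      (congrArg₂ (fun x y => B₂₃ (b x) (c y)) ?_ ?_)) <;>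
    · ext1 i; simp
  rw [h1, h2, altSum_smul, altSum_smul, altSum_block _ (sign_permLeft _ _),
    altSum_block _ (sign_permRight _ _)]
  simp only [Pi.smul_apply, smul_smul]
  rw [altSum_cast]
  have h3 : (fun w : Fin (p + (q + r)) → E => F (w ∘ Fin.cast (Nat.add_assoc p q r))) = F' := by
    ext w
    simp only [F, F', hB]
    refine congrArg₂ (fun s t => B' s t) rfl
      (congrArg₂ (fun x y => B₂₃ (b x) (c y)) rfl ?_)
    ext1 i; simp only [Function.comp_apply]; congr 1; ext; simp [add_assoc]
  rw [h3]
  congr 1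
  have := fun k : ℕ => (Nat.cast_ne_zero (R := ℝ)).2 (Nat.factorial_ne_zero k)
  field_simp [this (p + q), this (q + r), this p, this q, this r]

/-- Brings the exterior derivative into the same normal form as the wedge product. The defining sum
has p + 1 terms, each a signed cyclic permutation of one function `G`, so its alternating sum is p +
1 times that of `G`. On the other hand, alternating an alternating map multiplies it by (p + 1)!. -/
theorem alternatizeUncurryFin_eq_altSum {p : ℕ} (A : E →L[ℝ] E [⋀^Fin p]→L[ℝ] V)
    (v : Fin (p + 1) → E) :
    ContinuousAlternatingMap.alternatizeUncurryFin A v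
      = ((p ! : ℝ)⁻¹) • altSum (fun w => A (w 0) (w ∘ Fin.succ)) v := by
  have h := altSum_alternating (ContinuousAlternatingMap.alternatizeUncurryFin A)
  let G : (Fin (p + 1) → E) → V := fun w => A (w 0) (w ∘ Fin.succ)
  change _ = _ • altSum G v
  have h2 : (fun v => ContinuousAlternatingMap.alternatizeUncurryFin A v)
      = fun v => ∑ i : Fin (p + 1), Equiv.Perm.sign (Fin.cycleRange i).symm •
        G (v ∘ (Fin.cycleRange i).symm) := by
    ext v
    rw [ContinuousAlternatingMap.alternatizeUncurryFin_apply]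
    refine Finset.sum_congr rfl fun i _ => ?_
    rw [Equiv.Perm.sign_symm, Fin.sign_cycleRange]
    have : (v ∘ (Fin.cycleRange i).symm) ∘ Fin.succ = i.removeNth v := by
      ext j; simp [Fin.removeNth, Fin.cycleRange_symm_succ]
    simp only [G, this, Function.comp_apply, Fin.cycleRange_symm_zero]
    rcases Nat.even_or_odd (i : ℕ) with h | h <;> simp [h.neg_one_pow]
  have h3 : altSum (fun v => ContinuousAlternatingMap.alternatizeUncurryFin A v)
      = ((p + 1 : ℕ) : ℝ) • altSum G := by
    rw [h2, altSum_sum]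
    simp only [altSum_units_smul, altSum_comp_perm, smul_smul, Int.units_mul_self, one_smul,
      Finset.sum_const, Finset.card_univ, Fintype.card_fin, Nat.cast_smul_eq_nsmul]
  rw [h3] at h
  have h4 := congrFun h v
  simp only [Pi.smul_apply] at h4
  have hp : ((p + 1 : ℕ) : ℝ) ≠ 0 := by positivity
  have hf : ((p + 1) ! : ℝ) = ((p + 1 : ℕ) : ℝ) * (p ! : ℝ) := by
    rw [Nat.factorial_succ]; push_cast; ring
  rw [hf, ← smul_smul] at h4
  have h5 := smul_right_injective _ hp h4
  rw [h5, smul_smul, inv_mul_cancel₀ (by positivity), one_smul]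

/-- The half of the Leibniz rule in which the left factor is differentiated. The differentiation
slot already stands in front of the arguments of that factor, so no sign arises. -/
theorem alternatizeUncurryFin_wedgeAlt_left (B : V →L[ℝ] W →L[ℝ] U) {p q : ℕ}
    (A : E →L[ℝ] E [⋀^Fin p]→L[ℝ] V) (b : E [⋀^Fin q]→L[ℝ] W)
    (T : E →L[ℝ] E [⋀^Fin (p + q)]→L[ℝ] U) (hT : ∀ x, T x = wedgeAlt B (A x) b) :
    ContinuousAlternatingMap.alternatizeUncurryFin T
      = castDeg (by omega) (wedgeAlt B (ContinuousAlternatingMap.alternatizeUncurryFin A) b) := by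
  ext v
  rw [castDeg_apply, wedgeAlt_apply, alternatizeUncurryFin_eq_altSum]
  let F : (Fin (p + q + 1) → E) → U := fun w =>
    B (A (w 0) ((w ∘ Fin.succ) ∘ Fin.castAdd q)) (b ((w ∘ Fin.succ) ∘ Fin.natAdd p))
  let F' : (Fin (p + 1 + q) → E) → U := fun w =>
    B (A ((w ∘ Fin.castAdd q) 0) ((w ∘ Fin.castAdd q) ∘ Fin.succ)) (b (w ∘ Fin.natAdd (p + 1)))
  have h1 : (fun w : Fin (p + q + 1) → E => T (w 0) (w ∘ Fin.succ))
      = fun w => ((p ! * q ! : ℝ)⁻¹) •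
        -- The permutation `decomposeFin.symm (0, τ)` fixes the differentiation slot 0 and acts by
        -- `τ` on the other slots, so its sign is that of `τ`.
        ∑ τ, Equiv.Perm.sign τ • F (w ∘ Equiv.Perm.decomposeFin.symm (0, τ)) := by
    ext w
    simp only [hT, wedgeAlt_apply, altSum, F]
    congr 1
  have h2 : (fun w : Fin (p + 1 + q) → E =>
      B (ContinuousAlternatingMap.alternatizeUncurryFin A (w ∘ Fin.castAdd q))
        (b (w ∘ Fin.natAdd (p + 1))))
      = fun w => ((p ! : ℝ)⁻¹) •
        ∑ τ, Equiv.Perm.sign τ • F' (w ∘ permLeft (p + 1) q τ) := by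
    ext w
    simp only [alternatizeUncurryFin_eq_altSum, altSum, map_smul, map_sum, smul_apply, sum_apply,
      Units.smul_def, map_zsmul, F']
    congr 1
    refine Finset.sum_congr rfl fun τ _ => ?_
    refine congrArg _ (congrArg₂ (fun s t => B s t)
      (congrArg₂ (fun x y => A x y) ?_ ?_) (congrArg (fun x => b x) ?_))
    · simp only [Function.comp_apply, permLeft_castAdd]
    · ext1 i; simp
    · ext1 i; simp
  rw [h1, h2, altSum_smul, altSum_smul, altSum_block _ (sign_permLeft _ _),
    altSum_block (fun τ => Equiv.Perm.decomposeFin.symm (0, τ))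
      (fun τ => by rw [Equiv.Perm.decomposeFin.symm_sign]; simp)]
  simp only [Pi.smul_apply, smul_smul]
  rw [altSum_cast]
  have h3 : (fun w : Fin (p + q + 1) → E =>
      F' (w ∘ Fin.cast (by omega : p + 1 + q = p + q + 1))) = F := by
    ext w
    simp only [F, F']
    refine congrArg₂ (fun s t => B s t)
      (congrArg₂ (fun x y => A x y) rfl rfl) (congrArg (fun x => b x) ?_)
    ext1 i; simp only [Function.comp_apply]; congr 1; ext; simp; omega
  rw [h3]
  congr 1
  have := fun k : ℕ => (Nat.cast_ne_zero (R := ℝ)).2 (Nat.factorial_ne_zero k)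
  field_simp [this (p + q), this (p + 1), this p, this q]

/-- Here the differentiation slot has to move past the `p` arguments of `a`, which costs (-1)^p. -/
theorem alternatizeUncurryFin_wedgeAlt_right (B : V →L[ℝ] W →L[ℝ] U) {p q : ℕ}
    (a : E [⋀^Fin p]→L[ℝ] V) (A : E →L[ℝ] E [⋀^Fin q]→L[ℝ] W)
    (T : E →L[ℝ] E [⋀^Fin (p + q)]→L[ℝ] U) (hT : ∀ x, T x = wedgeAlt B a (A x)) :
    ContinuousAlternatingMap.alternatizeUncurryFin T
      = (-1 : ℝ) ^ p • castDeg (Nat.add_assoc p q 1).symm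
        (wedgeAlt B a (ContinuousAlternatingMap.alternatizeUncurryFin A)) := by
  ext v
  rw [ContinuousAlternatingMap.smul_apply, castDeg_apply, wedgeAlt_apply,
    alternatizeUncurryFin_eq_altSum]
  let F : (Fin (p + q + 1) → E) → U := fun w =>
    B (a ((w ∘ Fin.succ) ∘ Fin.castAdd q)) (A (w 0) ((w ∘ Fin.succ) ∘ Fin.natAdd p))
  let F' : (Fin (p + (q + 1)) → E) → U := fun w =>
    B (a (w ∘ Fin.castAdd (q + 1))) (A ((w ∘ Fin.natAdd p) 0) ((w ∘ Fin.natAdd p) ∘ Fin.succ))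
  have h1 : (fun w : Fin (p + q + 1) → E => T (w 0) (w ∘ Fin.succ))
      = fun w => ((p ! * q ! : ℝ)⁻¹) •
        ∑ τ, Equiv.Perm.sign τ • F (w ∘ Equiv.Perm.decomposeFin.symm (0, τ)) := by
    ext w
    simp only [hT, wedgeAlt_apply, altSum, F]
    congr 1
  have h2 : (fun w : Fin (p + (q + 1)) → E =>
      B (a (w ∘ Fin.castAdd (q + 1)))
        (ContinuousAlternatingMap.alternatizeUncurryFin A (w ∘ Fin.natAdd p)))
      = fun w => ((q ! : ℝ)⁻¹) •
        ∑ τ, Equiv.Perm.sign τ • F' (w ∘ permRight p (q + 1) τ) := by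
    ext w
    simp only [alternatizeUncurryFin_eq_altSum, altSum, map_smul, map_sum,
      Units.smul_def, map_zsmul, F']
    congr 1
    refine Finset.sum_congr rfl fun τ _ => ?_
    refine congrArg _ (congrArg₂ (fun s t => B s t)
      (congrArg (fun x => a x) ?_) (congrArg₂ (fun x y => A x y) ?_ ?_))
    · ext1 i; simp
    · simp only [Function.comp_apply, permRight_natAdd]
    · ext1 i; simp
  rw [h1, h2, altSum_smul, altSum_smul, altSum_block _ (sign_permRight _ _),
    altSum_block (fun τ => Equiv.Perm.decomposeFin.symm (0, τ))
      (fun τ => by rw [Equiv.Perm.decomposeFin.symm_sign]; simp)]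
  simp only [Pi.smul_apply, smul_smul]
  rw [altSum_cast]
  let k : Fin (p + q + 1) := ⟨p, by omega⟩
  -- `cycleRange k` with `k = p` shifts the slots below `p` up by one, sends slot `p` to 0 and fixes
  -- the later slots. It is a cycle of length p + 1, hence of sign (-1)^p.
  have h3 : F = fun w : Fin (p + q + 1) → E =>
      (fun w => F' (w ∘ Fin.cast (Nat.add_assoc p q 1).symm)) (w ∘ Fin.cycleRange k) := by
    ext w
    simp only [F, F']
    refine congrArg₂ (fun s t => B s t)
      (congrArg (fun x => a x) ?_) (congrArg₂ (fun x y => A x y) ?_ ?_)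
    · ext1 i; simp only [Function.comp_apply]; congr 1
      rw [Fin.cycleRange_of_lt (by rw [Fin.lt_def]; simp [k])]
      ext; simp only [Fin.val_succ, Fin.val_castAdd]
      rw [Fin.val_add_one_of_lt]
      · simp
      · rw [Fin.lt_def]; simp; omega
    · simp only [Function.comp_apply]; congr 1
      rw [Fin.cycleRange_of_eq]
      ext; simp [k]
    · ext1 i; simp only [Function.comp_apply]; congr 1
      rw [Fin.cycleRange_of_gt (by rw [Fin.lt_def]; simp [k])]
      ext; simp; omega
  rw [h3, altSum_comp_perm (fun w : Fin (p + q + 1) → E =>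
    F' (w ∘ Fin.cast (Nat.add_assoc p q 1).symm)), Fin.sign_cycleRange, Pi.smul_apply]
  have hs : ∀ u : U, ((-1 : ℤˣ) ^ (k : ℕ)) • u = (-1 : ℝ) ^ p • u := by
    intro u
    have : (k : ℕ) = p := rfl
    rw [this]
    rcases Nat.even_or_odd p with h | h <;> simp [h.neg_one_pow]
  rw [hs, smul_smul]
  congr 1
  have := fun k : ℕ => (Nat.cast_ne_zero (R := ℝ)).2 (Nat.factorial_ne_zero k)
  field_simp [this (p + q), this (q + 1), this p, this q]

theorem wedgeAlt_compContinuousLinearMap {E' : Type*} [NormedAddCommGroup E'] [NormedSpace ℝ E']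
    (B : V →L[ℝ] W →L[ℝ] U) {p q : ℕ} (a : E [⋀^Fin p]→L[ℝ] V) (b : E [⋀^Fin q]→L[ℝ] W)
    (T : E' →L[ℝ] E) :
    (wedgeAlt B a b).compContinuousLinearMap T
      = wedgeAlt B (a.compContinuousLinearMap T) (b.compContinuousLinearMap T) := by
  ext v
  simp only [ContinuousAlternatingMap.compContinuousLinearMap_apply, wedgeAlt_apply, altSum]
  rfl

theorem castDeg_compContinuousLinearMap {E' : Type*} [NormedAddCommGroup E'] [NormedSpace ℝ E']
    {p q : ℕ} (h : p = q) (a : E [⋀^Fin p]→L[ℝ] V) (T : E' →L[ℝ] E) :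
    (castDeg h a).compContinuousLinearMap T = castDeg h (a.compContinuousLinearMap T) := by
  subst h; rfl

end Wedge

/-! ### Contraction of a form of top degree, and its wedge with another form. -/

section Contract

variable {E V W U : Type*} [NormedAddCommGroup E] [NormedSpace ℝ E]
  [NormedAddCommGroup V] [NormedSpace ℝ V] [NormedAddCommGroup W] [NormedSpace ℝ W]
  [NormedAddCommGroup U] [NormedSpace ℝ U]

theorem contract_apply {q : ℕ} : ∀ (p : ℕ) (θ : E [⋀^Fin (q + p)]→L[ℝ] V) (w : Fin p → E)
    (v : Fin q → E),
    contract p θ w v = θ (Fin.append w v ∘ Fin.cast (Nat.add_comm q p))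
  | 0, θ, w, v => by
    rw [contract]
    congr 1
    ext1 i
    simp only [Function.comp_apply]
    rw [show Fin.cast (Nat.add_comm q 0) i = Fin.natAdd 0 i by ext; simp, Fin.append_right]
  | p + 1, θ, w, v => by
    rw [contract, contract_apply p]
    change θ (Fin.cons (w 0) _) = _
    congr 1
    ext1 i
    refine Fin.cases ?_ (fun i => ?_) i
    · simp only [Fin.cons_zero, Function.comp_apply]
      rw [show Fin.cast (Nat.add_comm q (p + 1)) 0 = Fin.castAdd q 0 by ext; simp,
        Fin.append_left]
    · simp only [Fin.cons_succ, Function.comp_apply]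
      obtain ⟨j, rfl⟩ : ∃ j, i = Fin.cast (Nat.add_comm p q) j :=
        ⟨Fin.cast (Nat.add_comm q p) i, by simp⟩
      refine Fin.addCases (fun j => ?_) (fun j => ?_) j
      · rw [show Fin.cast (Nat.add_comm q (p + 1)) (Fin.cast (Nat.add_comm p q)
          (Fin.castAdd q j)).succ = Fin.castAdd q j.succ by ext; simp, Fin.append_left]
        simp [Fin.tail]
      · rw [show Fin.cast (Nat.add_comm q (p + 1)) (Fin.cast (Nat.add_comm p q)
          (Fin.natAdd p j)).succ = Fin.natAdd (p + 1) j by ext; simp; omega, Fin.append_right]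
        simp

theorem append_castAdd_natAdd {X : Type*} {p q : ℕ} (u : Fin (p + q) → X) :
    Fin.append (u ∘ Fin.castAdd q) (u ∘ Fin.natAdd p) = u := by
  ext1 i
  refine Fin.addCases (fun j => ?_) (fun j => ?_) i <;> simp

theorem exists_perm_extending {p q : ℕ} (f : Fin p → Fin (p + q)) (hf : Function.Injective f) :
    ∃ τ : Equiv.Perm (Fin (p + q)), ∀ i, τ (Fin.castAdd q i) = f i := by
  classical
  let e : {x // x ∈ range (Fin.castAdd q : Fin p → Fin (p + q))} ≃ {x // x ∈ range f} :=
    (Equiv.ofInjective _ (Fin.castAdd_injective p q)).symm.trans (Equiv.ofInjective f hf)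
  refine ⟨e.extendSubtype, fun i => ?_⟩
  rw [e.extendSubtype_apply_of_mem _ ⟨i, rfl⟩]
  simp only [e, Equiv.trans_apply]
  rw [Equiv.ofInjective_symm_apply]
  rfl

/-- Only the permutations preserving the two blocks contribute. -/
theorem sum_perm_block {p q : ℕ} (α : E [⋀^Fin p]→L[ℝ] V) (D : E [⋀^Fin (p + q)]→L[ℝ] ℝ)
    (u : Fin (p + q) → E) :
    ∑ ρ : Equiv.Perm (Fin (p + q)), Equiv.Perm.sign ρ •
      (D (Fin.append (u ∘ Fin.castAdd q) ((u ∘ ρ) ∘ Fin.natAdd p)) •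
        α ((u ∘ ρ) ∘ Fin.castAdd q))
      = (p ! * q ! : ℝ) • D u • α (u ∘ Fin.castAdd q) := by
  classical
  let T : Equiv.Perm (Fin (p + q)) → V := fun ρ => Equiv.Perm.sign ρ •
      (D (Fin.append (u ∘ Fin.castAdd q) ((u ∘ ρ) ∘ Fin.natAdd p)) •
        α ((u ∘ ρ) ∘ Fin.castAdd q))
  let e : Equiv.Perm (Fin p) × Equiv.Perm (Fin q) → Equiv.Perm (Fin (p + q)) := fun s =>
    finSumFinEquiv.permCongr (Equiv.Perm.sumCongr s.1 s.2)
  have he : Function.Injective e := by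
    intro s t h
    have h1 := (finSumFinEquiv (m := p) (n := q)).permCongr.injective h
    exact Equiv.Perm.sumCongrHom_injective h1
  have e1 : ∀ s i, e s (Fin.castAdd q i) = Fin.castAdd q (s.1 i) := by
    intro s i; simp [e, Equiv.permCongr_apply]
  have e2 : ∀ s i, e s (Fin.natAdd p i) = Fin.natAdd p (s.2 i) := by
    intro s i; simp [e, Equiv.permCongr_apply]
  have hval : ∀ s, T (e s) = D u • α (u ∘ Fin.castAdd q) := by
    intro s
    have h1 : (u ∘ e s) ∘ Fin.castAdd q = (u ∘ Fin.castAdd q) ∘ s.1 := by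
      ext1 i; simp [e1]
    have h2 : Fin.append (u ∘ Fin.castAdd q) ((u ∘ e s) ∘ Fin.natAdd p)
        = u ∘ permRight p q s.2 := by
      rw [← append_castAdd_natAdd (u ∘ permRight p q s.2)]
      congr 1
      · ext1 i; simp
      · ext1 i; simp [e2]
    have h3 : Equiv.Perm.sign (e s) = Equiv.Perm.sign s.1 * Equiv.Perm.sign s.2 := by
      simp only [e, Equiv.Perm.sign_permCongr, Equiv.Perm.sign_sumCongr]
    have h4 : α ((u ∘ Fin.castAdd q) ∘ s.1) = Equiv.Perm.sign s.1 • α (u ∘ Fin.castAdd q) :=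
      α.toAlternatingMap.map_perm _ _
    have h5 : D (u ∘ permRight p q s.2) = Equiv.Perm.sign s.2 • D u := by
      rw [← sign_permRight p q s.2]
      exact D.toAlternatingMap.map_perm _ _
    simp only [T]
    rw [h1, h2, h3, h4, h5]
    rcases Int.units_eq_one_or (Equiv.Perm.sign s.1) with h | h <;>
      rcases Int.units_eq_one_or (Equiv.Perm.sign s.2) with h' | h' <;> simp [h, h']
  have hzero : ∀ ρ, ρ ∉ range e → T ρ = 0 := by
    intro ρ hρ
    -- A permutation preserving the last block also preserves the first, by counting, and so is in
    -- the range of `e`. Any other permutation sends some index of the last block into the first,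
    -- which repeats an argument of `D`.
    by_cases hmap : ∀ j, ∃ j', ρ (Fin.natAdd p j) = Fin.natAdd p j'
    · exfalso
      apply hρ
      let ρ' : Equiv.Perm (Fin p ⊕ Fin q) := finSumFinEquiv.symm.permCongr ρ
      have hmaps : MapsTo ρ' (range Sum.inr) (range Sum.inr) := by
        rintro _ ⟨j, rfl⟩
        obtain ⟨j', hj'⟩ := hmap j
        refine ⟨j', ?_⟩
        simp [ρ', Equiv.permCongr_apply, hj']
      have hmaps' : MapsTo ρ' (range Sum.inl) (range Sum.inl) := by
        intro x hx
        have hbij : ρ' '' range (Sum.inr : Fin q → Fin p ⊕ Fin q) = range Sum.inr :=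
          Set.eq_of_subset_of_ncard_le (image_subset_iff.2 hmaps)
            (by rw [Set.ncard_image_of_injective _ ρ'.injective])
        by_contra hcon
        have : ρ' x ∈ range (Sum.inr : Fin q → Fin p ⊕ Fin q) := by
          rcases h : ρ' x with y | y
          · exact absurd ⟨y, h.symm⟩ hcon
          · exact ⟨y, rfl⟩
        rw [← hbij] at this
        obtain ⟨z, hz, hzx⟩ := this
        rw [ρ'.injective hzx] at hz
        obtain ⟨a, rfl⟩ := hx
        obtain ⟨b, hb⟩ := hz
        exact Sum.inr_ne_inl hb
      obtain ⟨s, hs⟩ := Equiv.Perm.mem_sumCongrHom_range_of_perm_mapsTo_inl hmaps'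
      refine ⟨s, ?_⟩
      have hs' : Equiv.Perm.sumCongr s.1 s.2 = ρ' := hs
      simp only [e, hs', ρ']
      ext; simp [Equiv.permCongr_apply]
    · push Not at hmap
      obtain ⟨j, hj⟩ := hmap
      have hi : ∃ i, ρ (Fin.natAdd p j) = Fin.castAdd q i := by
        rcases h : finSumFinEquiv.symm (ρ (Fin.natAdd p j)) with i | i
        · exact ⟨i, by rw [Equiv.symm_apply_eq] at h; simpa using h⟩
        · rw [Equiv.symm_apply_eq] at h
          exact absurd (by simpa using h) (hj i)
      obtain ⟨i, hi⟩ := hi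
      have : D (Fin.append (u ∘ Fin.castAdd q) ((u ∘ ρ) ∘ Fin.natAdd p)) = 0 := by
        refine D.map_eq_zero_of_eq _ (i := Fin.castAdd q i) (j := Fin.natAdd p j) ?_ ?_
        · simp [hi]
        · intro h; have := congrArg Fin.val h; simp at this; omega
      simp only [T, this]; simp
  have hsum : ∑ ρ, T ρ = ∑ s, T (e s) := by
    symm
    refine Finset.sum_of_injOn e he.injOn (fun _ _ => Finset.mem_univ _) ?_ (fun _ _ => rfl)
    intro ρ _ hρ
    apply hzero
    simpa using hρ
  change ∑ ρ, T ρ = _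
  rw [hsum]
  simp only [hval, Finset.sum_const, Finset.card_univ, Fintype.card_prod, Fintype.card_perm,
    Fintype.card_fin]
  rw [← Nat.cast_smul_eq_nsmul ℝ, Nat.cast_mul]

/-- The identity that makes the coordinate formula for the Hodge dual computable. If `f` is
injective, it extends to a permutation `τ`. After translating the sum by `τ` only block permutations
survive, p! q! of them, and the two occurrences of sign τ cancel. If `f` is not injective, both
sides vanish through a repeated argument. -/
theorem wedgeAlt_contract (B : V →L[ℝ] W →L[ℝ] U) {p q : ℕ} (α : E [⋀^Fin p]→L[ℝ] V)
    (D : E [⋀^Fin (q + p)]→L[ℝ] ℝ) (u : W) (v : Fin (p + q) → E) (f : Fin p → Fin (p + q)) :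
    wedgeAlt B α ((contract p D (v ∘ f)).smulRight u) v
      = D (v ∘ Fin.cast (Nat.add_comm q p)) • B (α (v ∘ f)) u := by
  let D' : E [⋀^Fin (p + q)]→L[ℝ] ℝ := castDeg (Nat.add_comm q p) D
  have hD' : ∀ w, D' w = D (w ∘ Fin.cast (Nat.add_comm q p)) := fun w => castDeg_apply _ _ _
  simp only [wedgeAlt_apply, altSum, ContinuousAlternatingMap.smulRight_apply, contract_apply,
    ← hD', map_smul]
  by_cases hf : Function.Injective f
  · obtain ⟨τ, hτ⟩ := exists_perm_extending f hf
    have hvf : v ∘ f = (v ∘ τ) ∘ Fin.castAdd q := by ext1 i; simp [hτ]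
    rw [hvf, ← Equiv.sum_comp (Equiv.mulLeft τ)]
    have key := sum_perm_block ((B.flip u).compContinuousAlternatingMap α) D' (v ∘ τ)
    simp only [ContinuousLinearMap.compContinuousAlternatingMap_coe, Function.comp_apply,
      ContinuousLinearMap.flip_apply] at key
    have h1 : ∀ ρ : Equiv.Perm (Fin (p + q)), v ∘ ⇑(τ * ρ) = (v ∘ τ) ∘ ρ := fun ρ => rfl
    simp only [Equiv.coe_mulLeft, h1, Equiv.Perm.sign_mul, mul_smul]
    rw [← Finset.smul_sum, key, ← mul_smul]
    have h2 : D' (v ∘ τ) = Equiv.Perm.sign τ • D' v := D'.toAlternatingMap.map_perm _ _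
    rw [h2, smul_comm (Equiv.Perm.sign τ), smul_smul, mul_smul]
    rcases Int.units_eq_one_or (Equiv.Perm.sign τ) with h | h <;>
      simp [h, smul_smul] <;> congr 1 <;> field_simp
  · have hα : α (v ∘ f) = 0 := by
      obtain ⟨i, j, hij, hne⟩ := Function.not_injective_iff.1 hf
      exact α.map_eq_zero_of_eq _ (by simp [hij]) hne
    have hD : ∀ w : Fin q → E, D' (Fin.append (v ∘ f) w) = 0 := by
      intro w
      obtain ⟨i, j, hij, hne⟩ := Function.not_injective_iff.1 hf
      refine D'.map_eq_zero_of_eq _ (i := Fin.castAdd q i) (j := Fin.castAdd q j) ?_ ?_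
      · simp [hij]
      · exact fun h => hne (Fin.castAdd_injective p q h)
    simp [hα, hD]

/-- Expanding by multilinearity, both sides are the double sum with coefficients ∏ P (f k) (r k). It
moves a matrix from one factor to the other as its transpose, which yields both the symmetry of the
Hodge pairing and the naturality of the Hodge dual. -/
theorem sum_multilinear_change {p n : ℕ} (B : V →L[ℝ] W →L[ℝ] U)
    (α : MultilinearMap ℝ (fun _ : Fin p => E) V) (β : MultilinearMap ℝ (fun _ : Fin p => E) W)
    (P : Matrix (Fin n) (Fin n) ℝ) (e e' : Fin n → E) :
    ∑ f : Fin p → Fin n, B (α fun k => ∑ j, P (f k) j • e j) (β (e' ∘ f))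
      = ∑ f : Fin p → Fin n, B (α (e ∘ f)) (β fun k => ∑ j, P j (f k) • e' j) := by
  classical
  simp only [MultilinearMap.map_sum, MultilinearMap.map_smul_univ, map_sum, map_smul,
    sum_apply, smul_apply]
  rw [Finset.sum_comm]
  rfl

/-- The multilinear map obtained by fixing the last `q` arguments. -/
def fixRight {p q : ℕ} (D : E [⋀^Fin (q + p)]→L[ℝ] V) (v : Fin q → E) :
    MultilinearMap ℝ (fun _ : Fin p => E) V :=
  LinearMap.compMultilinearMap
    ({ toFun := fun m => m v, map_add' := fun _ _ => rfl, map_smul' := fun _ _ => rfl } :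
      MultilinearMap ℝ (fun _ : Fin q => E) V →ₗ[ℝ] V)
    (D.toMultilinearMap.domDomCongr
      ((finCongr (Nat.add_comm q p)).trans finSumFinEquiv.symm)).currySum

theorem fixRight_apply {p q : ℕ} (D : E [⋀^Fin (q + p)]→L[ℝ] V) (v : Fin q → E)
    (w : Fin p → E) : fixRight D v w = contract p D w v := by
  rw [contract_apply]
  change D _ = _
  congr 1
  ext1 i
  simp only [Equiv.trans_apply, finCongr_apply, Function.comp_apply]
  refine Fin.addCases (fun j => ?_) (fun j => ?_) (Fin.cast (Nat.add_comm q p) i) <;> simp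

end Contract

/-! ### The Hodge dual at a point, for an arbitrary Gram matrix: symmetry, injectivity, naturality.
-/

section Hodge

variable {V W U : Type*} [NormedAddCommGroup V] [NormedSpace ℝ V] [NormedAddCommGroup W]
  [NormedSpace ℝ W] [NormedAddCommGroup U] [NormedSpace ℝ U] {n : ℕ}

theorem frame_eq (i : Fin n) : frame i = (EuclideanSpace.basisFun (Fin n) ℝ).toBasis i := by
  simp [frame]

theorem frame_eq' : (frame : Fin n → Euc n) = (EuclideanSpace.basisFun (Fin n) ℝ).toBasis :=
  funext frame_eq

theorem ext_frame {p : ℕ} {a b : (Euc n) [⋀^Fin p]→L[ℝ] V}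
    (h : ∀ f : Fin p → Fin n, a (frame ∘ f) = b (frame ∘ f)) : a = b := by
  have : a.toMultilinearMap = b.toMultilinearMap := by
    refine Module.Basis.ext_multilinear
      (fun _ : Fin p => (EuclideanSpace.basisFun (Fin n) ℝ).toBasis) fun f => ?_
    have := h f
    rw [frame_eq'] at this
    exact this
  ext v
  exact congrArg (fun m => m v) this

theorem detForm_apply (v : Fin n → Euc n) :
    detForm n v = (EuclideanSpace.basisFun (Fin n) ℝ).toBasis.det v := rfl

@[simp] theorem detForm_frame : detForm n frame = 1 := by
  rw [detForm_apply, frame_eq']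
  exact Module.Basis.det_self _

theorem detForm_comp (T : Euc n →L[ℝ] Euc n) (v : Fin n → Euc n) :
    detForm n (T ∘ v) = LinearMap.det (T : Euc n →ₗ[ℝ] Euc n) * detForm n v := by
  simp only [detForm_apply]
  exact Module.Basis.det_comp _ (T : Euc n →ₗ[ℝ] Euc n) v

/-- The Hodge dual determined by a Gram matrix and an orientation sign. -/
def hodgeAlg (G : Matrix (Fin n) (Fin n) ℝ) (c : ℝ) {p q : ℕ} (h : n = q + p)
    (β : (Euc n) [⋀^Fin p]→L[ℝ] V) : (Euc n) [⋀^Fin q]→L[ℝ] V :=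
  ∑ f : Fin p → Fin n, ((p ! : ℝ)⁻¹) •
    (contract p (castDeg h ((c * √|G.det|) • detForm n)) (fun k => frame (f k))).smulRight
      (β fun k => ∑ j, G⁻¹ (f k) j • frame j)

theorem hodgeAlg_apply (G : Matrix (Fin n) (Fin n) ℝ) (c : ℝ) {p q : ℕ} (h : n = q + p)
    (β : (Euc n) [⋀^Fin p]→L[ℝ] V) (v : Fin q → Euc n) :
    hodgeAlg G c h β v = (p ! : ℝ)⁻¹ • ∑ f : Fin p → Fin n,
      fixRight (castDeg h ((c * √|G.det|) • detForm n)) v (frame ∘ f) •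
        β fun k => ∑ j, G⁻¹ (f k) j • frame j := by
  simp only [hodgeAlg, ContinuousAlternatingMap.sum_apply, ContinuousAlternatingMap.smul_apply,
    ContinuousAlternatingMap.smulRight_apply, fixRight_apply, Finset.smul_sum]
  rfl

/-- `wedgeAlt_contract`, applied to each summand of the dual, exhibits α ∧ ∗β as the metric pairing
times the volume. Symmetry and injectivity are read off from this formula. -/
theorem wedgeAlt_hodgeAlg (B : V →L[ℝ] W →L[ℝ] U) (G : Matrix (Fin n) (Fin n) ℝ) (c : ℝ)
    {p q : ℕ} (h : n = q + p) (h' : p + q = n) (α : (Euc n) [⋀^Fin p]→L[ℝ] V)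
    (β : (Euc n) [⋀^Fin p]→L[ℝ] W) :
    wedgeAlt B α (hodgeAlg G c h β) (frame ∘ Fin.cast h') =
      ((p ! : ℝ)⁻¹ * (c * √|G.det|)) • ∑ f : Fin p → Fin n,
        B (α (frame ∘ f)) (β fun k => ∑ j, G⁻¹ (f k) j • frame j) := by
  have hadd : ∀ (s : Finset (Fin p → Fin n)) (γ : (Fin p → Fin n) → (Euc n) [⋀^Fin q]→L[ℝ] W)
      (v : Fin (p + q) → Euc n),
      wedgeAlt B α (∑ f ∈ s, (p ! : ℝ)⁻¹ • γ f) v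
        = ∑ f ∈ s, (p ! : ℝ)⁻¹ • wedgeAlt B α (γ f) v := by
    intro s γ v
    simp only [wedgeAlt_apply, ContinuousAlternatingMap.sum_apply,
      ContinuousAlternatingMap.smul_apply, map_sum, map_smul]
    rw [altSum_sum, Finset.sum_apply, Finset.smul_sum]
    refine Finset.sum_congr rfl fun f _ => ?_
    rw [altSum_smul, Pi.smul_apply, smul_comm]
  rw [hodgeAlg, hadd, Finset.smul_sum]
  refine Finset.sum_congr rfl fun f _ => ?_
  rw [mul_smul ((p ! : ℝ)⁻¹)]
  congr 1
  have key := wedgeAlt_contract B α (castDeg h ((c * √|G.det|) • detForm n))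
    (β fun k => ∑ j, G⁻¹ (f k) j • frame j) (frame ∘ Fin.cast h') (Fin.cast h'.symm ∘ f)
  have h1 : (frame ∘ Fin.cast h') ∘ Fin.cast h'.symm ∘ f = frame ∘ f := by ext1; simp
  rw [h1] at key
  refine key.trans ?_
  rw [castDeg_apply, ContinuousAlternatingMap.smul_apply]
  have h2 : ((frame ∘ Fin.cast h') ∘ Fin.cast (Nat.add_comm q p)) ∘ Fin.cast h
      = (frame : Fin n → Euc n) := by
    ext1 i; simp
  rw [h2, detForm_frame, smul_eq_mul, mul_one]

theorem wedgeAlt_hodgeAlg_symm (B : V →L[ℝ] W →L[ℝ] U) (G : Matrix (Fin n) (Fin n) ℝ)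
    (hG : G.IsSymm) (c : ℝ) {p q : ℕ} (h : n = q + p) (h' : p + q = n)
    (α : (Euc n) [⋀^Fin p]→L[ℝ] V) (β : (Euc n) [⋀^Fin p]→L[ℝ] W) :
    wedgeAlt B α (hodgeAlg G c h β) (frame ∘ Fin.cast h') =
      wedgeAlt B.flip β (hodgeAlg G c h α) (frame ∘ Fin.cast h') := by
  rw [wedgeAlt_hodgeAlg, wedgeAlt_hodgeAlg]
  congr 1
  have hs : ∀ i j, G⁻¹ i j = G⁻¹ j i := fun i j => by
    conv_lhs => rw [← hG.eq, ← Matrix.transpose_nonsing_inv, Matrix.transpose_apply]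
  have key := sum_multilinear_change B α.toMultilinearMap β.toMultilinearMap (G⁻¹) frame frame
  simp only [ContinuousLinearMap.flip_apply]
  refine Eq.trans ?_ key.symm
  refine Finset.sum_congr rfl fun f _ => ?_
  simp only [hs _ (f _)]
  rfl

/-- Testing against the contraction of the determinant with chosen frame vectors, tensored with `x`,
isolates `B x` of a single component of `e`, up to sign. Nondegeneracy of `B` then kills that
component. -/
theorem wedgeAlt_nondegenerate (B : V →L[ℝ] W →L[ℝ] U)
    (hB : ∀ y, (∀ x, B x y = 0) → y = 0) {p q : ℕ} (h : p + q = n)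
    (e : (Euc n) [⋀^Fin q]→L[ℝ] W)
    (he : ∀ c : (Euc n) [⋀^Fin p]→L[ℝ] V, wedgeAlt B c e (frame ∘ Fin.cast h) = 0) : e = 0 := by
  refine ext_frame fun f => hB _ fun x => ?_
  have h1 := he ((contract q (castDeg h.symm (detForm n)) (frame ∘ f)).smulRight x)
  have hc := wedgeAlt_comm B
    ((contract q (castDeg h.symm (detForm n)) (frame ∘ f)).smulRight x) e
  have h2 := congrArg (fun m => m (frame ∘ Fin.cast ((Nat.add_comm q p).trans h))) hc
  have key := wedgeAlt_contract B.flip e (castDeg h.symm (detForm n)) x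
    (frame ∘ Fin.cast ((Nat.add_comm q p).trans h))
    (Fin.cast ((Nat.add_comm q p).trans h).symm ∘ f)
  have h3 : (frame ∘ Fin.cast ((Nat.add_comm q p).trans h)) ∘
      Fin.cast ((Nat.add_comm q p).trans h).symm ∘ f = (frame ∘ f : Fin q → Euc n) := by
    ext1; simp
  have h4 : ((frame ∘ Fin.cast ((Nat.add_comm q p).trans h)) ∘ Fin.cast (Nat.add_comm p q)) ∘
      Fin.cast h.symm = (frame : Fin n → Euc n) := by
    ext1; simp
  rw [h3, castDeg_apply, h4, detForm_frame, one_smul] at key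
  simp only [castDeg_apply, ContinuousAlternatingMap.smul_apply] at h2
  rw [key] at h2
  have h5 : (frame ∘ Fin.cast ((Nat.add_comm q p).trans h)) ∘ Fin.cast (Nat.add_comm p q)
      = (frame ∘ Fin.cast h : _ → Euc n) := by
    ext1; simp
  rw [h5, h1] at h2
  have h6 := (smul_eq_zero.1 h2.symm).resolve_left (pow_ne_zero _ (by norm_num))
  simpa using h6

/-- The argument must cover indefinite metrics. Let `P` send the frame to the reciprocal frame, and
pair ∗β = 0 with ℓ ∘ β ∘ P for a real functional ℓ. As both factors now have raised indices, the
result is a sum of squares ℓ(β(e^f))², so every β(e^f) is zero. Frame vectors are images of `P`,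
since `G` is invertible; hence β = 0. -/
theorem hodgeAlg_injective (G : Matrix (Fin n) (Fin n) ℝ) (hG : G.det ≠ 0) (c : ℝ) (hc : c ≠ 0)
    {p q : ℕ} (h : n = q + p) (β : (Euc n) [⋀^Fin p]→L[ℝ] V) (hβ : hodgeAlg G c h β = 0) :
    β = 0 := by
  let b := (EuclideanSpace.basisFun (Fin n) ℝ).toBasis
  let P : Euc n →L[ℝ] Euc n :=
    LinearMap.toContinuousLinearMap (b.constr ℝ fun i => ∑ j, G⁻¹ i j • frame j)
  have hP : ∀ i, P (frame i) = ∑ j, G⁻¹ i j • frame j := by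
    intro i
    simp only [P, LinearMap.coe_toContinuousLinearMap', frame_eq]
    rw [b.constr_basis]
  have hPinv : ∀ i, P (∑ j, G i j • frame j) = frame i := by
    intro i
    simp only [map_sum, map_smul, hP, Finset.smul_sum, smul_smul]
    rw [Finset.sum_comm]
    have : ∀ l, ∑ j, (G i j * G⁻¹ j l) • (frame l : Euc n)
        = (1 : Matrix (Fin n) (Fin n) ℝ) i l • frame l := by
      intro l
      rw [← Finset.sum_smul, ← Matrix.mul_nonsing_inv G (isUnit_iff_ne_zero.2 hG),
        Matrix.mul_apply]
    simp [this, Matrix.one_apply]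
  have hzero : ∀ f : Fin p → Fin n, β (fun k => ∑ j, G⁻¹ (f k) j • frame j) = 0 := by
    intro f
    by_contra hne
    obtain ⟨ℓ, hℓ⟩ := SeparatingDual.exists_ne_zero (R := ℝ) hne
    have h1 := wedgeAlt_hodgeAlg (ContinuousLinearMap.lsmul ℝ ℝ) G c h
      ((Nat.add_comm p q).trans h.symm)
      (ℓ.compContinuousAlternatingMap (β.compContinuousLinearMap P)) β
    rw [hβ] at h1
    have h0 : wedgeAlt (ContinuousLinearMap.lsmul ℝ ℝ)
      (ℓ.compContinuousAlternatingMap (β.compContinuousLinearMap P))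
      (0 : (Euc n) [⋀^Fin q]→L[ℝ] V) (frame ∘ Fin.cast ((Nat.add_comm p q).trans h.symm)) = 0 := by
      simp [wedgeAlt_apply, altSum]
    rw [h0] at h1
    have h2 := (smul_eq_zero.1 h1.symm).resolve_left
      (mul_ne_zero (by positivity) (mul_ne_zero hc (by positivity)))
    have h3 := congrArg ℓ h2
    simp only [map_sum, ContinuousLinearMap.lsmul_apply, map_smul, smul_eq_mul, map_zero] at h3
    have h4 : ∀ f : Fin p → Fin n,
        (ℓ.compContinuousAlternatingMap (β.compContinuousLinearMap P)) (frame ∘ f)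
        = ℓ (β fun k => ∑ j, G⁻¹ (f k) j • frame j) := by
      intro f
      simp only [ContinuousLinearMap.compContinuousAlternatingMap_coe, Function.comp_apply,
        ContinuousAlternatingMap.compContinuousLinearMap_apply]
      congr 2
      ext1 k
      exact hP (f k)
    simp only [h4] at h3
    have h5 := (Finset.sum_eq_zero_iff_of_nonneg fun f _ => mul_self_nonneg _).1 h3 f
      (Finset.mem_univ _)
    exact hℓ (mul_self_eq_zero.1 h5)
  have hcomp : β.compContinuousLinearMap P = 0 := by
    refine ext_frame fun f => ?_
    rw [ContinuousAlternatingMap.compContinuousLinearMap_apply]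
    refine Eq.trans ?_ (hzero f)
    congr 1
    ext1 k
    exact hP (f k)
  refine ext_frame fun f => ?_
  have : β.compContinuousLinearMap P (fun k => ∑ j, G (f k) j • frame j) = 0 := by
    rw [hcomp]; rfl
  rw [ContinuousAlternatingMap.compContinuousLinearMap_apply] at this
  refine Eq.trans ?_ this
  congr 1
  ext1 k
  exact (hPinv (f k)).symm

/-- Under pullback by `T` the factor √|det G| is multiplied by |det τ|, while the determinant form
gives det τ; `hc` says that the orientation signs account for the difference. The matrix `τᵀ` is
then moved from the volume factor to `β`, where τ (τᵀGτ)⁻¹ τᵀ = G⁻¹ restores the reciprocal frame.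
-/
theorem hodgeAlg_compContinuousLinearMap (G : Matrix (Fin n) (Fin n) ℝ) (c c' : ℝ) {p q : ℕ}
    (h : n = q + p) (β : (Euc n) [⋀^Fin p]→L[ℝ] V) (T : Euc n →L[ℝ] Euc n)
    (τ : Matrix (Fin n) (Fin n) ℝ) (hτ : ∀ i, T (frame i) = ∑ j, τ j i • frame j)
    (hT : τ.det ≠ 0) (hc : c' * |τ.det| = c * τ.det) :
    hodgeAlg (τ.transpose * G * τ) c' h (β.compContinuousLinearMap T)
      = (hodgeAlg G c h β).compContinuousLinearMap T := by
  have hdet : LinearMap.det (T : Euc n →ₗ[ℝ] Euc n) = τ.det := by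
    rw [← LinearMap.det_toMatrix (EuclideanSpace.basisFun (Fin n) ℝ).toBasis]
    congr 1
    ext i j
    rw [LinearMap.toMatrix_apply, ← frame_eq, ContinuousLinearMap.coe_coe, hτ]
    simp [frame, Finset.sum_apply]
  ext v
  rw [ContinuousAlternatingMap.compContinuousLinearMap_apply, hodgeAlg_apply, hodgeAlg_apply]
  congr 1
  have h1 : ∀ f : Fin p → Fin n,
      fixRight (castDeg h ((c' * √|(τ.transpose * G * τ).det|) • detForm n)) v (frame ∘ f)
      = fixRight (castDeg h ((c * √|G.det|) • detForm n)) (T ∘ v)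
        (fun k => ∑ j, τ.transpose (f k) j • frame j) := by
    intro f
    simp only [fixRight_apply, contract_apply, castDeg_apply, ContinuousAlternatingMap.smul_apply]
    have h2 : Fin.append (fun k => ∑ j, τ.transpose (f k) j • frame j) (T ∘ v)
        = T ∘ Fin.append (frame ∘ f) v := by
      ext1 i
      refine Fin.addCases (fun j => ?_) (fun j => ?_) i <;> simp [hτ]
    have h3 : ∀ A : Fin (p + q) → Euc n,
        ((T ∘ A) ∘ Fin.cast (Nat.add_comm q p)) ∘ Fin.cast h
          = T ∘ ((A ∘ Fin.cast (Nat.add_comm q p)) ∘ Fin.cast h) := fun _ => rfl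
    rw [h2, h3, detForm_comp, hdet, Matrix.det_mul,
      Matrix.det_mul, Matrix.det_transpose, show τ.det * G.det * τ.det = τ.det ^ 2 * G.det by ring,
      abs_mul, Real.sqrt_mul (abs_nonneg _), abs_of_nonneg (sq_nonneg τ.det), Real.sqrt_sq_eq_abs,
      smul_eq_mul, smul_eq_mul]
    linear_combination (√|G.det| * detForm n ((Fin.append (frame ∘ f) v ∘
      Fin.cast (Nat.add_comm q p)) ∘ Fin.cast h)) * hc
  simp only [h1]
  have key := sum_multilinear_change (ContinuousLinearMap.lsmul ℝ ℝ)
    (fixRight (castDeg h ((c * √|G.det|) • detForm n)) (T ∘ v)) β.toMultilinearMap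
    τ.transpose frame (fun i => T (∑ j, (τ.transpose * G * τ)⁻¹ i j • frame j))
  refine Eq.trans ?_ (key.trans ?_)
  · rfl
  · refine Finset.sum_congr rfl fun f _ => ?_
    rw [ContinuousLinearMap.lsmul_apply]
    congr 1
    change β _ = _
    congr 1
    ext1 k
    have hinv : τ * (τ.transpose * G * τ)⁻¹ * τ.transpose = G⁻¹ := by
      have hu : IsUnit τ.det := isUnit_iff_ne_zero.2 hT
      rw [Matrix.mul_inv_rev, Matrix.mul_inv_rev, ← Matrix.mul_assoc,
        Matrix.mul_nonsing_inv _ hu, Matrix.one_mul, Matrix.mul_assoc,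
        Matrix.nonsing_inv_mul _ (by rwa [Matrix.det_transpose]), Matrix.mul_one]
    simp only [map_sum, map_smul, hτ, Finset.smul_sum, smul_smul, Matrix.transpose_apply]
    conv_rhs => rw [← hinv]
    simp only [Matrix.mul_apply, Matrix.transpose_apply, Finset.sum_mul, Finset.sum_smul]
    rw [Finset.sum_congr rfl fun x _ => Finset.sum_comm, Finset.sum_comm]
    refine Finset.sum_congr rfl fun x _ => ?_
    rw [Finset.sum_comm]
    refine Finset.sum_congr rfl fun y _ => Finset.sum_congr rfl fun z _ => ?_
    congr 1
    ring

/-- The fully expanded coordinate formula, from which smooth dependence on `G` and `β` is visible.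
-/
theorem hodgeAlg_apply_frame (G : Matrix (Fin n) (Fin n) ℝ) (c : ℝ) {p q : ℕ} (h : n = q + p)
    (β : (Euc n) [⋀^Fin p]→L[ℝ] V) (v : Fin q → Euc n) :
    hodgeAlg G c h β v = (c * √|G.det|) • ∑ f : Fin p → Fin n, ∑ r : Fin p → Fin n,
      (((p ! : ℝ)⁻¹ * fixRight (castDeg h (detForm n)) v (frame ∘ f)) *
        ∏ k, G⁻¹ (f k) (r k)) • β (frame ∘ r) := by
  classical
  have h1 : ∀ f : Fin p → Fin n,
      fixRight (castDeg h ((c * √|G.det|) • detForm n)) v (frame ∘ f)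
        = (c * √|G.det|) * fixRight (castDeg h (detForm n)) v (frame ∘ f) := by
    intro f
    simp only [fixRight_apply, contract_apply, castDeg_apply, ContinuousAlternatingMap.smul_apply,
      smul_eq_mul]
  have h2 : ∀ f : Fin p → Fin n, β (fun k => ∑ j, G⁻¹ (f k) j • frame j)
      = ∑ r : Fin p → Fin n, (∏ k, G⁻¹ (f k) (r k)) • β (frame ∘ r) := by
    intro f
    have := β.toMultilinearMap.map_sum (fun k j => G⁻¹ (f k) j • (frame j : Euc n))
    simp only [MultilinearMap.map_smul_univ] at this
    exact this
  simp only [hodgeAlg_apply, h1, h2, Finset.smul_sum, smul_smul]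
  refine Finset.sum_congr rfl fun f _ => Finset.sum_congr rfl fun r _ => ?_
  congr 1
  ring

theorem hodgeAlg_add (G : Matrix (Fin n) (Fin n) ℝ) (c : ℝ) {p q : ℕ} (h : n = q + p)
    (β γ : (Euc n) [⋀^Fin p]→L[ℝ] V) :
    hodgeAlg G c h (β + γ) = hodgeAlg G c h β + hodgeAlg G c h γ := by
  ext v
  simp [hodgeAlg_apply, Finset.sum_add_distrib]

theorem hodgeAlg_smul {R : Type*} [Monoid R] [DistribMulAction R V] [SMulCommClass ℝ R V]
    [ContinuousConstSMul R V] (G : Matrix (Fin n) (Fin n) ℝ) (c : ℝ) {p q : ℕ} (h : n = q + p)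
    (r : R) (β : (Euc n) [⋀^Fin p]→L[ℝ] V) :
    hodgeAlg G c h (r • β) = r • hodgeAlg G c h β := by
  ext v
  simp only [hodgeAlg_apply, ContinuousAlternatingMap.smul_apply, Finset.smul_sum]
  refine Finset.sum_congr rfl fun f _ => ?_
  rw [smul_comm _ r, smul_comm _ r]

end Hodge

/-! ### Components of alternating maps, and smoothness of algebraic operations. -/

section Coordinates

variable {n : ℕ} {V W U : Type*} [NormedAddCommGroup V] [NormedSpace ℝ V] [NormedAddCommGroup W]
  [NormedSpace ℝ W] [NormedAddCommGroup U] [NormedSpace ℝ U]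
  {X : Type*} [NormedAddCommGroup X] [NormedSpace ℝ X]

theorem sum_frame (v : Euc n) : ∑ j, v j • frame j = v := by
  have := (EuclideanSpace.basisFun (Fin n) ℝ).toBasis.sum_repr v
  simpa [← frame_eq] using this

theorem alternating_expand {p : ℕ} (a : (Euc n) [⋀^Fin p]→L[ℝ] V) (v : Fin p → Euc n) :
    a v = ∑ r : Fin p → Fin n, (∏ k, v k (r k)) • a (frame ∘ r) := by
  classical
  have := a.toMultilinearMap.map_sum (fun k j => v k j • (frame j : Euc n))
  simp only [MultilinearMap.map_smul_univ, sum_frame] at this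
  exact this

/-- The components of an alternating map. -/
def components (n p : ℕ) (V : Type*) [NormedAddCommGroup V] [NormedSpace ℝ V] :
    (Euc n) [⋀^Fin p]→L[ℝ] V →L[ℝ] ((Fin p → Fin n) → V) :=
  ContinuousLinearMap.pi fun f => ContinuousAlternatingMap.apply ℝ (Euc n) V (frame ∘ f)

/-- An alternating map is determined by its values on frame vectors. A linear left inverse of the
component map is continuous because the space of components is finite-dimensional, so smoothness can
be tested on components. -/
theorem exists_components_leftInverse [FiniteDimensional ℝ V] (p : ℕ) :
    ∃ R : ((Fin p → Fin n) → V) →L[ℝ] (Euc n) [⋀^Fin p]→L[ℝ] V,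
      ∀ a, R (components n p V a) = a := by
  have hinj : Function.Injective (components n p V) := fun a b h =>
    ext_frame fun f => congrFun h f
  obtain ⟨R, hR⟩ := LinearMap.exists_leftInverse_of_injective
    (components n p V).toLinearMap (LinearMap.ker_eq_bot.2 hinj)
  exact ⟨LinearMap.toContinuousLinearMap R, fun a => congrArg (fun l => l a) hR⟩

theorem contDiffWithinAt_of_components [FiniteDimensional ℝ V] {p : ℕ} {m : WithTop ℕ∞}
    {F : X → (Euc n) [⋀^Fin p]→L[ℝ] V} {s : Set X} {x : X}
    (h : ∀ f : Fin p → Fin n, ContDiffWithinAt ℝ m (fun y => F y (frame ∘ f)) s x) :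
    ContDiffWithinAt ℝ m F s x := by
  obtain ⟨R, hR⟩ := exists_components_leftInverse (n := n) (V := V) p
  have h1 : ContDiffWithinAt ℝ m (fun y => components n p V (F y)) s x :=
    contDiffWithinAt_pi.2 h
  have h2 := R.contDiff.contDiffAt.comp_contDiffWithinAt x h1
  refine h2.congr_of_eventuallyEq (Filter.Eventually.of_forall fun y => ?_) ?_ <;>
    simp [hR]

theorem contDiffWithinAt_alternating_apply {p : ℕ} {m : WithTop ℕ∞}
    {F : X → (Euc n) [⋀^Fin p]→L[ℝ] V} {s : Set X} {x : X} (h : ContDiffWithinAt ℝ m F s x)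
    (v : Fin p → Euc n) : ContDiffWithinAt ℝ m (fun y => F y v) s x :=
  (ContinuousAlternatingMap.apply ℝ (Euc n) V v).contDiff.contDiffAt.comp_contDiffWithinAt x h

theorem contDiffWithinAt_pullback [FiniteDimensional ℝ V] {p : ℕ} {m : WithTop ℕ∞}
    {F : X → (Euc n) [⋀^Fin p]→L[ℝ] V} {T : X → Euc n →L[ℝ] Euc n} {s : Set X} {x : X}
    (hF : ContDiffWithinAt ℝ m F s x) (hT : ContDiffWithinAt ℝ m T s x) :
    ContDiffWithinAt ℝ m (fun y => (F y).compContinuousLinearMap (T y)) s x := by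
  refine contDiffWithinAt_of_components fun f => ?_
  have h : ∀ y, (F y).compContinuousLinearMap (T y) (frame ∘ f)
      = ∑ r : Fin p → Fin n, (∏ k, T y (frame (f k)) (r k)) • F y (frame ∘ r) := fun y => by
    rw [ContinuousAlternatingMap.compContinuousLinearMap_apply, alternating_expand]; rfl
  simp only [h]
  refine ContDiffWithinAt.sum fun r _ => ContDiffWithinAt.smul ?_ (contDiffWithinAt_alternating_apply hF _)
  refine contDiffWithinAt_prod fun k _ => ?_
  have h1 : ContDiffWithinAt ℝ m (fun y => T y (frame (f k))) s x :=
    hT.clm_apply contDiffWithinAt_const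
  exact (EuclideanSpace.proj (𝕜 := ℝ) (r k)).contDiff.contDiffAt.comp_contDiffWithinAt x h1

theorem contDiffWithinAt_wedgeAlt [FiniteDimensional ℝ U] (B : V →L[ℝ] W →L[ℝ] U) {p q : ℕ}
    {m : WithTop ℕ∞} {F : X → (Euc n) [⋀^Fin p]→L[ℝ] V} {G : X → (Euc n) [⋀^Fin q]→L[ℝ] W}
    {s : Set X} {x : X} (hF : ContDiffWithinAt ℝ m F s x) (hG : ContDiffWithinAt ℝ m G s x) :
    ContDiffWithinAt ℝ m (fun y => wedgeAlt B (F y) (G y)) s x := by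
  refine contDiffWithinAt_of_components fun f => ?_
  simp only [wedgeAlt_apply, altSum, Units.smul_def, ← Int.cast_smul_eq_zsmul ℝ]
  refine contDiffWithinAt_const.smul
    (ContDiffWithinAt.sum fun σ _ => contDiffWithinAt_const.smul ?_)
  exact (B.contDiff.contDiffAt.comp_contDiffWithinAt x (contDiffWithinAt_alternating_apply hF _)).clm_apply
    (contDiffWithinAt_alternating_apply hG _)

end Coordinates

/-! ### Chart expressions of forms: change of chart, smoothness at a point, exterior derivative. -/

section Charts

variable {n : ℕ} {H : Type*} [TopologicalSpace H] {I : ModelWithCorners ℝ (Euc n) H}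
  {M : Type*} [TopologicalSpace M] [ChartedSpace H M] [IsManifold I ∞ M]
  {V W U : Type*} [NormedAddCommGroup V] [NormedSpace ℝ V] [NormedAddCommGroup W]
  [NormedSpace ℝ W] [NormedAddCommGroup U] [NormedSpace ℝ U]

theorem contDiffWithinAt_transition {x₀ x₁ p : M} (h₀ : p ∈ (extChartAt I x₀).source)
    (h₁ : p ∈ (extChartAt I x₁).source) :
    ContDiffWithinAt ℝ ∞ (extChartAt I x₁ ∘ (extChartAt I x₀).symm) (range I)
      (extChartAt I x₀ p) := by
  refine contDiffWithinAt_ext_coord_change x₁ x₀ ?_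
  rw [PartialEquiv.trans_source'', PartialEquiv.symm_symm, PartialEquiv.symm_target]
  exact mem_image_of_mem _ ⟨h₀, h₁⟩

omit [IsManifold I ∞ M] in
theorem eventually_mem_target {x₀ p : M} (h₀ : p ∈ (extChartAt I x₀).source) :
    ∀ᶠ y in 𝓝[range I] (extChartAt I x₀ p), y ∈ (extChartAt I x₀).target :=
  extChartAt_target_mem_nhdsWithin' h₀

omit [IsManifold I ∞ M] in
theorem tendsto_symm {x₀ p : M} (h₀ : p ∈ (extChartAt I x₀).source) :
    Filter.Tendsto (extChartAt I x₀).symm (𝓝[range I] (extChartAt I x₀ p)) (𝓝 p) := by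
  have := (continuousAt_extChartAt_symm' (I := I) h₀).tendsto
  rw [(extChartAt I x₀).left_inv h₀] at this
  exact this.mono_left nhdsWithin_le_nhds

variable {p : ℕ} {θ : M → (Euc n) [⋀^Fin p]→L[ℝ] V}

theorem inChart_apply (θ : M → (Euc n) [⋀^Fin p]→L[ℝ] V) {x₀ x : M}
    (hx : x ∈ (extChartAt I x₀).source) :
    inChart I θ x₀ (extChartAt I x₀ x)
      = (θ x).compContinuousLinearMap (tangentCoordChange I x₀ x x) := by
  rw [inChart, (extChartAt I x₀).left_inv hx]

theorem inChart_self (θ : M → (Euc n) [⋀^Fin p]→L[ℝ] V) (x : M) :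
    inChart I θ x (extChartAt I x x) = θ x := by
  rw [inChart_apply θ (mem_extChartAt_source x)]
  ext v
  rw [ContinuousAlternatingMap.compContinuousLinearMap_apply]
  congr 1
  ext1 k
  exact tangentCoordChange_self (mem_extChartAt_source x)

theorem inChart_change (θ : M → (Euc n) [⋀^Fin p]→L[ℝ] V) {x₀ x₁ x : M}
    (h₀ : x ∈ (extChartAt I x₀).source) (h₁ : x ∈ (extChartAt I x₁).source) :
    inChart I θ x₀ (extChartAt I x₀ x)
      = (inChart I θ x₁ (extChartAt I x₁ x)).compContinuousLinearMap
        (tangentCoordChange I x₀ x₁ x) := by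
  rw [inChart_apply θ h₀, inChart_apply θ h₁]
  ext v
  simp only [ContinuousAlternatingMap.compContinuousLinearMap_apply]
  congr 1
  ext1 k
  exact (tangentCoordChange_comp ⟨⟨h₀, h₁⟩, mem_extChartAt_source x⟩).symm

/-- `tangentCoordChange` is the derivative within `range I` of the transition map. Two chart
expressions are therefore related near the point by an honest pullback on the model space, to which
results on smoothness and exterior derivatives apply. -/
theorem inChart_change_eventuallyEq (θ : M → (Euc n) [⋀^Fin p]→L[ℝ] V) {x₀ x₁ x : M}
    (h₀ : x ∈ (extChartAt I x₀).source) (h₁ : x ∈ (extChartAt I x₁).source) :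
    inChart I θ x₀ =ᶠ[𝓝[range I] (extChartAt I x₀ x)] fun y =>
      (inChart I θ x₁ ((extChartAt I x₁ ∘ (extChartAt I x₀).symm) y)).compContinuousLinearMap
        (fderivWithin ℝ (extChartAt I x₁ ∘ (extChartAt I x₀).symm) (range I) y) := by
  have hs := (tendsto_symm h₀).eventually
    ((isOpen_extChartAt_source (I := I) x₁).mem_nhds h₁)
  filter_upwards [hs, eventually_mem_target h₀] with y hy1 hy2
  have := inChart_change θ ((extChartAt I x₀).map_target hy2) hy1
  rw [tangentCoordChange_def, (extChartAt I x₀).right_inv hy2] at this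
  exact this

variable (I) in
/-- Smoothness of a form at a point, in the preferred chart at that point. -/
def SmoothAt (θ : M → (Euc n) [⋀^Fin p]→L[ℝ] V) (x : M) : Prop :=
  ContDiffWithinAt ℝ ∞ (inChart I θ x) (range I) (extChartAt I x x)

theorem contDiffWithinAt_inChart_change [FiniteDimensional ℝ V] {x₀ x₁ x : M}
    (h₀ : x ∈ (extChartAt I x₀).source) (h₁ : x ∈ (extChartAt I x₁).source)
    (h : ContDiffWithinAt ℝ ∞ (inChart I θ x₁) (range I) (extChartAt I x₁ x)) :
    ContDiffWithinAt ℝ ∞ (inChart I θ x₀) (range I) (extChartAt I x₀ x) := by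
  have e := inChart_change_eventuallyEq θ h₀ h₁
  refine ContDiffWithinAt.congr_of_eventuallyEq ?_ e (e.self_of_nhdsWithin (mem_range_self _))
  refine contDiffWithinAt_pullback ?_
    ((contDiffWithinAt_transition h₀ h₁).fderivWithin_right (m := ∞) I.uniqueDiffOn
      (by simp) (mem_range_self _))
  refine ContDiffWithinAt.comp (g := inChart I θ x₁) _ (t := range I) ?_
    (contDiffWithinAt_transition h₀ h₁) fun y _ => mem_range_self _
  rwa [Function.comp_apply, (extChartAt I x₀).left_inv h₀]

theorem SmoothAt.contDiffWithinAt [FiniteDimensional ℝ V] {x : M} (h : SmoothAt I θ x) {x₀ : M}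
    (hx : x ∈ (extChartAt I x₀).source) :
    ContDiffWithinAt ℝ ∞ (inChart I θ x₀) (range I) (extChartAt I x₀ x) :=
  contDiffWithinAt_inChart_change hx (mem_extChartAt_source x) h

theorem SmoothAt.of_chart [FiniteDimensional ℝ V] {x₀ x : M}
    (hx : x ∈ (extChartAt I x₀).source)
    (h : ContDiffWithinAt ℝ ∞ (inChart I θ x₀) (range I) (extChartAt I x₀ x)) :
    SmoothAt I θ x :=
  contDiffWithinAt_inChart_change (mem_extChartAt_source x) hx h

/-- Replaces smoothness over whole charts by a pointwise condition in the chart at each point, the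
one in which the exterior derivative is computed. -/
theorem contDiffOn_inChart_iff [FiniteDimensional ℝ V] :
    (∀ x₀ : M, ContDiffOn ℝ ∞ (inChart I θ x₀) (extChartAt I x₀).target)
      ↔ ∀ x, SmoothAt I θ x := by
  constructor
  · intro h x
    refine (h x _ (mem_extChartAt_target x)).mono_of_mem_nhdsWithin ?_
    exact extChartAt_target_mem_nhdsWithin x
  · intro h x₀ y hy
    have := (h _).contDiffWithinAt ((extChartAt I x₀).map_target hy)
    rw [(extChartAt I x₀).right_inv hy] at this
    exact this.mono (extChartAt_target_subset_range x₀)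

/-- The exterior derivative of a form of degree `p`. -/
def extD (I : ModelWithCorners ℝ (Euc n) H) {M : Type*} [TopologicalSpace M] [ChartedSpace H M]
    [IsManifold I ∞ M] {p : ℕ} (θ : M → (Euc n) [⋀^Fin p]→L[ℝ] V) (x : M) :
    (Euc n) [⋀^Fin (p + 1)]→L[ℝ] V :=
  extDerivWithin (inChart I θ x) (range I) (extChartAt I x x)

/-- Chart independence of the exterior derivative, from its naturality under pullback by the
transition map. The argument also covers boundary points, since `range I` lies in the closure of its
interior. Without it, `extD` would be a family of values taken in unrelated charts, with nothing
known about its smoothness. -/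
theorem inChart_extD {x₀ x : M} (h : SmoothAt I θ x) (hx : x ∈ (extChartAt I x₀).source) :
    inChart I (extD I θ) x₀ (extChartAt I x₀ x)
      = extDerivWithin (inChart I θ x₀) (range I) (extChartAt I x₀ x) := by
  have hx' := mem_extChartAt_source (I := I) x
  have hd : DifferentiableWithinAt ℝ (inChart I θ x) (range I)
      ((extChartAt I x ∘ (extChartAt I x₀).symm) (extChartAt I x₀ x)) := by
    rw [Function.comp_apply, (extChartAt I x₀).left_inv hx]
    exact ContDiffWithinAt.differentiableWithinAt h (by simp)
  rw [(inChart_change_eventuallyEq θ hx hx').extDerivWithin_eq_of_mem (mem_range_self _),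
    extDerivWithin_pullback hd (contDiffWithinAt_transition hx hx')
      (by simpa using WithTop.coe_le_coe.2 (le_top : (2 : ℕ∞) ≤ ⊤)) I.uniqueDiffOn
      (I.range_subset_closure_interior (mem_range_self _)) (mem_range_self _)
      (fun y _ => mem_range_self _),
    inChart_apply _ hx, tangentCoordChange_def, Function.comp_apply,
    (extChartAt I x₀).left_inv hx]
  rfl

theorem inChart_extD_eventuallyEq (h : ∀ x, SmoothAt I θ x) {x₀ x : M}
    (hx : x ∈ (extChartAt I x₀).source) :
    inChart I (extD I θ) x₀ =ᶠ[𝓝[range I] (extChartAt I x₀ x)]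
      extDerivWithin (inChart I θ x₀) (range I) := by
  filter_upwards [eventually_mem_target hx] with y hy
  have := inChart_extD (h _) ((extChartAt I x₀).map_target hy)
  rwa [(extChartAt I x₀).right_inv hy] at this

theorem smoothAt_extD (h : ∀ x, SmoothAt I θ x) (x : M) : SmoothAt I (extD I θ) x := by
  have e := inChart_extD_eventuallyEq h (mem_extChartAt_source (I := I) x)
  refine ContDiffWithinAt.congr_of_eventuallyEq ?_ e (e.self_of_nhdsWithin (mem_range_self _))
  have h1 := ContDiffWithinAt.fderivWithin_right (h x) (m := ∞) I.uniqueDiffOn (by simp) (mem_range_self _)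
  exact (ContinuousAlternatingMap.alternatizeUncurryFinCLM ℝ (Euc n) V).contDiff.contDiffAt
    |>.comp_contDiffWithinAt _ h1

theorem smoothAt_wedgeAlt [FiniteDimensional ℝ U] (B : V →L[ℝ] W →L[ℝ] U) {q : ℕ}
    {η : M → (Euc n) [⋀^Fin q]→L[ℝ] W} {x : M} (h : SmoothAt I θ x) (h' : SmoothAt I η x) :
    SmoothAt I (fun x => wedgeAlt B (θ x) (η x)) x := by
  have : inChart I (fun x => wedgeAlt B (θ x) (η x)) x
      = fun y => wedgeAlt B (inChart I θ x y) (inChart I η x y) := by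
    ext1 y
    simp only [inChart, wedgeAlt_compContinuousLinearMap]
  rw [SmoothAt, this]
  exact contDiffWithinAt_wedgeAlt B h h'

theorem smoothAt_castDeg {q : ℕ} (e : p = q) {x : M} (h : SmoothAt I θ x) :
    SmoothAt I (fun x => castDeg e (θ x)) x := by
  subst e; exact h

theorem smoothAt_sum {ι : Type*} (s : Finset ι) {θ : ι → M → (Euc n) [⋀^Fin p]→L[ℝ] V} {x : M}
    (h : ∀ i ∈ s, SmoothAt I (θ i) x) : SmoothAt I (fun x => ∑ i ∈ s, θ i x) x := by
  have : inChart I (fun x => ∑ i ∈ s, θ i x) x = fun y => ∑ i ∈ s, inChart I (θ i) x y := by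
    ext1 y
    ext v
    simp only [inChart, ContinuousAlternatingMap.compContinuousLinearMap_apply,
      ContinuousAlternatingMap.sum_apply]
  rw [SmoothAt, this]
  exact ContDiffWithinAt.sum h

theorem SmoothAt.add {η : M → (Euc n) [⋀^Fin p]→L[ℝ] V} {x : M} (h : SmoothAt I θ x)
    (h' : SmoothAt I η x) : SmoothAt I (fun x => θ x + η x) x :=
  ContDiffWithinAt.add h h'

theorem SmoothAt.compLinear (L : V →L[ℝ] W) {x : M} (h : SmoothAt I θ x) :
    SmoothAt I (fun x => L.compContinuousAlternatingMap (θ x)) x := by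
  let Φ : (Euc n) [⋀^Fin p]→L[ℝ] V →L[ℝ] (Euc n) [⋀^Fin p]→L[ℝ] W :=
    LinearMap.mkContinuous
      { toFun := fun a => L.compContinuousAlternatingMap a
        map_add' := fun a b => by ext; simp
        map_smul' := fun c a => by ext; simp } ‖L‖
      (fun a => L.norm_compContinuousAlternatingMap_le a)
  exact Φ.contDiff.contDiffAt.comp_contDiffWithinAt _ h

theorem SmoothAt.smulFun {f : M → ℝ} {x : M} (h : SmoothAt I θ x)
    (hf : ContDiffWithinAt ℝ ∞ (f ∘ (extChartAt I x).symm) (range I) (extChartAt I x x)) :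
    SmoothAt I (fun x => f x • θ x) x := by
  have : inChart I (fun x => f x • θ x) x
      = fun y => (f ∘ (extChartAt I x).symm) y • inChart I θ x y := by
    ext1 y
    ext v
    simp only [inChart, ContinuousAlternatingMap.compContinuousLinearMap_apply,
      ContinuousAlternatingMap.smul_apply, Function.comp_apply]
  rw [SmoothAt, this]
  exact ContDiffWithinAt.smul hf h

theorem SmoothAt.congr {η : M → (Euc n) [⋀^Fin p]→L[ℝ] V} {x : M} (h : SmoothAt I θ x)
    (e : η =ᶠ[𝓝 x] θ) : SmoothAt I η x := by
  have h1 := (tendsto_symm (mem_extChartAt_source (I := I) x)).eventually e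
  have e : inChart I η x =ᶠ[𝓝[range I] (extChartAt I x x)] inChart I θ x := by
    filter_upwards [h1] with y hy
    simp only [inChart, hy]
  exact ContDiffWithinAt.congr_of_eventuallyEq h e (e.self_of_nhdsWithin (mem_range_self _))

theorem smoothAt_zero (x : M) : SmoothAt I (fun _ => (0 : (Euc n) [⋀^Fin p]→L[ℝ] V)) x := by
  have : inChart I (fun _ : M => (0 : (Euc n) [⋀^Fin p]→L[ℝ] V)) x = fun _ => 0 := by
    ext1 y; ext v; simp [inChart]
  rw [SmoothAt, this]
  exact contDiffWithinAt_const

end Charts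

/-! ### The Hodge star in charts, and its smoothness. -/

section HodgeCharts

variable {n : ℕ} {H : Type*} [TopologicalSpace H] {I : ModelWithCorners ℝ (Euc n) H}
  {M : Type*} [TopologicalSpace M] [ChartedSpace H M] [IsManifold I ∞ M]
  {V : Type*} [NormedAddCommGroup V] [NormedSpace ℝ V]

/-- The matrix of an endomorphism of the model space in the standard frame. -/
def frameMatrix (T : Euc n →L[ℝ] Euc n) : Matrix (Fin n) (Fin n) ℝ :=
  Matrix.of fun j i => T (frame i) j

theorem apply_frame (T : Euc n →L[ℝ] Euc n) (i : Fin n) :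
    T (frame i) = ∑ j, frameMatrix T j i • frame j := (sum_frame _).symm

theorem det_frameMatrix (T : Euc n →L[ℝ] Euc n) :
    (frameMatrix T).det = LinearMap.det (T : Euc n →ₗ[ℝ] Euc n) := by
  rw [← LinearMap.det_toMatrix (EuclideanSpace.basisFun (Fin n) ℝ).toBasis]
  congr 1

theorem det_gram_ne_zero (g : Metric I M) (x : M) : (gram g x).det ≠ 0 := by
  intro h
  obtain ⟨v, hv, hv0⟩ := Matrix.exists_vecMul_eq_zero_iff.2 h
  apply hv
  have hz : ∑ i, v i • (frame i : Euc n) = 0 := by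
    refine g.nondegenerate x _ fun w => ?_
    rw [← sum_frame w]
    simp only [map_sum, map_smul, sum_apply, smul_apply, smul_eq_mul]
    rw [Finset.sum_eq_zero]
    intro j _
    have := congrFun hv0 j
    simp only [Matrix.vecMul, dotProduct, gram, Matrix.of_apply, Pi.zero_apply] at this
    rw [this, mul_zero]
  ext i
  have := congrArg (fun u : Euc n => u i) hz
  simpa [frame, Finset.sum_apply, Pi.single_apply] using this

theorem isSymm_gram (g : Metric I M) (x : M) : (gram g x).IsSymm := by
  ext i j
  simp [gram, g.symm x (frame i)]

theorem det_tangentCoordChange_ne_zero {x₀ x₁ x : M} (h₀ : x ∈ (extChartAt I x₀).source)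
    (h₁ : x ∈ (extChartAt I x₁).source) :
    LinearMap.det (tangentCoordChange I x₀ x₁ x : Euc n →ₗ[ℝ] Euc n) ≠ 0 := by
  have h : (tangentCoordChange I x₁ x₀ x : Euc n →ₗ[ℝ] Euc n) ∘ₗ
      (tangentCoordChange I x₀ x₁ x : Euc n →ₗ[ℝ] Euc n) = LinearMap.id := by
    ext1 v
    exact (tangentCoordChange_comp ⟨⟨h₀, h₁⟩, h₀⟩).trans (tangentCoordChange_self h₀)
  have h2 := congrArg LinearMap.det h
  rw [LinearMap.det_comp, LinearMap.det_id] at h2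
  exact right_ne_zero_of_mul_eq_one h2

/-- The Gram matrix of the coordinate frame of the chart at `x₀`. -/
def chartGram (g : Metric I M) (x₀ : M) (y : Euc n) : Matrix (Fin n) (Fin n) ℝ :=
  Matrix.of fun i j : Fin n => g.val ((extChartAt I x₀).symm y)
    (tangentCoordChange I x₀ ((extChartAt I x₀).symm y) ((extChartAt I x₀).symm y) (frame i))
    (tangentCoordChange I x₀ ((extChartAt I x₀).symm y) ((extChartAt I x₀).symm y) (frame j))

theorem chartGram_apply (g : Metric I M) {x₀ x : M} (hx : x ∈ (extChartAt I x₀).source) :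
    chartGram g x₀ (extChartAt I x₀ x) = (frameMatrix (tangentCoordChange I x₀ x x)).transpose *
      gram g x * frameMatrix (tangentCoordChange I x₀ x x) := by
  ext i j
  simp only [chartGram, Matrix.of_apply, (extChartAt I x₀).left_inv hx]
  rw [apply_frame, apply_frame]
  simp only [map_sum, map_smul, sum_apply, smul_apply, smul_eq_mul, Matrix.mul_apply,
    Matrix.transpose_apply, gram, Matrix.of_apply, Finset.sum_mul, Finset.mul_sum]
  exact Finset.sum_congr rfl fun a _ => Finset.sum_congr rfl fun b _ => by ring

theorem chartGram_det_ne_zero (g : Metric I M) {x₀ : M} {y : Euc n}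
    (hy : y ∈ (extChartAt I x₀).target) : (chartGram g x₀ y).det ≠ 0 := by
  have hx := (extChartAt I x₀).map_target hy
  rw [← (extChartAt I x₀).right_inv hy, chartGram_apply g hx]
  simp only [Matrix.det_mul, Matrix.det_transpose, det_frameMatrix]
  have := det_tangentCoordChange_ne_zero hx (mem_extChartAt_source (I := I) _)
  exact mul_ne_zero (mul_ne_zero this (det_gram_ne_zero g _)) this

theorem chartGram_smooth (g : Metric I M) (x₀ : M) (i j : Fin n) :
    ContDiffOn ℝ ∞ (fun y => chartGram g x₀ y i j) (extChartAt I x₀).target :=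
  g.smooth x₀ (frame i) (frame j)

/-- `x` lies in the chart at `x₀` and the coordinate orientation at `x` agrees with the one
at `x₀`. -/
def Good (o : Orient I M) (x₀ x : M) : Prop :=
  x ∈ (extChartAt I x₀).source ∧
    0 < o.sign x₀ * o.sign x * LinearMap.det (tangentCoordChange I x₀ x x : Euc n →ₗ[ℝ] Euc n)

theorem eventually_good (o : Orient I M) (x₀ : M) : ∀ᶠ x in 𝓝 x₀, Good o x₀ x :=
  Filter.Eventually.and (extChartAt_source_mem_nhds (I := I) x₀) (o.locally_constant x₀)

theorem Good.sign_mul {o : Orient I M} {x₀ x : M} (h : Good o x₀ x) :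
    o.sign x₀ * |LinearMap.det (tangentCoordChange I x₀ x x : Euc n →ₗ[ℝ] Euc n)|
      = o.sign x * LinearMap.det (tangentCoordChange I x₀ x x : Euc n →ₗ[ℝ] Euc n) := by
  have h2 := h.2
  rcases o.sign_eq x₀ with h0 | h0 <;> rcases o.sign_eq x with h1 | h1 <;>
    rw [h0, h1] at h2 ⊢
  · rw [abs_of_pos (by linarith)]
  · rw [abs_of_neg (by linarith)]; ring
  · rw [abs_of_neg (by linarith)]; ring
  · rw [abs_of_pos (by linarith)]

theorem sign_ne_zero (o : Orient I M) (x : M) : o.sign x ≠ 0 := by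
  rcases o.sign_eq x with h | h <;> rw [h] <;> norm_num

/-- Naturality of the Hodge dual, applied to the coordinate change. At good points `Good.sign_mul`
is exactly the required sign condition, and it allows the varying sign to be replaced by the
constant `o.sign x₀`. -/
theorem inChart_hodge (g : Metric I M) (o : Orient I M) {p q : ℕ} (h : n = q + p)
    (β : M → (Euc n) [⋀^Fin p]→L[ℝ] V) {x₀ x : M} (hx : Good o x₀ x) :
    inChart I (fun x => hodge g o x h (β x)) x₀ (extChartAt I x₀ x)
      = hodgeAlg (chartGram g x₀ (extChartAt I x₀ x)) (o.sign x₀) h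
        (inChart I β x₀ (extChartAt I x₀ x)) := by
  rw [inChart_apply _ hx.1, inChart_apply _ hx.1, chartGram_apply g hx.1]
  refine (hodgeAlg_compContinuousLinearMap _ (o.sign x) _ h (β x) _ _ (apply_frame _) ?_ ?_).symm
  · rw [det_frameMatrix]
    exact det_tangentCoordChange_ne_zero hx.1 (mem_extChartAt_source x)
  · rw [det_frameMatrix]
    exact hx.sign_mul

theorem eventually_good_symm (o : Orient I M) (x₀ : M) :
    ∀ᶠ y in 𝓝[range I] (extChartAt I x₀ x₀), y ∈ (extChartAt I x₀).target ∧
      Good o x₀ ((extChartAt I x₀).symm y) :=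
  (eventually_mem_target (mem_extChartAt_source x₀)).and
    ((tendsto_symm (mem_extChartAt_source (I := I) x₀)).eventually (eventually_good o x₀))

theorem contDiffWithinAt_det {X : Type*} [NormedAddCommGroup X] [NormedSpace ℝ X]
    {G : X → Matrix (Fin n) (Fin n) ℝ} {s : Set X} {x : X}
    (hG : ∀ i j, ContDiffWithinAt ℝ ∞ (fun y => G y i j) s x) :
    ContDiffWithinAt ℝ ∞ (fun y => (G y).det) s x := by
  simp only [Matrix.det_apply, Units.smul_def, ← Int.cast_smul_eq_zsmul ℝ]
  refine ContDiffWithinAt.sum fun σ _ => ?_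
  have h1 : ContDiffWithinAt ℝ ∞ (fun y => ∏ i, G y (σ i) i) s x :=
    contDiffWithinAt_prod fun k _ => hG _ _
  exact (contDiffWithinAt_const (c := ((Equiv.Perm.sign σ : ℤ) : ℝ))).mul h1

theorem contDiffWithinAt_hodgeAlg [FiniteDimensional ℝ V] {X : Type*} [NormedAddCommGroup X]
    [NormedSpace ℝ X] {G : X → Matrix (Fin n) (Fin n) ℝ} {s : Set X} {x : X}
    (hG : ∀ i j, ContDiffWithinAt ℝ ∞ (fun y => G y i j) s x) (hdet : (G x).det ≠ 0) (c : ℝ)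
    {p q : ℕ} (h : n = q + p) {β : X → (Euc n) [⋀^Fin p]→L[ℝ] V}
    (hβ : ContDiffWithinAt ℝ ∞ β s x) :
    ContDiffWithinAt ℝ ∞ (fun y => hodgeAlg (G y) c h (β y)) s x := by
  have hd := contDiffWithinAt_det hG
  have habs : ContDiffWithinAt ℝ ∞ (fun y => √|(G y).det|) s x := by
    have h1 : ContDiffWithinAt ℝ ∞ (fun y => |(G y).det|) s x :=
      ContDiffAt.comp_contDiffWithinAt x (contDiffAt_abs hdet) hd
    exact h1.sqrt (abs_ne_zero.2 hdet)
  -- By Cramer's rule each entry of the inverse is the determinant of `G` with one row replaced by a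
  -- constant row, divided by det G.
  have hinv : ∀ i j, ContDiffWithinAt ℝ ∞ (fun y => (G y)⁻¹ i j) s x := by
    intro i j
    simp only [Matrix.inv_def, Ring.inverse_eq_inv', Matrix.smul_apply, smul_eq_mul,
      Matrix.adjugate_apply]
    refine (hd.inv hdet).mul (contDiffWithinAt_det fun k l => ?_)
    by_cases hk : k = j
    · subst hk
      simp only [Matrix.updateRow_self]
      exact contDiffWithinAt_const
    · simp only [Matrix.updateRow_ne hk]
      exact hG _ _
  refine contDiffWithinAt_of_components fun f => ?_
  simp only [hodgeAlg_apply_frame]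
  refine (contDiffWithinAt_const.mul habs).smul (ContDiffWithinAt.sum fun f _ =>
    ContDiffWithinAt.sum fun r _ => ContDiffWithinAt.smul ?_
      (contDiffWithinAt_alternating_apply hβ _))
  exact contDiffWithinAt_const.mul (contDiffWithinAt_prod fun k _ => hinv _ _)

theorem smoothAt_hodge [FiniteDimensional ℝ V] (g : Metric I M) (o : Orient I M) {p q : ℕ}
    (h : n = q + p) {β : M → (Euc n) [⋀^Fin p]→L[ℝ] V} {x : M} (hβ : SmoothAt I β x) :
    SmoothAt I (fun x => hodge g o x h (β x)) x := by
  have e : inChart I (fun x => hodge g o x h (β x)) x =ᶠ[𝓝[range I] (extChartAt I x x)]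
      fun y => hodgeAlg (chartGram g x y) (o.sign x) h (inChart I β x y) := by
    filter_upwards [eventually_good_symm o x] with y hy
    have := inChart_hodge g o h β hy.2
    rwa [(extChartAt I x).right_inv hy.1] at this
  refine ContDiffWithinAt.congr_of_eventuallyEq ?_ e (e.self_of_nhdsWithin (mem_range_self _))
  refine contDiffWithinAt_hodgeAlg (fun i j => ?_)
    (chartGram_det_ne_zero g (mem_extChartAt_target x)) _ h hβ
  exact (chartGram_smooth g x i j _ (mem_extChartAt_target x)).mono_of_mem_nhdsWithin
    (extChartAt_target_mem_nhdsWithin x)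

end HodgeCharts

/-! ### Homogeneous forms of integer degree. -/

section Homogeneous

variable {n : ℕ} {M : Type*} {V : Type*} [NormedAddCommGroup V] [NormedSpace ℝ V] {p : ℤ}
  {θ η : DForm n M V}

/-- Homogeneity of degree `p`. -/
def IsHom (p : ℤ) (θ : DForm n M V) : Prop := ∀ q : ℕ, (q : ℤ) ≠ p → θ q = 0

theorem IsHom.ext {p : ℕ} (hθ : IsHom p θ) (hη : IsHom p η) (h : ∀ x, θ p x = η p x) : θ = η := by
  funext q
  by_cases hq : q = p
  · subst hq; exact funext h
  · rw [hθ q (by exact_mod_cast hq), hη q (by exact_mod_cast hq)]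

theorem IsHom.eq_zero_of_neg (hp : p < 0) (hθ : IsHom p θ) : θ = 0 :=
  funext fun q => hθ q (by omega)

theorem alternating_eq_zero_of_lt {q : ℕ} (h : n < q) (a : (Euc n) [⋀^Fin q]→L[ℝ] V) : a = 0 := by
  refine ext_frame fun f => ?_
  have : ¬ Function.Injective f := fun hf => by
    have := Fintype.card_le_of_injective f hf
    simp at this; omega
  obtain ⟨i, j, hij, hne⟩ := Function.not_injective_iff.1 this
  exact a.map_eq_zero_of_eq _ (by simp [hij]) hne

theorem IsHom.eq_zero_of_gt (hp : (n : ℤ) < p) (hθ : IsHom p θ) : θ = 0 := by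
  funext q
  by_cases hq : (q : ℤ) = p
  · exact funext fun x => alternating_eq_zero_of_lt (by omega) _
  · exact hθ q hq

theorem isHom_zero (p : ℤ) : IsHom p (0 : DForm n M V) := fun _ _ => rfl

theorem IsHom.add (hθ : IsHom p θ) (hη : IsHom p η) : IsHom p (θ + η) := fun q hq => by
  change θ q + η q = 0
  rw [hθ q hq, hη q hq, add_zero]

theorem IsHom.smul {R : Type*} [Monoid R] [DistribMulAction R V] [SMulCommClass ℝ R V]
    [ContinuousConstSMul R V] (c : R) (hθ : IsHom p θ) : IsHom p (c • θ) := fun q hq => by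
  change c • θ q = 0
  rw [hθ q hq, smul_zero]

end Homogeneous

/-! ### The exterior product of forms: bilinearity, degree, commutativity, associativity. -/

section WedgeForms

variable {𝕜 : Type*} [RCLike 𝕜] {n : ℕ} {M : Type*} {V W U : Type*}
  [NormedAddCommGroup V] [NormedSpace ℝ V] [NormedSpace 𝕜 V] [IsScalarTower ℝ 𝕜 V]
  [FiniteDimensional 𝕜 V]
  [NormedAddCommGroup W] [NormedSpace ℝ W] [NormedSpace 𝕜 W] [IsScalarTower ℝ 𝕜 W]
  [FiniteDimensional 𝕜 W]
  [NormedAddCommGroup U] [NormedSpace ℝ U] [NormedSpace 𝕜 U] [IsScalarTower ℝ 𝕜 U]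

@[simp] theorem realBilinear_apply (B : V →ₗ[𝕜] W →ₗ[𝕜] U) (x : V) (y : W) :
    realBilinear B x y = B x y := rfl

theorem realBilinear_flip (B : V →ₗ[𝕜] W →ₗ[𝕜] U) :
    realBilinear B.flip = (realBilinear B).flip := rfl

/-- The exterior product of two families of alternating maps, in degree `r`. -/
def wedgePt (B : V →L[ℝ] W →L[ℝ] U) (a : (p : ℕ) → (Euc n) [⋀^Fin p]→L[ℝ] V)
    (b : (p : ℕ) → (Euc n) [⋀^Fin p]→L[ℝ] W) (r : ℕ) : (Euc n) [⋀^Fin r]→L[ℝ] U :=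
  ∑ i : Fin (r + 1), castDeg (Nat.add_sub_of_le (Nat.le_of_lt_succ i.2))
    (wedgeAlt B (a i) (b (r - i)))

theorem wedge_eq_wedgePt (B : V →ₗ[𝕜] W →ₗ[𝕜] U) (θ : DForm n M V) (η : DForm n M W) (r : ℕ)
    (x : M) : wedge B θ η r x = wedgePt (realBilinear B) (fun p => θ p x) (fun p => η p x) r := rfl

theorem wedge_apply (B : V →ₗ[𝕜] W →ₗ[𝕜] U) (θ : DForm n M V) (η : DForm n M W) (r : ℕ)
    (x : M) (v : Fin r → Euc n) :
    wedge B θ η r x v = ∑ i : Fin (r + 1), (((i : ℕ)! * (r - i)! : ℝ)⁻¹) •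
      ∑ σ : Equiv.Perm (Fin (i + (r - i))), Equiv.Perm.sign σ •
        B (θ i x ((((v ∘ Fin.cast (Nat.add_sub_of_le (Nat.le_of_lt_succ i.2))) ∘ σ)
          ∘ Fin.castAdd _)))
          (η (r - i) x (((v ∘ Fin.cast (Nat.add_sub_of_le (Nat.le_of_lt_succ i.2))) ∘ σ)
            ∘ Fin.natAdd _)) := by
  simp only [wedge, ContinuousAlternatingMap.sum_apply, castDeg_apply, wedgeAlt_apply, altSum,
    realBilinear_apply]

theorem wedge_add_left (B : V →ₗ[𝕜] W →ₗ[𝕜] U) (θ θ' : DForm n M V) (η : DForm n M W) :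
    wedge B (θ + θ') η = wedge B θ η + wedge B θ' η := by
  funext r x; ext v
  change _ = wedge B θ η r x v + wedge B θ' η r x v
  have h : ∀ p y w, (θ + θ') p y w = θ p y w + θ' p y w := fun _ _ _ => rfl
  simp only [wedge_apply, h, map_add, smul_add, LinearMap.add_apply, Finset.sum_add_distrib]

theorem wedge_add_right (B : V →ₗ[𝕜] W →ₗ[𝕜] U) (θ : DForm n M V) (η η' : DForm n M W) :
    wedge B θ (η + η') = wedge B θ η + wedge B θ η' := by
  funext r x; ext v
  change _ = wedge B θ η r x v + wedge B θ η' r x v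
  have h : ∀ p y w, (η + η') p y w = η p y w + η' p y w := fun _ _ _ => rfl
  simp only [wedge_apply, h, map_add, smul_add, Finset.sum_add_distrib]

theorem wedge_smul_left (B : V →ₗ[𝕜] W →ₗ[𝕜] U) (c : 𝕜) (θ : DForm n M V) (η : DForm n M W) :
    wedge B (c • θ) η = c • wedge B θ η := by
  funext r x; ext v
  change _ = c • wedge B θ η r x v
  have h : ∀ p y w, (c • θ) p y w = c • θ p y w := fun _ _ _ => rfl
  simp only [wedge_apply, h, map_smul, LinearMap.smul_apply, Finset.smul_sum]
  simp only [smul_comm c]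

theorem wedge_smul_right (B : V →ₗ[𝕜] W →ₗ[𝕜] U) (c : 𝕜) (θ : DForm n M V) (η : DForm n M W) :
    wedge B θ (c • η) = c • wedge B θ η := by
  funext r x; ext v
  change _ = c • wedge B θ η r x v
  have h : ∀ p y w, (c • η) p y w = c • η p y w := fun _ _ _ => rfl
  simp only [wedge_apply, h, map_smul, Finset.smul_sum]
  simp only [smul_comm c]

theorem wedge_zero_left (B : V →ₗ[𝕜] W →ₗ[𝕜] U) (η : DForm n M W) :
    wedge B (0 : DForm n M V) η = 0 := by
  simpa using wedge_smul_left B 0 0 η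

theorem wedge_zero_right (B : V →ₗ[𝕜] W →ₗ[𝕜] U) (θ : DForm n M V) :
    wedge B θ (0 : DForm n M W) = 0 := by
  simpa using wedge_smul_right B 0 θ 0

theorem wedge_neg_left (B : V →ₗ[𝕜] W →ₗ[𝕜] U) (θ : DForm n M V) (η : DForm n M W) :
    wedge B (-θ) η = -wedge B θ η := by
  simpa using wedge_smul_left B (-1) θ η

theorem wedge_neg_right (B : V →ₗ[𝕜] W →ₗ[𝕜] U) (θ : DForm n M V) (η : DForm n M W) :
    wedge B θ (-η) = -wedge B θ η := by
  simpa using wedge_smul_right B (-1) θ η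

theorem wedge_sub_left (B : V →ₗ[𝕜] W →ₗ[𝕜] U) (θ θ' : DForm n M V) (η : DForm n M W) :
    wedge B (θ - θ') η = wedge B θ η - wedge B θ' η := by
  rw [sub_eq_add_neg, wedge_add_left, wedge_neg_left, sub_eq_add_neg]

theorem wedge_sub_right (B : V →ₗ[𝕜] W →ₗ[𝕜] U) (θ : DForm n M V) (η η' : DForm n M W) :
    wedge B θ (η - η') = wedge B θ η - wedge B θ η' := by
  rw [sub_eq_add_neg, wedge_add_right, wedge_neg_right, sub_eq_add_neg]

theorem wedge_congr_bilin (B B' : V →ₗ[𝕜] W →ₗ[𝕜] U) (h : ∀ x y, B x y = -B' x y)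
    (θ : DForm n M V) (η : DForm n M W) : wedge B θ η = -wedge B' θ η := by
  have : B = (-1 : 𝕜) • B' := by ext x y; simp [h]
  rw [this]
  funext r x; ext v
  change _ = - wedge B' θ η r x v
  simp only [wedge_apply, LinearMap.smul_apply, LinearMap.neg_apply, ← Finset.sum_neg_distrib, ← smul_neg, neg_smul, one_smul]

/-- Adjointness of two maps on values passes to forms. It is applied with α and α*. -/
theorem wedge_mapForm_left {V' : Type*} [NormedAddCommGroup V'] [NormedSpace ℝ V']
    [NormedSpace 𝕜 V'] [IsScalarTower ℝ 𝕜 V'] [FiniteDimensional 𝕜 V']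
    {W' : Type*} [NormedAddCommGroup W'] [NormedSpace ℝ W']
    [NormedSpace 𝕜 W'] [IsScalarTower ℝ 𝕜 W'] [FiniteDimensional 𝕜 W']
    (B : V' →ₗ[𝕜] W →ₗ[𝕜] U) (B' : V →ₗ[𝕜] W' →ₗ[𝕜] U) (f : V →ₗ[𝕜] V') (f' : W →ₗ[𝕜] W')
    (h : ∀ x y, B (f x) y = B' x (f' y)) (θ : DForm n M V) (η : DForm n M W) :
    wedge B (mapForm f θ) η = wedge B' θ (mapForm f' η) := by
  funext r x; ext v
  have h1 : ∀ p y w, mapForm f θ p y w = f (θ p y w) := fun _ _ _ => rfl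
  have h2 : ∀ p y w, mapForm f' η p y w = f' (η p y w) := fun _ _ _ => rfl
  simp only [wedge_apply, h1, h2, h]

theorem mapForm_add (f : V →ₗ[𝕜] U) (θ η : DForm n M V) :
    mapForm f (θ + η) = mapForm f θ + mapForm f η := by
  funext p x; ext v
  exact map_add f _ _

theorem mapForm_smul (f : V →ₗ[𝕜] U) (c : 𝕜) (θ : DForm n M V) :
    mapForm f (c • θ) = c • mapForm f θ := by
  funext p x; ext v
  exact map_smul f _ _

theorem mapForm_zero (f : V →ₗ[𝕜] U) : mapForm f (0 : DForm n M V) = 0 := by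
  simpa using mapForm_smul f 0 0

theorem smul_eq_mapForm (c : 𝕜) (θ : DForm n M V) :
    c • θ = mapForm (c • (LinearMap.id : V →ₗ[𝕜] V)) θ := by
  funext p x; ext v; rfl

theorem real_smul_eq (t : ℝ) (θ : DForm n M V) : t • θ = (t : 𝕜) • θ := by
  funext p x; ext v
  exact RCLike.real_smul_eq_coe_smul (K := 𝕜) t (θ p x v)

theorem IsHom.mapForm (f : V →ₗ[𝕜] U) {p : ℤ} {θ : DForm n M V} (h : IsHom p θ) :
    IsHom p (mapForm f θ) := fun q hq => by
  funext x; ext v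
  change f (θ q x v) = 0
  rw [h q hq]
  exact map_zero f

theorem wedgeAlt_zero_left {V W U E : Type*} [NormedAddCommGroup V] [NormedSpace ℝ V]
    [NormedAddCommGroup W] [NormedSpace ℝ W] [NormedAddCommGroup U] [NormedSpace ℝ U]
    [NormedAddCommGroup E] [NormedSpace ℝ E] (B : V →L[ℝ] W →L[ℝ] U) {p q : ℕ}
    (b : E [⋀^Fin q]→L[ℝ] W) : wedgeAlt B (0 : E [⋀^Fin p]→L[ℝ] V) b = 0 := by
  ext v; simp [wedgeAlt_apply, altSum]

theorem wedgeAlt_zero_right {V W U E : Type*} [NormedAddCommGroup V] [NormedSpace ℝ V]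
    [NormedAddCommGroup W] [NormedSpace ℝ W] [NormedAddCommGroup U] [NormedSpace ℝ U]
    [NormedAddCommGroup E] [NormedSpace ℝ E] (B : V →L[ℝ] W →L[ℝ] U) {p q : ℕ}
    (a : E [⋀^Fin p]→L[ℝ] V) : wedgeAlt B a (0 : E [⋀^Fin q]→L[ℝ] W) = 0 := by
  ext v; simp [wedgeAlt_apply, altSum]

theorem castDeg_zero {V E : Type*} [NormedAddCommGroup V] [NormedSpace ℝ V]
    [NormedAddCommGroup E] [NormedSpace ℝ E] {p q : ℕ} (h : p = q) :
    castDeg h (0 : E [⋀^Fin p]→L[ℝ] V) = 0 := by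
  subst h; rfl

theorem wedgePt_degree (B : V →L[ℝ] W →L[ℝ] U) {a : (p : ℕ) → (Euc n) [⋀^Fin p]→L[ℝ] V}
    (b : (p : ℕ) → (Euc n) [⋀^Fin p]→L[ℝ] W) {p q r : ℕ} (h : p + q = r)
    (ha : ∀ i, i ≠ p → a i = 0) : wedgePt B a b r = castDeg h (wedgeAlt B (a p) (b q)) := by
  rw [wedgePt, Finset.sum_eq_single (⟨p, by omega⟩ : Fin (r + 1))]
  · have : ∀ (s : ℕ) (hs : s = q) (h' : p + s = r),
        castDeg h' (wedgeAlt B (a p) (b s)) = castDeg h (wedgeAlt B (a p) (b q)) := by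
      intro s hs h'
      subst hs; rfl
    exact this _ (by simp; omega) _
  · intro i _ hi
    rw [ha i (fun hip => hi (Fin.ext hip)), wedgeAlt_zero_left, castDeg_zero]
  · simp

theorem wedge_degree (B : V →ₗ[𝕜] W →ₗ[𝕜] U) {θ : DForm n M V} (η : DForm n M W) {p q r : ℕ}
    (h : p + q = r) (hθ : IsHom p θ) (x : M) :
    wedge B θ η r x = castDeg h (wedgeAlt (realBilinear B) (θ p x) (η q x)) := by
  rw [wedge_eq_wedgePt]
  exact wedgePt_degree _ _ h fun i hi => congrFun (hθ i (by exact_mod_cast hi)) x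

theorem IsHom.wedge (B : V →ₗ[𝕜] W →ₗ[𝕜] U) {θ : DForm n M V} {η : DForm n M W} {p q : ℤ}
    (hθ : IsHom p θ) (hη : IsHom q η) : IsHom (p + q) (wedge B θ η) := fun r hr => by
  funext x
  refine Finset.sum_eq_zero fun i _ => ?_
  by_cases hi : ((i : ℕ) : ℤ) = p
  · rw [hη (r - i) (by have := i.2; omega), Pi.zero_apply, wedgeAlt_zero_right, castDeg_zero]
  · rw [hθ i hi, Pi.zero_apply, wedgeAlt_zero_left, castDeg_zero]

theorem wedge_comm (B : V →ₗ[𝕜] W →ₗ[𝕜] U) {θ : DForm n M V} {η : DForm n M W} {p q : ℤ}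
    (hθ : IsHom p θ) (hη : IsHom q η) :
    wedge B θ η = ((-1 : 𝕜) ^ (p * q)) • wedge B.flip η θ := by
  -- Degrees are integers because n - 3 and n - 4 occur as degrees and may be negative. A form of
  -- negative degree is zero, so the identity is trivial there and the degrees can be lifted to ℕ.
  rcases lt_or_ge p 0 with hp | hp
  · rw [hθ.eq_zero_of_neg hp, wedge_zero_left, wedge_zero_right, smul_zero]
  rcases lt_or_ge q 0 with hq | hq
  · rw [hη.eq_zero_of_neg hq, wedge_zero_left, wedge_zero_right, smul_zero]
  lift p to ℕ using hp
  lift q to ℕ using hq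
  have h1 : IsHom ((p + q : ℕ) : ℤ) (wedge B θ η) := by
    rw [Nat.cast_add]; exact hθ.wedge B hη
  have h2 : IsHom ((p + q : ℕ) : ℤ) (((-1 : 𝕜) ^ ((p : ℤ) * q)) • wedge B.flip η θ) := by
    rw [Nat.cast_add, add_comm]; exact (hη.wedge B.flip hθ).smul _
  refine h1.ext h2 fun x => ?_
  change _ = ((-1 : 𝕜) ^ ((p : ℤ) * q)) • wedge B.flip η θ (p + q) x
  rw [wedge_degree B η rfl hθ, wedge_degree B.flip θ (Nat.add_comm q p) hη]
  have key := wedgeAlt_comm (realBilinear B) (θ p x) (η q x)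
  rw [← realBilinear_flip] at key
  ext v
  have k := congrArg (fun a => a (v ∘ Fin.cast (Nat.add_comm q p))) key
  simp only [castDeg_apply, ContinuousAlternatingMap.smul_apply] at k
  simp only [castDeg_apply, ContinuousAlternatingMap.smul_apply]
  rw [show ((p : ℤ) * q) = ((p * q : ℕ) : ℤ) by push_cast; rfl, zpow_natCast]
  refine Eq.trans k ?_
  rcases Nat.even_or_odd (p * q) with h | h <;> simp [h.neg_one_pow]

theorem wedge_assoc {V₁ V₂ V₃ V₁₂ V₂₃ : Type*}
    [NormedAddCommGroup V₁] [NormedSpace ℝ V₁] [NormedSpace 𝕜 V₁] [IsScalarTower ℝ 𝕜 V₁]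
    [FiniteDimensional 𝕜 V₁]
    [NormedAddCommGroup V₂] [NormedSpace ℝ V₂] [NormedSpace 𝕜 V₂] [IsScalarTower ℝ 𝕜 V₂]
    [FiniteDimensional 𝕜 V₂]
    [NormedAddCommGroup V₃] [NormedSpace ℝ V₃] [NormedSpace 𝕜 V₃] [IsScalarTower ℝ 𝕜 V₃]
    [FiniteDimensional 𝕜 V₃]
    [NormedAddCommGroup V₁₂] [NormedSpace ℝ V₁₂] [NormedSpace 𝕜 V₁₂] [IsScalarTower ℝ 𝕜 V₁₂]
    [FiniteDimensional 𝕜 V₁₂]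
    [NormedAddCommGroup V₂₃] [NormedSpace ℝ V₂₃] [NormedSpace 𝕜 V₂₃] [IsScalarTower ℝ 𝕜 V₂₃]
    [FiniteDimensional 𝕜 V₂₃]
    (B₁₂ : V₁ →ₗ[𝕜] V₂ →ₗ[𝕜] V₁₂) (B : V₁₂ →ₗ[𝕜] V₃ →ₗ[𝕜] U)
    (B₂₃ : V₂ →ₗ[𝕜] V₃ →ₗ[𝕜] V₂₃) (B' : V₁ →ₗ[𝕜] V₂₃ →ₗ[𝕜] U)
    (hB : ∀ x y z, B (B₁₂ x y) z = B' x (B₂₃ y z)) {a : DForm n M V₁} {b : DForm n M V₂}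
    {c : DForm n M V₃} {p q r : ℤ} (ha : IsHom p a) (hb : IsHom q b) (hc : IsHom r c) :
    wedge B (wedge B₁₂ a b) c = wedge B' a (wedge B₂₃ b c) := by
  rcases lt_or_ge p 0 with hp | hp
  · simp only [ha.eq_zero_of_neg hp, wedge_zero_left]
  rcases lt_or_ge q 0 with hq | hq
  · simp only [hb.eq_zero_of_neg hq, wedge_zero_left, wedge_zero_right]
  rcases lt_or_ge r 0 with hr | hr
  · simp only [hc.eq_zero_of_neg hr, wedge_zero_right]
  lift p to ℕ using hp
  lift q to ℕ using hq
  lift r to ℕ using hr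
  have hab : IsHom ((p + q : ℕ) : ℤ) (wedge B₁₂ a b) := by
    rw [Nat.cast_add]; exact ha.wedge _ hb
  have h1 : IsHom ((p + q + r : ℕ) : ℤ) (wedge B (wedge B₁₂ a b) c) := by
    rw [Nat.cast_add]; exact hab.wedge _ hc
  have h2 : IsHom ((p + q + r : ℕ) : ℤ) (wedge B' a (wedge B₂₃ b c)) := by
    push_cast
    rw [add_assoc]
    exact ha.wedge _ (hb.wedge _ hc)
  refine h1.ext h2 fun x => ?_
  rw [wedge_degree B c rfl hab, wedge_degree B₁₂ b rfl ha,
    wedge_degree B' _ (Nat.add_assoc p q r).symm ha, wedge_degree B₂₃ c rfl hb]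
  have key := wedgeAlt_assoc (realBilinear B₁₂) (realBilinear B) (realBilinear B₂₃)
    (realBilinear B') hB (a p x) (b q x) (c r x)
  simp only [castDeg_rfl]
  rw [← key]
  ext v
  simp only [castDeg_apply]
  congr 1

end WedgeForms

/-! ### Smooth forms: closure under the operations, and linearity of the exterior derivative. -/

section Forms

variable {𝕜 : Type*} [RCLike 𝕜] {n : ℕ} {H : Type*} [TopologicalSpace H]
  {I : ModelWithCorners ℝ (Euc n) H}
  {M : Type*} [TopologicalSpace M] [ChartedSpace H M] [IsManifold I ∞ M] {V W U : Type*}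
  [NormedAddCommGroup V] [NormedSpace ℝ V] [NormedSpace 𝕜 V] [IsScalarTower ℝ 𝕜 V]
  [FiniteDimensional 𝕜 V]
  [NormedAddCommGroup W] [NormedSpace ℝ W] [NormedSpace 𝕜 W] [IsScalarTower ℝ 𝕜 W]
  [FiniteDimensional 𝕜 W]
  [NormedAddCommGroup U] [NormedSpace ℝ U] [NormedSpace 𝕜 U] [IsScalarTower ℝ 𝕜 U]
  [FiniteDimensional 𝕜 U]

theorem isForm_iff [FiniteDimensional ℝ V] {p : ℤ} {θ : DForm n M V} :
    IsForm I p θ ↔ IsHom p θ ∧ ∀ q x, SmoothAt I (θ q) x := by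
  rw [IsForm, IsHom]
  exact and_congr_right fun _ => forall_congr' fun q => contDiffOn_inChart_iff

theorem IsForm.isHom {V : Type*} [NormedAddCommGroup V] [NormedSpace ℝ V] {p : ℤ}
    {θ : DForm n M V} (h : IsForm I p θ) : IsHom p θ := h.1

theorem IsForm.smoothAt {V : Type*} [NormedAddCommGroup V] [NormedSpace ℝ V] {p : ℤ}
    {θ : DForm n M V} (h : IsForm I p θ) (q : ℕ) (x : M) : SmoothAt I (θ q) x :=
  (h.2 q x _ (mem_extChartAt_target x)).mono_of_mem_nhdsWithin
    (extChartAt_target_mem_nhdsWithin x)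

theorem IsForm.of_smoothAt [FiniteDimensional ℝ V] {p : ℤ} {θ : DForm n M V} (h : IsHom p θ)
    (h' : ∀ q x, SmoothAt I (θ q) x) : IsForm I p θ := isForm_iff.2 ⟨h, h'⟩

theorem isForm_zero [FiniteDimensional ℝ V] (p : ℤ) : IsForm I p (0 : DForm n M V) :=
  .of_smoothAt (isHom_zero p) fun _ _ => smoothAt_zero _

theorem IsForm.add [FiniteDimensional ℝ V] {p : ℤ} {θ η : DForm n M V} (h : IsForm I p θ)
    (h' : IsForm I p η) : IsForm I p (θ + η) :=
  .of_smoothAt (h.isHom.add h'.isHom) fun q x => (h.smoothAt q x).add (h'.smoothAt q x)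

theorem IsForm.mapForm (f : V →ₗ[𝕜] U) {p : ℤ} {θ : DForm n M V} (h : IsForm I p θ) :
    IsForm I p (mapForm f θ) :=
  haveI : FiniteDimensional ℝ U := FiniteDimensional.trans ℝ 𝕜 U
  .of_smoothAt (h.isHom.mapForm f) fun q x => (h.smoothAt q x).compLinear (realLinear f)

theorem IsForm.smul (c : 𝕜) {p : ℤ} {θ : DForm n M V} (h : IsForm I p θ) :
    IsForm I p (c • θ) := by
  rw [smul_eq_mapForm]; exact h.mapForm _

theorem IsForm.neg [FiniteDimensional ℝ V] {p : ℤ} {θ : DForm n M V} (h : IsForm I p θ) :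
    IsForm I p (-θ) := by
  simpa using h.smul (-1 : ℝ)

theorem IsForm.sub [FiniteDimensional ℝ V] {p : ℤ} {θ η : DForm n M V} (h : IsForm I p θ)
    (h' : IsForm I p η) : IsForm I p (θ - η) := by
  rw [sub_eq_add_neg]
  exact h.add h'.neg

theorem IsForm.wedge (B : V →ₗ[𝕜] W →ₗ[𝕜] U) {p q : ℤ} {θ : DForm n M V} {η : DForm n M W}
    (h : IsForm I p θ) (h' : IsForm I q η) : IsForm I (p + q) (wedge B θ η) := by
  have : FiniteDimensional ℝ U := FiniteDimensional.trans ℝ 𝕜 U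
  refine .of_smoothAt (h.isHom.wedge B h'.isHom) fun r x => ?_
  exact smoothAt_sum _ fun i _ =>
    smoothAt_castDeg _ (smoothAt_wedgeAlt _ (h.smoothAt _ x) (h'.smoothAt _ x))

theorem d_succ {V : Type*} [NormedAddCommGroup V] [NormedSpace ℝ V] (θ : DForm n M V) (p : ℕ) :
    d I θ (p + 1) = extD I (θ p) := rfl

theorem extD_zero {V : Type*} [NormedAddCommGroup V] [NormedSpace ℝ V] (p : ℕ) :
    extD I (0 : M → (Euc n) [⋀^Fin p]→L[ℝ] V) = 0 := by
  funext x
  have : ∀ x, inChart I (0 : M → (Euc n) [⋀^Fin p]→L[ℝ] V) x = 0 := by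
    intro x; ext1 y; ext v; simp [inChart]
  rw [extD, this, extDerivWithin, fderivWithin_zero]
  ext v
  simp [ContinuousAlternatingMap.alternatizeUncurryFin_apply]

theorem d_zero {V : Type*} [NormedAddCommGroup V] [NormedSpace ℝ V] :
    d I (0 : DForm n M V) = 0 := by
  funext p
  cases p with
  | zero => rfl
  | succ p => exact extD_zero p

theorem IsHom.d {V : Type*} [NormedAddCommGroup V] [NormedSpace ℝ V] {p : ℤ} {θ : DForm n M V}
    (h : IsHom p θ) : IsHom (p + 1) (d I θ) := fun q hq => by
  cases q with
  | zero => rfl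
  | succ q =>
    rw [d_succ, h q (by push_cast at hq; omega)]
    exact extD_zero q

theorem IsForm.d [FiniteDimensional ℝ V] {p : ℤ} {θ : DForm n M V} (h : IsForm I p θ) :
    IsForm I (p + 1) (d I θ) := by
  refine .of_smoothAt h.isHom.d fun q x => ?_
  cases q with
  | zero => exact smoothAt_zero x
  | succ q => exact smoothAt_extD (h.smoothAt q) x

theorem d_add {V : Type*} [NormedAddCommGroup V] [NormedSpace ℝ V] {p q : ℤ} {θ η : DForm n M V}
    (h : IsForm I p θ) (h' : IsForm I q η) : d I (θ + η) = d I θ + d I η := by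
  funext r x
  cases r with
  | zero => exact (add_zero _).symm
  | succ r =>
    exact extDerivWithin_add (I.uniqueDiffOn _ (mem_range_self _))
      (ContDiffWithinAt.differentiableWithinAt (h.smoothAt r x) (by simp))
      (ContDiffWithinAt.differentiableWithinAt (h'.smoothAt r x) (by simp))

theorem d_smul (c : 𝕜) {p : ℤ} {θ : DForm n M V} (h : IsForm I p θ) :
    d I (c • θ) = c • d I θ := by
  funext r x
  cases r with
  | zero => exact (smul_zero c).symm
  | succ r =>
    have hs : DifferentiableWithinAt ℝ (inChart I (θ r) x) (range I) (extChartAt I x x) :=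
      ContDiffWithinAt.differentiableWithinAt (h.smoothAt r x) (by simp)
    change extDerivWithin (c • inChart I (θ r) x) _ _ = c • extDerivWithin _ _ _
    rw [extDerivWithin, extDerivWithin,
      fderivWithin_const_smul (I.uniqueDiffOn (extChartAt I x x) (mem_range_self _)) hs c,
      ContinuousAlternatingMap.alternatizeUncurryFin_smul]

theorem finiteDimensional_alternating (V : Type*) [NormedAddCommGroup V] [NormedSpace ℝ V]
    [FiniteDimensional ℝ V] (n p : ℕ) : FiniteDimensional ℝ ((Euc n) [⋀^Fin p]→L[ℝ] V) := by
  obtain ⟨R, hR⟩ := exists_components_leftInverse (n := n) (V := V) p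
  exact FiniteDimensional.of_injective (components n p V).toLinearMap
    (Function.LeftInverse.injective hR)

end Forms

/-! ### The Leibniz rule on the model space. -/

section Leibniz

variable {n : ℕ} {V W U : Type*} [NormedAddCommGroup V] [NormedSpace ℝ V] [FiniteDimensional ℝ V]
  [NormedAddCommGroup W] [NormedSpace ℝ W] [FiniteDimensional ℝ W]
  [NormedAddCommGroup U] [NormedSpace ℝ U]

/-- The exterior product as a bilinear map. -/
def wedgeAltL (B : V →L[ℝ] W →L[ℝ] U) (p q : ℕ) :
    (Euc n) [⋀^Fin p]→L[ℝ] V →L[ℝ] (Euc n) [⋀^Fin q]→L[ℝ] W →L[ℝ] (Euc n) [⋀^Fin (p + q)]→L[ℝ] U :=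
  haveI := finiteDimensional_alternating V n p
  haveI := finiteDimensional_alternating W n q
  LinearMap.toContinuousBilinearMap <| LinearMap.mk₂ ℝ (wedgeAlt B)
    (fun a a' b => by
      ext v
      simp only [wedgeAlt_apply, altSum, ContinuousAlternatingMap.add_apply, map_add,
        add_apply, smul_add, Finset.sum_add_distrib])
    (fun c a b => by
      ext v
      simp only [wedgeAlt_apply, altSum, ContinuousAlternatingMap.smul_apply, map_smul,
        smul_apply, Finset.smul_sum, smul_comm c])
    (fun a b b' => by
      ext v
      simp only [wedgeAlt_apply, altSum, ContinuousAlternatingMap.add_apply, map_add,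
        smul_add, Finset.sum_add_distrib])
    (fun c a b => by
      ext v
      simp only [wedgeAlt_apply, altSum, ContinuousAlternatingMap.smul_apply, map_smul,
        Finset.smul_sum, smul_comm c])

theorem wedgeAltL_apply (B : V →L[ℝ] W →L[ℝ] U) {p q : ℕ} (a : (Euc n) [⋀^Fin p]→L[ℝ] V)
    (b : (Euc n) [⋀^Fin q]→L[ℝ] W) : wedgeAltL B p q a b = wedgeAlt B a b := rfl

/-- The derivative of a bilinear expression has two terms, and alternating each of them is one of
the two algebraic halves of the Leibniz rule. -/
theorem extDerivWithin_wedgeAlt (B : V →L[ℝ] W →L[ℝ] U) {p q : ℕ}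
    {a : Euc n → (Euc n) [⋀^Fin p]→L[ℝ] V} {b : Euc n → (Euc n) [⋀^Fin q]→L[ℝ] W}
    {s : Set (Euc n)} {y : Euc n} (hs : UniqueDiffWithinAt ℝ s y)
    (ha : DifferentiableWithinAt ℝ a s y) (hb : DifferentiableWithinAt ℝ b s y) :
    extDerivWithin (fun z => wedgeAlt B (a z) (b z)) s y =
      castDeg (by omega) (wedgeAlt B (extDerivWithin a s y) (b y)) +
        (-1 : ℝ) ^ p • castDeg (Nat.add_assoc p q 1).symm
          (wedgeAlt B (a y) (extDerivWithin b s y)) := by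
  have h := ((wedgeAltL B p q).hasFDerivWithinAt_of_bilinear ha.hasFDerivWithinAt
    hb.hasFDerivWithinAt).fderivWithin hs
  simp only [wedgeAltL_apply] at h
  rw [extDerivWithin, h, ContinuousAlternatingMap.alternatizeUncurryFin_add]
  exact (congrArg₂ (· + ·)
    (alternatizeUncurryFin_wedgeAlt_right B (a y) (fderivWithin ℝ b s y) _ (fun _ => rfl))
    (alternatizeUncurryFin_wedgeAlt_left B (fderivWithin ℝ a s y) (b y) _ (fun _ => rfl))).trans
    (add_comm _ _)

end Leibniz

/-! ### The graded Leibniz rule on the manifold. -/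

section Forms

variable {𝕜 : Type*} [RCLike 𝕜] {n : ℕ} {H : Type*} [TopologicalSpace H]
  {I : ModelWithCorners ℝ (Euc n) H}
  {M : Type*} [TopologicalSpace M] [ChartedSpace H M] [IsManifold I ∞ M] {V W U : Type*}
  [NormedAddCommGroup V] [NormedSpace ℝ V] [NormedSpace 𝕜 V] [IsScalarTower ℝ 𝕜 V]
  [FiniteDimensional 𝕜 V]
  [NormedAddCommGroup W] [NormedSpace ℝ W] [NormedSpace 𝕜 W] [IsScalarTower ℝ 𝕜 W]
  [FiniteDimensional 𝕜 W]
  [NormedAddCommGroup U] [NormedSpace ℝ U] [NormedSpace 𝕜 U] [IsScalarTower ℝ 𝕜 U]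
  [FiniteDimensional 𝕜 U]

theorem extD_wedgeAlt [FiniteDimensional ℝ V] [FiniteDimensional ℝ W] (B : V →L[ℝ] W →L[ℝ] U)
    {p q : ℕ} {θ : M → (Euc n) [⋀^Fin p]→L[ℝ] V}
    {η : M → (Euc n) [⋀^Fin q]→L[ℝ] W} {x : M} (hθ : SmoothAt I θ x) (hη : SmoothAt I η x) :
    extD I (fun y => wedgeAlt B (θ y) (η y)) x =
      castDeg (by omega) (wedgeAlt B (extD I θ x) (η x)) +
        (-1 : ℝ) ^ p • castDeg (Nat.add_assoc p q 1).symm (wedgeAlt B (θ x) (extD I η x)) := by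
  have h : inChart I (fun y => wedgeAlt B (θ y) (η y)) x =
      fun z => wedgeAlt B (inChart I θ x z) (inChart I η x z) := by
    funext z
    exact wedgeAlt_compContinuousLinearMap _ _ _ _
  rw [extD, h, extDerivWithin_wedgeAlt B (I.uniqueDiffOn (extChartAt I x x) (mem_range_self _))
    (ContDiffWithinAt.differentiableWithinAt hθ (by simp))
    (ContDiffWithinAt.differentiableWithinAt hη (by simp)), inChart_self, inChart_self]
  rfl

theorem neg_one_pow_smul (p : ℕ) (v : V) : (-1 : ℝ) ^ p • v = (-1 : 𝕜) ^ p • v := by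
  rcases Nat.even_or_odd p with h | h <;> simp [h.neg_one_pow]

theorem d_wedge (B : V →ₗ[𝕜] W →ₗ[𝕜] U) {p q : ℤ} {θ : DForm n M V} {η : DForm n M W}
    (hθ : IsForm I p θ) (hη : IsForm I q η) :
    d I (wedge B θ η) = wedge B (d I θ) η + (-1 : 𝕜) ^ p • wedge B θ (d I η) := by
  rcases lt_or_ge p 0 with hp | hp
  · rw [hθ.isHom.eq_zero_of_neg hp, d_zero]
    simp only [wedge_zero_left, d_zero, smul_zero, add_zero]
  rcases lt_or_ge q 0 with hq | hq
  · rw [hη.isHom.eq_zero_of_neg hq, d_zero]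
    simp only [wedge_zero_right, d_zero, smul_zero, add_zero]
  lift p to ℕ using hp
  lift q to ℕ using hq
  have hdθ : IsHom ((p + 1 : ℕ) : ℤ) (d I θ) := by
    rw [Nat.cast_add, Nat.cast_one]; exact hθ.isHom.d
  have hw : IsHom ((p + q : ℕ) : ℤ) (wedge B θ η) := by
    rw [Nat.cast_add]; exact hθ.isHom.wedge B hη.isHom
  have h1 : IsHom ((p + q + 1 : ℕ) : ℤ) (d I (wedge B θ η)) := by
    rw [Nat.cast_add, Nat.cast_one]; exact IsHom.d hw
  have h2 : IsHom ((p + q + 1 : ℕ) : ℤ)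
      (wedge B (d I θ) η + (-1 : 𝕜) ^ (p : ℤ) • wedge B θ (d I η)) := by
    refine IsHom.add ?_ (IsHom.smul _ ?_)
    · have := hdθ.wedge B hη.isHom
      rwa [show (((p + 1 : ℕ) : ℤ) + q) = ((p + q + 1 : ℕ) : ℤ) by push_cast; ring] at this
    · have := hθ.isHom.wedge B (IsHom.d (I := I) hη.isHom)
      rwa [show ((p : ℤ) + (q + 1)) = ((p + q + 1 : ℕ) : ℤ) by push_cast; ring] at this
  have : FiniteDimensional ℝ V := FiniteDimensional.trans ℝ 𝕜 V
  have : FiniteDimensional ℝ W := FiniteDimensional.trans ℝ 𝕜 W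
  refine IsHom.ext h1 h2 fun x => ?_
  change _ = wedge B (d I θ) η (p + q + 1) x +
    (-1 : 𝕜) ^ (p : ℤ) • wedge B θ (d I η) (p + q + 1) x
  have hw' : wedge B θ η (p + q) = fun y => wedgeAlt (realBilinear B) (θ p y) (η q y) := by
    funext y
    rw [wedge_degree B η rfl hθ.isHom, castDeg_rfl]
  rw [d_succ, hw', extD_wedgeAlt _ (hθ.smoothAt p x) (hη.smoothAt q x),
    wedge_degree B η (by omega : p + 1 + q = p + q + 1) hdθ,
    wedge_degree B _ (Nat.add_assoc p q 1).symm hθ.isHom, zpow_natCast]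
  congr 1
  ext v
  exact neg_one_pow_smul p _

end Forms

/-! ### The Hodge star on forms: linearity, degree, smoothness, injectivity. -/

section Star

variable {n : ℕ} {H : Type*} [TopologicalSpace H] {I : ModelWithCorners ℝ (Euc n) H}
  {M : Type*} [TopologicalSpace M] [ChartedSpace H M] [IsManifold I ∞ M]
  {V : Type*} [NormedAddCommGroup V] [NormedSpace ℝ V] (g : Metric I M) (o : Orient I M)

theorem hodgeStar_degree (θ : DForm n M V) {p q : ℕ} (h : n = q + p) (x : M) :
    hodgeStar g o θ q x = hodge g o x h (θ p x) := by
  obtain rfl : p = n - q := by omega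
  rw [hodgeStar, dif_pos (by omega)]

theorem hodge_add (x : M) {p q : ℕ} (h : n = q + p) (β β' : (Euc n) [⋀^Fin p]→L[ℝ] V) :
    hodge g o x h (β + β') = hodge g o x h β + hodge g o x h β' :=
  hodgeAlg_add _ _ _ _ _

theorem hodge_smul {R : Type*} [Monoid R] [DistribMulAction R V] [SMulCommClass ℝ R V]
    [ContinuousConstSMul R V] (x : M) {p q : ℕ} (h : n = q + p) (c : R)
    (β : (Euc n) [⋀^Fin p]→L[ℝ] V) : hodge g o x h (c • β) = c • hodge g o x h β :=
  hodgeAlg_smul _ _ _ _ _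

theorem hodge_zero (x : M) {p q : ℕ} (h : n = q + p) :
    hodge g o x h (0 : (Euc n) [⋀^Fin p]→L[ℝ] V) = 0 := by
  simpa using hodge_smul g o x h (0 : ℝ) (0 : (Euc n) [⋀^Fin p]→L[ℝ] V)

theorem hodgeStar_add (θ η : DForm n M V) :
    hodgeStar g o (θ + η) = hodgeStar g o θ + hodgeStar g o η := by
  funext q x
  change _ = hodgeStar g o θ q x + hodgeStar g o η q x
  by_cases h : q ≤ n
  · simp only [hodgeStar, dif_pos h]
    exact hodge_add g o x _ _ _
  · simp only [hodgeStar, dif_neg h, add_zero]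

theorem hodgeStar_smul {R : Type*} [Monoid R] [DistribMulAction R V] [SMulCommClass ℝ R V]
    [ContinuousConstSMul R V] (c : R) (θ : DForm n M V) :
    hodgeStar g o (c • θ) = c • hodgeStar g o θ := by
  funext q x
  change _ = c • hodgeStar g o θ q x
  by_cases h : q ≤ n
  · simp only [hodgeStar, dif_pos h]
    exact hodge_smul g o x _ _ _
  · simp only [hodgeStar, dif_neg h, smul_zero]

theorem hodgeStar_zero : hodgeStar g o (0 : DForm n M V) = 0 := by
  simpa using hodgeStar_smul g o (0 : ℝ) (0 : DForm n M V)

theorem IsHom.hodgeStar {p : ℤ} {θ : DForm n M V} (h : IsHom p θ) :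
    IsHom (n - p) (hodgeStar g o θ) := fun q hq => by
  funext x
  by_cases hqn : q ≤ n
  · rw [hodgeStar_degree g o θ (p := n - q) (by omega) x, h _ (by omega)]
    exact hodge_zero g o x _
  · rw [HigherYM.hodgeStar, dif_neg hqn]; rfl

theorem IsForm.hodgeStar [FiniteDimensional ℝ V] {p : ℤ} {θ : DForm n M V} (h : IsForm I p θ) :
    IsForm I (n - p) (hodgeStar g o θ) := by
  refine .of_smoothAt (h.isHom.hodgeStar g o) fun q x => ?_
  by_cases hqn : q ≤ n
  · have : HigherYM.hodgeStar g o θ q = fun y =>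
        hodge g o y (Nat.add_sub_of_le hqn).symm (θ (n - q) y) :=
      funext fun y => hodgeStar_degree g o θ _ y
    rw [this]
    exact smoothAt_hodge g o _ (h.smoothAt _ x)
  · have : HigherYM.hodgeStar g o θ q = 0 := by
      funext y; rw [HigherYM.hodgeStar, dif_neg hqn]; rfl
    rw [this]
    exact smoothAt_zero x

theorem hodgeStar_injective {p : ℤ} {θ : DForm n M V} (h : IsHom p θ)
    (h0 : hodgeStar g o θ = 0) : θ = 0 := by
  rcases lt_or_ge p 0 with hp | hp
  · exact h.eq_zero_of_neg hp
  rcases lt_or_ge (n : ℤ) p with hn | hn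
  · exact h.eq_zero_of_gt hn
  lift p to ℕ using hp
  refine h.ext (isHom_zero _) fun x => ?_
  have h1 := congrFun (congrFun h0 (n - p)) x
  rw [hodgeStar_degree g o θ (p := p) (by omega) x] at h1
  exact hodgeAlg_injective _ (det_gram_ne_zero g x) _ (sign_ne_zero o x) _ _ h1

end Star

/-! ### Symmetry of the pairing ⟨X, ∗Y⟩. -/

section StarWedge

variable {𝕜 : Type*} [RCLike 𝕜] {n : ℕ} {H : Type*} [TopologicalSpace H]
  {I : ModelWithCorners ℝ (Euc n) H}
  {M : Type*} [TopologicalSpace M] [ChartedSpace H M] [IsManifold I ∞ M] {V W U : Type*}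
  [NormedAddCommGroup V] [NormedSpace ℝ V] [NormedSpace 𝕜 V] [IsScalarTower ℝ 𝕜 V]
  [FiniteDimensional 𝕜 V]
  [NormedAddCommGroup U] [NormedSpace ℝ U] [NormedSpace 𝕜 U] [IsScalarTower ℝ 𝕜 U]

theorem ext_top {U : Type*} [NormedAddCommGroup U] [NormedSpace ℝ U]
    {θ η : (Euc n) [⋀^Fin n]→L[ℝ] U} (h : θ frame = η frame) : θ = η := by
  refine ext_frame fun f => ?_
  by_cases hf : Function.Injective f
  · obtain ⟨e, rfl⟩ : ∃ e : Equiv.Perm (Fin n), f = e :=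
      ⟨Equiv.ofBijective f (Finite.injective_iff_bijective.1 hf), rfl⟩
    have h1 := θ.toAlternatingMap.map_perm frame e
    have h2 := η.toAlternatingMap.map_perm frame e
    exact h1.trans ((congrArg (fun u => Equiv.Perm.sign e • u) h).trans h2.symm)
  · obtain ⟨i, j, hij, hne⟩ := Function.not_injective_iff.1 hf
    rw [θ.map_eq_zero_of_eq _ (by simp [hij]) hne, η.map_eq_zero_of_eq _ (by simp [hij]) hne]

/-- A form of top degree is determined by its value on the frame, and there the pairing is symmetric
because the inverse Gram matrix and `B` are. This symmetry is the source of the factor 2 in the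
first variation. -/
theorem wedge_hodgeStar_comm (g : Metric I M) (o : Orient I M) (B : V →ₗ[𝕜] V →ₗ[𝕜] U)
    (hB : ∀ x y, B x y = B y x) {p : ℤ}
    {θ η : DForm n M V} (hθ : IsHom p θ) (hη : IsHom p η) :
    wedge B θ (hodgeStar g o η) = wedge B η (hodgeStar g o θ) := by
  rcases lt_or_ge p 0 with hp | hp
  · simp only [hθ.eq_zero_of_neg hp, hη.eq_zero_of_neg hp]
  rcases lt_or_ge (n : ℤ) p with hn | hn
  · simp only [hθ.eq_zero_of_gt hn, hη.eq_zero_of_gt hn]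
  lift p to ℕ using hp
  have h1 : IsHom (n : ℤ) (wedge B θ (hodgeStar g o η)) := by
    have := hθ.wedge B (hη.hodgeStar g o)
    rwa [add_sub_cancel] at this
  have h2 : IsHom (n : ℤ) (wedge B η (hodgeStar g o θ)) := by
    have := hη.wedge B (hθ.hodgeStar g o)
    rwa [add_sub_cancel] at this
  refine h1.ext h2 fun x => ext_top ?_
  have hpn : p + (n - p) = n := by omega
  have hflip : (realBilinear B).flip = realBilinear B := by ext x y; exact hB y x
  rw [wedge_degree B _ hpn hθ, wedge_degree B _ hpn hη, castDeg_apply, castDeg_apply,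
    hodgeStar_degree g o η (p := p) (by omega), hodgeStar_degree g o θ (p := p) (by omega)]
  have := wedgeAlt_hodgeAlg_symm (realBilinear B) (gram g x) (isSymm_gram g x) (o.sign x)
    (by omega) hpn (θ p x) (η p x)
  rw [hflip] at this
  exact this

end StarWedge

/-! ### The volume measure: agreement of chart measures, restriction to charts, local finiteness. -/

section Volume

variable {n : ℕ} {H : Type*} [TopologicalSpace H] {I : ModelWithCorners ℝ (Euc n) H}
  {M : Type*} [TopologicalSpace M] [ChartedSpace H M] [IsManifold I ∞ M]
  {V : Type*} [NormedAddCommGroup V] [NormedSpace ℝ V]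

theorem measurableSet_target (I : ModelWithCorners ℝ (Euc n) H) {M : Type*} [TopologicalSpace M]
    [ChartedSpace H M] (x₀ : M) : MeasurableSet (extChartAt I x₀).target := by
  rw [extChartAt_target]
  exact (((chartAt H x₀).open_target.preimage I.continuous_symm).measurableSet).inter
    I.isClosed_range.measurableSet

/-- The density of the volume measure in the chart centred at `x₀`. -/
def chartDensity (g : Metric I M) (x₀ : M) (y : Euc n) : ℝ := √|(chartGram g x₀ y).det|

theorem chartDensity_continuousOn (g : Metric I M) (x₀ : M) :
    ContinuousOn (chartDensity g x₀) (extChartAt I x₀).target := by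
  have : ContinuousOn (fun y => (chartGram g x₀ y).det) (extChartAt I x₀).target := fun y hy =>
    (contDiffWithinAt_det fun i j => chartGram_smooth g x₀ i j y hy).continuousWithinAt
  exact Real.continuous_sqrt.comp_continuousOn this.abs

theorem chartDensity_pos (g : Metric I M) {x₀ : M} {y : Euc n}
    (hy : y ∈ (extChartAt I x₀).target) : 0 < chartDensity g x₀ y :=
  Real.sqrt_pos.2 (abs_pos.2 (chartGram_det_ne_zero g hy))

theorem chartDensity_apply (g : Metric I M) {x₀ x : M} (hx : x ∈ (extChartAt I x₀).source) :
    chartDensity g x₀ (extChartAt I x₀ x) =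
      |LinearMap.det (tangentCoordChange I x₀ x x : Euc n →ₗ[ℝ] Euc n)| * √|(gram g x).det| := by
  rw [chartDensity, chartGram_apply g hx]
  simp only [Matrix.det_mul, Matrix.det_transpose, det_frameMatrix, abs_mul]
  rw [mul_right_comm, Real.sqrt_mul (by positivity), Real.sqrt_mul_self (abs_nonneg _)]

theorem chartDensity_change (g : Metric I M) {x₀ x₁ x : M} (h₀ : x ∈ (extChartAt I x₀).source)
    (h₁ : x ∈ (extChartAt I x₁).source) :
    chartDensity g x₁ (extChartAt I x₁ x) =
      |LinearMap.det (tangentCoordChange I x₁ x₀ x : Euc n →ₗ[ℝ] Euc n)| *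
        chartDensity g x₀ (extChartAt I x₀ x) := by
  rw [chartDensity_apply g h₀, chartDensity_apply g h₁, ← mul_assoc, ← abs_mul]
  have h : (tangentCoordChange I x₀ x x : Euc n →ₗ[ℝ] Euc n) ∘ₗ
      (tangentCoordChange I x₁ x₀ x : Euc n →ₗ[ℝ] Euc n) =
      (tangentCoordChange I x₁ x x : Euc n →ₗ[ℝ] Euc n) := by
    ext1 v
    exact tangentCoordChange_comp ⟨⟨h₁, h₀⟩, mem_extChartAt_source x⟩
  rw [← h, LinearMap.det_comp, mul_comm (LinearMap.det _)]

variable [MeasurableSpace M]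

theorem chartVolume_eq (g : Metric I M) (x₀ : M) : chartVolume g x₀ =
    Measure.map (extChartAt I x₀).symm ((volume.restrict (extChartAt I x₀).target).withDensity
      fun y => ENNReal.ofReal (chartDensity g x₀ y)) := rfl

variable [BorelSpace M]

theorem aemeasurable_symm (g : Metric I M) (x₀ : M) : AEMeasurable (extChartAt I x₀).symm
    ((volume.restrict (extChartAt I x₀).target).withDensity
      fun y => ENNReal.ofReal (chartDensity g x₀ y)) :=
  ((continuousOn_extChartAt_symm x₀).aemeasurable (measurableSet_target I x₀)).mono_ac
    (withDensity_absolutelyContinuous _ _)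

theorem measurableSet_target_inter {x₀ : M} {A : Set M} (hA : MeasurableSet A) :
    MeasurableSet ((extChartAt I x₀).target ∩ (extChartAt I x₀).symm ⁻¹' A) := by
  classical
  have h := (continuousOn_extChartAt_symm (I := I) x₀).measurable_piecewise
    (continuousOn_const (c := x₀)) (measurableSet_target I x₀)
  have : (extChartAt I x₀).target ∩ (extChartAt I x₀).symm ⁻¹' A = (extChartAt I x₀).target ∩
      ((extChartAt I x₀).target.piecewise (extChartAt I x₀).symm fun _ => x₀) ⁻¹' A := by
    ext y
    simp only [mem_inter_iff, mem_preimage, and_congr_right_iff]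
    intro hy
    rw [piecewise_eq_of_mem _ _ _ hy]
  rw [this]
  exact (measurableSet_target I x₀).inter (h hA)

theorem chartVolume_apply (g : Metric I M) (x₀ : M) {A : Set M} (hA : MeasurableSet A) :
    chartVolume g x₀ A = ∫⁻ y in (extChartAt I x₀).target ∩ (extChartAt I x₀).symm ⁻¹' A,
      ENNReal.ofReal (chartDensity g x₀ y) := by
  rw [chartVolume_eq, Measure.map_apply_of_aemeasurable (aemeasurable_symm g x₀) hA,
    withDensity_apply', Measure.restrict_restrict' (measurableSet_target I x₀), inter_comm]

/-- The change of variables formula for the transition map, whose Jacobian is the ratio of the two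
densities. Only derivatives within the image of `A` are needed, so boundary points cause no
difficulty. -/
theorem chartVolume_congr (g : Metric I M) {x₀ x₁ : M} {A : Set M} (hA : MeasurableSet A)
    (h₀ : A ⊆ (extChartAt I x₀).source) (h₁ : A ⊆ (extChartAt I x₁).source) :
    chartVolume g x₀ A = chartVolume g x₁ A := by
  have himg : ∀ z : M, A ⊆ (extChartAt I z).source →
      (extChartAt I z).target ∩ (extChartAt I z).symm ⁻¹' A = extChartAt I z '' A := by
    intro z hz
    rw [(extChartAt I z).image_eq_target_inter_inv_preimage hz]
  rw [chartVolume_apply g x₀ hA, chartVolume_apply g x₁ hA]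
  have hm := measurableSet_target_inter (I := I) (x₀ := x₁) hA
  rw [himg x₀ h₀]
  rw [himg x₁ h₁] at hm ⊢
  have e : extChartAt I x₀ '' A =
      (extChartAt I x₀ ∘ (extChartAt I x₁).symm) '' (extChartAt I x₁ '' A) := by
    rw [image_image]
    exact image_congr fun x hx => by rw [Function.comp_apply, (extChartAt I x₁).left_inv (h₁ hx)]
  rw [e, lintegral_image_eq_lintegral_abs_det_fderiv_mul volume hm
    (f' := fun y => tangentCoordChange I x₁ x₀ ((extChartAt I x₁).symm y))]
  · refine setLIntegral_congr_fun hm ?_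
    rintro _ ⟨x, hx, rfl⟩
    simp only [Function.comp_apply, (extChartAt I x₁).left_inv (h₁ hx)]
    rw [chartDensity_change g (h₀ hx) (h₁ hx), ENNReal.ofReal_mul (abs_nonneg _)]
  · rintro _ ⟨x, hx, rfl⟩
    rw [(extChartAt I x₁).left_inv (h₁ hx)]
    refine (hasFDerivWithinAt_tangentCoordChange ⟨h₁ hx, h₀ hx⟩).mono ?_
    rintro _ ⟨z, hz, rfl⟩
    exact extChartAt_target_subset_range x₁ ((extChartAt I x₁).map_source (h₁ hz))
  · rintro _ ⟨x, hx, rfl⟩ _ ⟨z, hz, rfl⟩ h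
    simp only [Function.comp_apply, (extChartAt I x₁).left_inv (h₁ hx),
      (extChartAt I x₁).left_inv (h₁ hz)] at h
    rw [(extChartAt I x₀).injOn (h₀ hx) (h₀ hz) h]

theorem measurableSet_source (I : ModelWithCorners ℝ (Euc n) H) {M : Type*} [TopologicalSpace M]
    [ChartedSpace H M] [MeasurableSpace M] [BorelSpace M] (x₀ : M) :
    MeasurableSet (extChartAt I x₀).source :=
  (isOpen_extChartAt_source x₀).measurableSet

theorem chartVolume_inter_source (g : Metric I M) (x₀ : M) {A : Set M} (hA : MeasurableSet A) :
    chartVolume g x₀ (A ∩ (extChartAt I x₀).source) = chartVolume g x₀ A := by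
  rw [chartVolume_apply g x₀ hA, chartVolume_apply g x₀ (hA.inter (measurableSet_source I x₀))]
  congr 2
  ext y
  simp only [mem_inter_iff, mem_preimage, and_congr_right_iff, and_iff_left_iff_imp]
  exact fun hy _ => (extChartAt I x₀).map_target hy

/-- An upper bound for all chart measures at once: inside the chart at `x₀` they do not exceed the
measure of that chart, and outside the infinite measure is a bound that costs nothing. It passes to
the supremum, where restricting to the chart removes the infinite part. -/
theorem chartVolume_le (g : Metric I M) (x₀ x₁ : M) : chartVolume g x₁ ≤
    chartVolume g x₀ + (⊤ : Measure M).restrict ((extChartAt I x₀).source)ᶜ := by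
  refine Measure.le_iff.2 fun A hA => ?_
  have hs := measurableSet_source I x₀
  rw [← measure_inter_add_sdiff A hs, Measure.add_apply]
  refine add_le_add ?_ ?_
  · rw [← chartVolume_inter_source g x₁ (hA.inter hs),
      ← chartVolume_congr g ((hA.inter hs).inter (measurableSet_source I x₁))
        (fun x hx => hx.1.2) (fun x hx => hx.2)]
    exact measure_mono fun x hx => hx.1.1
  · rw [Measure.restrict_apply hA, sdiff_eq]
    exact (le_top : chartVolume g x₁ ≤ ⊤) _

theorem volMeasure_restrict (g : Metric I M) (x₀ : M) :
    (volMeasure g).restrict (extChartAt I x₀).source = chartVolume g x₀ := by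
  have hs := measurableSet_source I x₀
  refine Measure.ext fun A hA => ?_
  rw [Measure.restrict_apply hA, ← chartVolume_inter_source g x₀ hA]
  refine le_antisymm ?_ (le_iSup (fun x => chartVolume g x) x₀ _)
  have h : volMeasure g ≤
      chartVolume g x₀ + (⊤ : Measure M).restrict ((extChartAt I x₀).source)ᶜ :=
    iSup_le fun x₁ => chartVolume_le g x₀ x₁
  refine (h _).trans ?_
  rw [Measure.add_apply, Measure.restrict_apply (hA.inter hs), inter_assoc, inter_compl_self,
    inter_empty, measure_empty, add_zero]

/-- On a small ball around the image of a point the density is bounded by its value at the centre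
plus one, and the ball has finite Lebesgue measure. This is what makes smooth forms integrable over
compact sets. -/
instance isLocallyFiniteMeasure_volMeasure (g : Metric I M) :
    IsLocallyFiniteMeasure (volMeasure g) := by
  refine ⟨fun x₀ => ?_⟩
  have h1 : ∀ᶠ y in 𝓝[range I] (extChartAt I x₀ x₀), y ∈ (extChartAt I x₀).target ∧
      chartDensity g x₀ y < chartDensity g x₀ (extChartAt I x₀ x₀) + 1 := by
    refine (eventually_mem_target (mem_extChartAt_source x₀)).and ?_
    have := (chartDensity_continuousOn g x₀) _ (mem_extChartAt_target x₀)
    rw [ContinuousWithinAt, nhdsWithin_extChartAt_target_eq] at this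
    exact this.eventually_lt_const (by linarith)
  obtain ⟨r, hr, hsub⟩ := Metric.mem_nhdsWithin_iff.1 h1
  have hN : (extChartAt I x₀).source ∩ extChartAt I x₀ ⁻¹' Metric.ball (extChartAt I x₀ x₀) r
      ∈ 𝓝 x₀ := Filter.inter_mem (extChartAt_source_mem_nhds x₀)
    ((continuousAt_extChartAt x₀).preimage_mem_nhds (Metric.ball_mem_nhds _ hr))
  refine ⟨_, hN, ?_⟩
  have ho : IsOpen ((extChartAt I x₀).source ∩
      extChartAt I x₀ ⁻¹' Metric.ball (extChartAt I x₀ x₀) r) :=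
    (continuousOn_extChartAt x₀).isOpen_inter_preimage (isOpen_extChartAt_source x₀)
      Metric.isOpen_ball
  rw [← Measure.restrict_eq_self (volMeasure g) inter_subset_left, volMeasure_restrict,
    chartVolume_apply g x₀ ho.measurableSet]
  calc _ ≤ ∫⁻ y in (extChartAt I x₀).target ∩ (extChartAt I x₀).symm ⁻¹'
          ((extChartAt I x₀).source ∩ extChartAt I x₀ ⁻¹' Metric.ball (extChartAt I x₀ x₀) r),
          ENNReal.ofReal (chartDensity g x₀ (extChartAt I x₀ x₀) + 1) := by
        refine setLIntegral_mono' (measurableSet_target_inter ho.measurableSet) fun y hy => ?_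
        have hy2 := hy.2.2
        rw [mem_preimage, (extChartAt I x₀).right_inv hy.1] at hy2
        exact ENNReal.ofReal_le_ofReal
          (hsub ⟨hy2, extChartAt_target_subset_range x₀ hy.1⟩).2.le
    _ ≤ ENNReal.ofReal (chartDensity g x₀ (extChartAt I x₀ x₀) + 1) *
          volume (Metric.ball (extChartAt I x₀ x₀) r) := by
        rw [setLIntegral_const]
        refine mul_le_mul_right (measure_mono ?_) _
        intro y hy
        have hy2 := hy.2.2
        rwa [mem_preimage, (extChartAt I x₀).right_inv hy.1] at hy2
    _ < ⊤ := ENNReal.mul_lt_top ENNReal.ofReal_lt_top Metric.isBounded_ball.measure_lt_top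

end Volume

/-! ### Densities of top forms, and their integrals in a chart. -/

section Density

variable {n : ℕ} {H : Type*} [TopologicalSpace H] {I : ModelWithCorners ℝ (Euc n) H}
  {M : Type*} [TopologicalSpace M] [ChartedSpace H M] [IsManifold I ∞ M]
  {V : Type*} [NormedAddCommGroup V] [NormedSpace ℝ V] (g : Metric I M) (o : Orient I M)

/-- The quotient of a form of top degree by the volume form. -/
def density (θ : M → (Euc n) [⋀^Fin n]→L[ℝ] V) (x : M) : V :=
  (volForm g o x frame)⁻¹ • θ x frame

theorem formIntegral_eq [MeasurableSpace M] (K : Set M) (θ : DForm n M V) :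
    formIntegral g o K θ = ∫ x in K, density g o (θ n) x ∂(volMeasure g) := rfl

theorem apply_comp_frame (a : (Euc n) [⋀^Fin n]→L[ℝ] V) (P : Euc n →L[ℝ] Euc n) :
    a (fun i => P (frame i)) = LinearMap.det (P : Euc n →ₗ[ℝ] Euc n) • a frame := by
  have h : a = (detForm n).smulRight (a frame) := ext_top <| by
    rw [ContinuousAlternatingMap.smulRight_apply, detForm_frame, one_smul]
  conv_lhs => rw [h]
  rw [ContinuousAlternatingMap.smulRight_apply]
  have h1 := detForm_comp P frame
  rw [detForm_frame, mul_one] at h1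
  exact congrArg (· • a frame) h1

theorem density_chart (θ : M → (Euc n) [⋀^Fin n]→L[ℝ] V) {x₀ x : M} (hx : Good o x₀ x) :
    density g o θ x = (o.sign x₀ * chartDensity g x₀ (extChartAt I x₀ x))⁻¹ •
      inChart I θ x₀ (extChartAt I x₀ x) frame := by
  have h1 : volForm g o x frame = o.sign x * √|(gram g x).det| := by
    rw [volForm, ContinuousAlternatingMap.smul_apply, detForm_frame, smul_eq_mul, mul_one]
  have h2 := apply_comp_frame (θ x) (tangentCoordChange I x₀ x x)
  have hD := det_tangentCoordChange_ne_zero hx.1 (mem_extChartAt_source (I := I) x)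
  rw [density, h1, inChart_apply θ hx.1, chartDensity_apply g hx.1,
    ContinuousAlternatingMap.compContinuousLinearMap_apply]
  refine Eq.trans ?_ (congrArg _ h2).symm
  rw [← mul_assoc, hx.sign_mul, smul_smul]
  congr 1
  rw [mul_inv, mul_inv, mul_inv]
  field_simp

theorem density_continuous {θ : M → (Euc n) [⋀^Fin n]→L[ℝ] V} (hθ : ∀ x, SmoothAt I θ x) :
    Continuous (density g o θ) := by
  refine continuous_iff_continuousAt.2 fun x₀ => ?_
  have hT : Filter.Tendsto (extChartAt I x₀) (𝓝 x₀) (𝓝[range I] (extChartAt I x₀ x₀)) := by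
    refine tendsto_nhdsWithin_iff.2 ⟨continuousAt_extChartAt x₀, Filter.Eventually.of_forall ?_⟩
    exact fun x => mem_range_self _
  have h1 : ContinuousWithinAt (chartDensity g x₀) (range I) (extChartAt I x₀ x₀) := by
    have := chartDensity_continuousOn g x₀ _ (mem_extChartAt_target x₀)
    rwa [ContinuousWithinAt, nhdsWithin_extChartAt_target_eq] at this
  have h2 : ContinuousWithinAt (fun y => inChart I θ x₀ y frame) (range I)
      (extChartAt I x₀ x₀) :=
    (contDiffWithinAt_alternating_apply (hθ x₀) _).continuousWithinAt
  have h3 : ContinuousWithinAt (fun y => (o.sign x₀ * chartDensity g x₀ y)⁻¹ •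
      inChart I θ x₀ y frame) (range I) (extChartAt I x₀ x₀) :=
    ((continuousWithinAt_const.mul h1).inv₀ (mul_ne_zero (sign_ne_zero o x₀)
      (chartDensity_pos g (mem_extChartAt_target x₀)).ne')).smul h2
  have h4 := h3.tendsto.comp hT
  have e : density g o θ =ᶠ[𝓝 x₀] (fun y => (o.sign x₀ * chartDensity g x₀ y)⁻¹ •
      inChart I θ x₀ y frame) ∘ extChartAt I x₀ := by
    filter_upwards [eventually_good o x₀] with x hx
    exact density_chart g o θ hx
  rw [ContinuousAt, e.self_of_nhds]
  exact h4.congr' e.symm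

theorem density_zero {θ : M → (Euc n) [⋀^Fin n]→L[ℝ] V} {x : M} (h : θ x = 0) :
    density g o θ x = 0 := by
  rw [density, h]
  exact smul_zero _

variable [MeasurableSpace M] [BorelSpace M]

/-- The factor √|det g| in the measure cancels the one in the quotient by the volume form, leaving
the Lebesgue integral of the coefficient. The orientation sign is constant because the form vanishes
off the points oriented coherently with `x₀`. -/
theorem integral_density_chart [SecondCountableTopology M]
    {θ : M → (Euc n) [⋀^Fin n]→L[ℝ] V} (hθ : Continuous (density g o θ)) {x₀ : M}
    (h0 : ∀ x, ¬ Good o x₀ x → θ x = 0) :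
    ∫ x, density g o θ x ∂(volMeasure g) =
      o.sign x₀ • ∫ y in (extChartAt I x₀).target, inChart I θ x₀ y frame := by
  have hT := measurableSet_target I x₀
  rw [← setIntegral_eq_integral_of_forall_compl_eq_zero (s := (extChartAt I x₀).source)
    (fun x hx => density_zero g o (h0 x fun hg => hx hg.1)), volMeasure_restrict, chartVolume_eq,
    integral_map (aemeasurable_symm g x₀) hθ.aestronglyMeasurable,
    integral_withDensity_eq_integral_toReal_smul₀
      (((chartDensity_continuousOn g x₀).aemeasurable hT).ennreal_ofReal)
      (Filter.Eventually.of_forall fun _ => ENNReal.ofReal_lt_top), ← integral_smul]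
  refine setIntegral_congr_fun hT fun y hy => ?_
  have hρ := chartDensity_pos g hy
  beta_reduce
  rw [ENNReal.toReal_ofReal hρ.le]
  by_cases hg : Good o x₀ ((extChartAt I x₀).symm y)
  · rw [density_chart g o θ hg, (extChartAt I x₀).right_inv hy, smul_smul]
    congr 1
    rcases o.sign_eq x₀ with h | h <;> rw [h] <;> field_simp
  · rw [density_zero g o (h0 _ hg), inChart, h0 _ hg]
    simp

end Density

/-! ### Locality of the exterior derivative, and extension of chart expressions by zero. -/

section Locality

variable {n : ℕ} {H : Type*} [TopologicalSpace H] {I : ModelWithCorners ℝ (Euc n) H}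
  {M : Type*} [TopologicalSpace M] [ChartedSpace H M] [IsManifold I ∞ M]
  {V : Type*} [NormedAddCommGroup V] [NormedSpace ℝ V]

theorem extD_congr {p : ℕ} {θ η : M → (Euc n) [⋀^Fin p]→L[ℝ] V} {x : M} (h : θ =ᶠ[𝓝 x] η) :
    extD I θ x = extD I η x := by
  have h1 := (tendsto_symm (mem_extChartAt_source (I := I) x)).eventually h
  have e : inChart I θ x =ᶠ[𝓝[range I] (extChartAt I x x)] inChart I η x := by
    filter_upwards [h1] with y hy
    simp only [inChart, hy]
  exact e.extDerivWithin_eq (e.self_of_nhdsWithin (mem_range_self _))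

theorem extD_eq_zero {p : ℕ} {θ : M → (Euc n) [⋀^Fin p]→L[ℝ] V} {K : Set M} (hK : IsClosed K)
    (h : ∀ x ∉ K, θ x = 0) {x : M} (hx : x ∉ K) : extD I θ x = 0 := by
  have : θ =ᶠ[𝓝 x] 0 := by
    filter_upwards [hK.isOpen_compl.mem_nhds hx] with y hy using h y hy
  rw [extD_congr this, extD_zero]
  rfl

theorem target_mem_nhds {x₀ x : M} (hx : x ∈ (extChartAt I x₀).source)
    (hi : x ∈ I.interior M) : (extChartAt I x₀).target ∈ 𝓝 (extChartAt I x₀ x) := by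
  rw [extChartAt_source] at hx
  exact mem_interior_iff_mem_nhds.1 ((ModelWithCorners.isInteriorPoint_iff_of_mem_atlas
    (n := ∞) (by simp) (chart_mem_atlas H x₀) hx).1 hi)

/-- The expression of a form in a chart, extended by zero. -/
def chartExtend (I : ModelWithCorners ℝ (Euc n) H) {M : Type*} [TopologicalSpace M]
    [ChartedSpace H M] [IsManifold I ∞ M] {p : ℕ} (θ : M → (Euc n) [⋀^Fin p]→L[ℝ] V) (x₀ : M) :
    Euc n → (Euc n) [⋀^Fin p]→L[ℝ] V :=
  (extChartAt I x₀).target.indicator (inChart I θ x₀)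

variable [FiniteDimensional ℝ V] {p : ℕ} {θ : M → (Euc n) [⋀^Fin p]→L[ℝ] V} {K : Set M} {x₀ : M}

theorem isCompact_image_chart (hK : IsCompact K) (hKs : K ⊆ (extChartAt I x₀).source) :
    IsCompact (extChartAt I x₀ '' K) :=
  hK.image_of_continuousOn ((continuousOn_extChartAt x₀).mono hKs)

theorem inChart_eq_zero (h : ∀ x ∉ K, θ x = 0) {y : Euc n}
    (hyT : y ∈ (extChartAt I x₀).target) (hy : y ∉ extChartAt I x₀ '' K) :
    inChart I θ x₀ y = 0 := by
  rw [inChart, h _ fun hk => hy ⟨_, hk, (extChartAt I x₀).right_inv hyT⟩]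
  ext; simp

theorem chartExtend_eq_zero (h : ∀ x ∉ K, θ x = 0) {y : Euc n} (hy : y ∉ extChartAt I x₀ '' K) :
    chartExtend I θ x₀ y = 0 := by
  by_cases hyT : y ∈ (extChartAt I x₀).target
  · rw [chartExtend, indicator_of_mem hyT, inChart_eq_zero h hyT hy]
  · rw [chartExtend, indicator_of_notMem hyT]

theorem chartExtend_eventuallyEq {x : M} (hx : x ∈ (extChartAt I x₀).source)
    (hi : x ∈ I.interior M) :
    chartExtend I θ x₀ =ᶠ[𝓝 (extChartAt I x₀ x)] inChart I θ x₀ := by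
  filter_upwards [target_mem_nhds hx hi] with y hy
  rw [chartExtend, indicator_of_mem hy]

theorem hasCompactSupport_chartExtend (hK : IsCompact K) (hKs : K ⊆ (extChartAt I x₀).source)
    (h : ∀ x ∉ K, θ x = 0) : HasCompactSupport (chartExtend I θ x₀) :=
  HasCompactSupport.intro (isCompact_image_chart hK hKs) fun _ hy => chartExtend_eq_zero h hy

/-- Over `K` the chart target is a neighbourhood, because `K` avoids the boundary. Off the compact
image of `K` the extension is locally zero. This is where support in the interior, and not just
compact support, is needed. -/
theorem contDiff_chartExtend (hθ : ∀ x, SmoothAt I θ x) (hK : IsCompact K)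
    (hKs : K ⊆ (extChartAt I x₀).source) (hKi : K ⊆ I.interior M) (h : ∀ x ∉ K, θ x = 0) :
    ContDiff ℝ ∞ (chartExtend I θ x₀) := by
  refine contDiff_iff_contDiffAt.2 fun y => ?_
  by_cases hy : y ∈ extChartAt I x₀ '' K
  · obtain ⟨x, hx, rfl⟩ := hy
    have hT := target_mem_nhds (hKs hx) (hKi hx)
    refine ContDiffAt.congr_of_eventuallyEq ?_ (chartExtend_eventuallyEq (hKs hx) (hKi hx))
    exact ((hθ x).contDiffWithinAt (hKs hx)).contDiffAt
      (Filter.mem_of_superset hT (extChartAt_target_subset_range x₀))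
  · have e : chartExtend I θ x₀ =ᶠ[𝓝 y] fun _ => 0 := by
      filter_upwards [(isCompact_image_chart hK hKs).isClosed.isOpen_compl.mem_nhds hy] with z hz
        using chartExtend_eq_zero h hz
    exact contDiffAt_const.congr_of_eventuallyEq e

theorem extDeriv_chartExtend (hθ : ∀ x, SmoothAt I θ x) (hK : IsCompact K) [T2Space M]
    (hKs : K ⊆ (extChartAt I x₀).source) (hKi : K ⊆ I.interior M) (h : ∀ x ∉ K, θ x = 0) :
    extDeriv (chartExtend I θ x₀) =
      (extChartAt I x₀).target.indicator (inChart I (extD I θ) x₀) := by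
  funext y
  by_cases hy : y ∈ extChartAt I x₀ '' K
  · obtain ⟨x, hx, rfl⟩ := hy
    have hT := target_mem_nhds (hKs hx) (hKi hx)
    rw [indicator_of_mem (mem_of_mem_nhds hT), inChart_extD (hθ x) (hKs hx),
      (chartExtend_eventuallyEq (hKs hx) (hKi hx)).extDeriv_eq, extDerivWithin,
      fderivWithin_of_mem_nhds (Filter.mem_of_superset hT (extChartAt_target_subset_range x₀)),
      extDeriv]
  · have e : chartExtend I θ x₀ =ᶠ[𝓝 y] fun _ => 0 := by
      filter_upwards [(isCompact_image_chart hK hKs).isClosed.isOpen_compl.mem_nhds hy] with z hz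
        using chartExtend_eq_zero h hz
    have h1 : extDeriv (chartExtend I θ x₀) y = 0 := by
      rw [e.extDeriv_eq, extDeriv, fderiv_fun_const]
      ext v
      simp [ContinuousAlternatingMap.alternatizeUncurryFin_apply]
    have h2 := chartExtend_eq_zero (I := I) (θ := extD I θ)
      (fun x hx => extD_eq_zero hK.isClosed h hx) hy
    rw [h1]
    exact h2.symm

end Locality

/-! ### Stokes' theorem for compact support in the interior. -/

section Stokes

/-- Integration by parts against the constant function 1. -/
theorem integral_fderiv_eq_zero {n : ℕ} {V : Type*} [NormedAddCommGroup V] [NormedSpace ℝ V]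
    [FiniteDimensional ℝ V] {f : Euc n → V} (hf : ContDiff ℝ ∞ f) (hc : HasCompactSupport f)
    (w : Euc n) : Integrable (fun y => fderiv ℝ f y w) ∧ ∫ y, fderiv ℝ f y w = 0 := by
  have h1 : Integrable (fun y => fderiv ℝ f y w) :=
    ((hf.continuous_fderiv (by simp)).clm_apply continuous_const).integrable_of_hasCompactSupport
      (hc.fderiv_apply (𝕜 := ℝ) w)
  have h2 : Integrable f := hf.continuous.integrable_of_hasCompactSupport hc
  refine ⟨h1, ?_⟩
  have := integral_bilinear_fderiv_right_eq_neg_left_of_integrable (μ := volume) (f := f)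
    (g := fun _ => (1 : ℝ)) (v := w) (B := (ContinuousLinearMap.lsmul ℝ ℝ).flip)
    (by simpa using h1) (by simp) (by simpa using h2)
    (fun x _ => hf.differentiable (by simp) x) (fun x _ => differentiableAt_const _)
  simpa using this

theorem integral_extDeriv_eq_zero {m : ℕ} {V : Type*} [NormedAddCommGroup V] [NormedSpace ℝ V]
    [FiniteDimensional ℝ V] {η : Euc (m + 1) → (Euc (m + 1)) [⋀^Fin m]→L[ℝ] V}
    (hη : ContDiff ℝ ∞ η) (hc : HasCompactSupport η) : ∫ y, extDeriv η y frame = 0 := by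
  simp_rw [fun y => extDeriv_apply (hη.differentiable (by simp) y) frame,
    ← Int.cast_smul_eq_zsmul ℝ]
  have h : ∀ i : Fin (m + 1), _ := fun i => integral_fderiv_eq_zero
    (f := fun y => η y (i.removeNth frame))
    ((ContinuousAlternatingMap.apply ℝ (Euc (m + 1)) V (i.removeNth frame)).contDiff.comp hη)
    (hc.comp_left (g := fun a : (Euc (m + 1)) [⋀^Fin m]→L[ℝ] V => a (i.removeNth frame)) rfl) (frame i)
  rw [integral_finsetSum _ fun i _ => Integrable.fun_smul _ (h i).1]
  refine Finset.sum_eq_zero fun i _ => ?_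
  rw [integral_smul, (h i).2, smul_zero]

variable {m : ℕ} {H : Type*} [TopologicalSpace H] {I : ModelWithCorners ℝ (Euc (m + 1)) H}
  {M : Type*} [TopologicalSpace M] [ChartedSpace H M] [IsManifold I ∞ M]
  [T2Space M] [SecondCountableTopology M] [MeasurableSpace M] [BorelSpace M]
  {V : Type*} [NormedAddCommGroup V] [NormedSpace ℝ V] [FiniteDimensional ℝ V]
  (g : Metric I M) (o : Orient I M) {K : Set M} {θ : M → (Euc (m + 1)) [⋀^Fin m]→L[ℝ] V}

theorem integral_extD_chart (hθ : ∀ x, SmoothAt I θ x) (hK : IsCompact K) {x₀ : M}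
    (hKg : ∀ x ∈ K, Good o x₀ x) (hKi : K ⊆ I.interior M) (h : ∀ x ∉ K, θ x = 0) :
    ∫ x, density g o (extD I θ) x ∂(volMeasure g) = 0 := by
  have hKs : K ⊆ (extChartAt I x₀).source := fun x hx => (hKg x hx).1
  rw [integral_density_chart g o (density_continuous g o (smoothAt_extD hθ)) (x₀ := x₀)
    fun x hx => extD_eq_zero hK.isClosed h fun hk => hx (hKg x hk),
    ← integral_indicator (measurableSet_target I x₀)]
  have h1 : (extChartAt I x₀).target.indicator (fun y => inChart I (extD I θ) x₀ y frame) =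
      fun y => extDeriv (chartExtend I θ x₀) y frame := by
    rw [extDeriv_chartExtend hθ hK hKs hKi h]
    funext y
    by_cases hy : y ∈ (extChartAt I x₀).target
    · simp only [indicator_of_mem hy]
    · simp only [indicator_of_notMem hy]
      rfl
  rw [h1, integral_extDeriv_eq_zero (contDiff_chartExtend hθ hK hKs hKi h)
    (hasCompactSupport_chartExtend hK hKs h), smul_zero]

theorem integrable_density {n : ℕ} {I : ModelWithCorners ℝ (Euc n) H} [IsManifold I ∞ M]
    (g : Metric I M) (o : Orient I M) {θ : M → (Euc n) [⋀^Fin n]→L[ℝ] V}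
    (hθ : ∀ x, SmoothAt I θ x) (hK : IsCompact K) (h : ∀ x ∉ K, θ x = 0) :
    Integrable (density g o θ) (volMeasure g) :=
  (density_continuous g o hθ).integrable_of_hasCompactSupport
    (HasCompactSupport.intro hK fun x hx => density_zero g o (h x hx))

theorem extD_finset_sum {n : ℕ} {I : ModelWithCorners ℝ (Euc n) H} [IsManifold I ∞ M]
    {p : ℕ} {ι : Type*} (s : Finset ι) {θ : ι → M → (Euc n) [⋀^Fin p]→L[ℝ] V} {x : M}
    (hθ : ∀ i ∈ s, SmoothAt I (θ i) x) :
    extD I (fun x => ∑ i ∈ s, θ i x) x = ∑ i ∈ s, extD I (θ i) x := by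
  classical
  induction s using Finset.induction_on with
  | empty => exact congrFun (extD_zero (I := I) (M := M) (V := V) p) x
  | insert i s hi ih =>
    simp only [Finset.sum_insert hi]
    rw [← ih fun j hj => hθ j (Finset.mem_insert_of_mem hj)]
    exact extDerivWithin_add (I.uniqueDiffOn _ (mem_range_self _))
      (ContDiffWithinAt.differentiableWithinAt (hθ i (Finset.mem_insert_self i s)) (by simp))
      (ContDiffWithinAt.differentiableWithinAt
        (smoothAt_sum s fun j hj => hθ j (Finset.mem_insert_of_mem hj)) (by simp))

/-- A partition of unity on `K` subordinate to the coherently oriented parts of charts writes θ as a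
finite sum of forms f i • θ. Each is supported in one chart, where Stokes is already known;
additivity of the exterior derivative suffices. -/
theorem integral_extD (hθ : ∀ x, SmoothAt I θ x) (hK : IsCompact K) (hKi : K ⊆ I.interior M)
    (h : ∀ x ∉ K, θ x = 0) : ∫ x, density g o (extD I θ) x ∂(volMeasure g) = 0 := by
  have : LocallyCompactSpace H := I.locallyCompactSpace
  have : LocallyCompactSpace M := ChartedSpace.locallyCompactSpace H M
  obtain ⟨f, hf⟩ := SmoothPartitionOfUnity.exists_isSubordinate I hK.isClosed
    (fun x₀ => interior {x | Good o x₀ x}) (fun _ => isOpen_interior)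
    (fun x _ => mem_iUnion.2 ⟨x, mem_interior_iff_mem_nhds.2 (eventually_good o x)⟩)
  have hfin : {i | (Function.support (f i) ∩ K).Nonempty}.Finite :=
    f.locallyFinite.finite_nonempty_inter_compact hK
  have hsm : ∀ i x, SmoothAt I (fun x => f i x • θ x) x := fun i x =>
    (hθ x).smulFun (contMDiffAt_iff.1 ((f i).contMDiff x)).2
  have hsum : θ = fun x => ∑ i ∈ hfin.toFinset, f i x • θ x := by
    funext x
    by_cases hx : x ∈ K
    · rw [← Finset.sum_smul, ← finsum_eq_sum_of_support_subset, f.sum_eq_one hx, one_smul]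
      intro i hi
      simpa using ⟨x, hi, hx⟩
    · simp [h x hx]
  have hd : ∀ x, extD I θ x = ∑ i ∈ hfin.toFinset, extD I (fun x => f i x • θ x) x := by
    intro x
    conv_lhs => rw [hsum]
    exact extD_finset_sum _ fun i _ => hsm i x
  have hd' : density g o (extD I θ) = fun x => ∑ i ∈ hfin.toFinset,
      density g o (extD I (fun x => f i x • θ x)) x := by
    funext x
    simp only [density, hd x, ContinuousAlternatingMap.sum_apply, Finset.smul_sum]
  have h0 : ∀ i, ∀ x ∉ K ∩ tsupport (f i), f i x • θ x = 0 := by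
    intro i x hx
    by_cases hxK : x ∈ K
    · rw [image_eq_zero_of_notMem_tsupport fun ht => hx ⟨hxK, ht⟩, zero_smul]
    · rw [h x hxK, smul_zero]
  have hKc : ∀ i, IsCompact (K ∩ tsupport (f i)) := fun i =>
    hK.inter_right (isClosed_tsupport _)
  rw [hd', integral_finsetSum _ fun i _ => integrable_density g o (smoothAt_extD (hsm i))
    (hKc i) fun x hx => extD_eq_zero (hKc i).isClosed (h0 i) hx]
  refine Finset.sum_eq_zero fun i _ => ?_
  exact integral_extD_chart g o (hsm i) (hKc i)
    (fun x hx => (interior_subset : interior {x | Good o i x} ⊆ _) (hf i hx.2)) (inter_subset_left.trans hKi) (h0 i)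

end Stokes

/-! ### Supports of forms. -/

section Support

variable {n : ℕ} {H : Type*} [TopologicalSpace H] {I : ModelWithCorners ℝ (Euc n) H}
  {M : Type*} [TopologicalSpace M] [ChartedSpace H M] [IsManifold I ∞ M]
  {V : Type*} [NormedAddCommGroup V] [NormedSpace ℝ V]

omit [ChartedSpace H M] in
theorem eq_zero_of_notMem_supp {θ : DForm n M V} {x : M} (hx : x ∉ supp θ) (p : ℕ) :
    θ p x = 0 := by
  by_contra h
  exact hx (subset_closure ⟨p, h⟩)

theorem supp_subset_of_eq_zero {θ : DForm n M V} {K : Set M} (hK : IsClosed K)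
    (h : ∀ x ∉ K, ∀ p, θ p x = 0) : supp θ ⊆ K :=
  closure_minimal (fun x ⟨p, hp⟩ => by_contra fun hx => hp (h x hx p)) hK

theorem d_eq_zero_of_notMem_supp {θ : DForm n M V} {x : M} (hx : x ∉ supp θ) (p : ℕ) :
    d I θ p x = 0 := by
  cases p with
  | zero => rfl
  | succ p => exact extD_eq_zero isClosed_closure (fun y hy => eq_zero_of_notMem_supp hy p) hx

end Support

/-! ### Linearity of the integral of forms, and the global Stokes theorem. -/

section Integral

variable {n : ℕ} {H : Type*} [TopologicalSpace H] {I : ModelWithCorners ℝ (Euc n) H}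
  {M : Type*} [TopologicalSpace M] [ChartedSpace H M] [IsManifold I ∞ M]
  [T2Space M] [SecondCountableTopology M] [MeasurableSpace M] [BorelSpace M]
  {V : Type*} [NormedAddCommGroup V] [NormedSpace ℝ V]
  (g : Metric I M) (o : Orient I M) {K : Set M} {θ η : DForm n M V} {p q : ℤ}

theorem integrableOn_density (hK : IsCompact K) (hθ : IsForm I p θ) :
    IntegrableOn (density g o (θ n)) K (volMeasure g) :=
  (density_continuous g o (hθ.smoothAt n)).continuousOn.integrableOn_compact hK

theorem formIntegral_add (hK : IsCompact K) (hθ : IsForm I p θ) (hη : IsForm I q η) :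
    formIntegral g o K (θ + η) = formIntegral g o K θ + formIntegral g o K η := by
  rw [formIntegral_eq, formIntegral_eq, formIntegral_eq,
    ← integral_add (integrableOn_density g o hK hθ) (integrableOn_density g o hK hη)]
  exact integral_congr_ae (Filter.Eventually.of_forall fun x => smul_add _ _ _)

theorem formIntegral_smul {𝕜 : Type*} [RCLike 𝕜] [NormedSpace 𝕜 V] [IsScalarTower ℝ 𝕜 V] (c : 𝕜)
    (θ : DForm n M V) : formIntegral g o K (c • θ) = c • formIntegral g o K θ := by
  rw [formIntegral_eq, formIntegral_eq, ← integral_smul]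
  exact integral_congr_ae (Filter.Eventually.of_forall fun x => smul_comm _ _ _)

theorem formIntegral_zero : formIntegral g o K (0 : DForm n M V) = 0 := by
  simpa using formIntegral_smul g o (0 : ℝ) (0 : DForm n M V)

theorem formIntegral_neg (θ : DForm n M V) :
    formIntegral g o K (-θ) = -formIntegral g o K θ := by
  simpa using formIntegral_smul g o (-1 : ℝ) θ

/-- Stokes' theorem for forms with compact support in the interior. -/
theorem formIntegral_d [FiniteDimensional ℝ V] (hK : IsCompact K) (hθ : IsForm I (n - 1) θ)
    (hs : supp θ ⊆ K ∩ I.interior M) : formIntegral g o K (d I θ) = 0 := by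
  cases n with
  | zero =>
    -- In dimension zero the form has degree -1, hence is zero.
    rw [hθ.isHom.eq_zero_of_neg (by simp), d_zero, formIntegral_zero]
  | succ m =>
    have hc : IsCompact (supp θ) := hK.of_isClosed_subset isClosed_closure
      (hs.trans inter_subset_left)
    rw [formIntegral_eq, setIntegral_eq_integral_of_forall_compl_eq_zero fun x hx =>
      density_zero g o (d_eq_zero_of_notMem_supp (fun h => hx (hs h).1) _)]
    exact integral_extD g o (hθ.smoothAt m) hc (hs.trans inter_subset_right)
      fun x hx => eq_zero_of_notMem_supp hx m

end Integral

/-! ### Test forms supported in one chart. -/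

section TestForms

variable {n : ℕ} {H : Type*} [TopologicalSpace H] {I : ModelWithCorners ℝ (Euc n) H}
  {M : Type*} [TopologicalSpace M] [ChartedSpace H M] [IsManifold I ∞ M]
  {V : Type*} [NormedAddCommGroup V] [NormedSpace ℝ V]

variable (I) in
/-- The form with expression `f • c` in the chart at `x₀`, extended by zero. -/
def chartForm (x₀ : M) (f : Euc n → ℝ) {p : ℕ} (c : (Euc n) [⋀^Fin p]→L[ℝ] V) :
    M → (Euc n) [⋀^Fin p]→L[ℝ] V :=
  (extChartAt I x₀).source.indicator fun x =>
    f (extChartAt I x₀ x) • c.compContinuousLinearMap (tangentCoordChange I x x₀ x)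

variable {x₀ : M} {f : Euc n → ℝ} {p : ℕ} (c : (Euc n) [⋀^Fin p]→L[ℝ] V)

theorem inChart_chartForm {y : Euc n} (hy : y ∈ (extChartAt I x₀).target) :
    inChart I (chartForm I x₀ f c) x₀ y = f y • c := by
  have hx := (extChartAt I x₀).map_target hy
  rw [inChart, chartForm, indicator_of_mem hx, (extChartAt I x₀).right_inv hy]
  ext v
  simp only [ContinuousAlternatingMap.compContinuousLinearMap_apply,
    ContinuousAlternatingMap.smul_apply]
  congr 2
  ext1 k
  exact (tangentCoordChange_comp ⟨⟨hx, mem_extChartAt_source _⟩, hx⟩).trans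
    (tangentCoordChange_self hx)

theorem chartForm_eq_zero {x : M} (hx : x ∉ (extChartAt I x₀).symm '' tsupport f)  :
    chartForm I x₀ f c x = 0 := by
  by_cases hs : x ∈ (extChartAt I x₀).source
  · rw [chartForm, indicator_of_mem hs, image_eq_zero_of_notMem_tsupport fun ht =>
      hx ⟨_, ht, (extChartAt I x₀).left_inv hs⟩, zero_smul]
  · rw [chartForm, indicator_of_notMem hs]

theorem isCompact_image_tsupport (hc : HasCompactSupport f)
    (hs : tsupport f ⊆ (extChartAt I x₀).target) :
    IsCompact ((extChartAt I x₀).symm '' tsupport f) :=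
  hc.isCompact.image_of_continuousOn ((continuousOn_extChartAt_symm x₀).mono hs)

theorem smoothAt_chartForm [T2Space M] [FiniteDimensional ℝ V] (hf : ContDiff ℝ ∞ f)
    (hc : HasCompactSupport f) (hs : tsupport f ⊆ (extChartAt I x₀).target) (x : M) :
    SmoothAt I (chartForm I x₀ f c) x := by
  by_cases hx : x ∈ (extChartAt I x₀).source
  · refine SmoothAt.of_chart hx ?_
    have h1 : ContDiffWithinAt ℝ ∞ (fun y => f y • c) (range I) (extChartAt I x₀ x) :=
      (hf.smul contDiff_const).contDiffWithinAt
    refine h1.congr_of_eventuallyEq ?_ (inChart_chartForm c ((extChartAt I x₀).map_source hx))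
    filter_upwards [eventually_mem_target hx] with y hy using inChart_chartForm c hy
  · refine (smoothAt_zero x).congr ?_
    have hK := (isCompact_image_tsupport hc hs).isClosed
    have hxK : x ∉ (extChartAt I x₀).symm '' tsupport f := by
      rintro ⟨y, hy, rfl⟩
      exact hx ((extChartAt I x₀).map_target (hs hy))
    filter_upwards [hK.isOpen_compl.mem_nhds hxK] with y hy using chartForm_eq_zero c hy

end TestForms

/-! ### The fundamental lemma of the calculus of variations. -/

section Fundamental

variable {𝕜 : Type*} [RCLike 𝕜] {n : ℕ} {H : Type*} [TopologicalSpace H]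
  {I : ModelWithCorners ℝ (Euc n) H}
  {M : Type*} [TopologicalSpace M] [ChartedSpace H M] [IsManifold I ∞ M]
  [T2Space M] [SecondCountableTopology M] [MeasurableSpace M] [BorelSpace M] {V W U : Type*}
  [NormedAddCommGroup V] [NormedSpace ℝ V] [NormedSpace 𝕜 V] [IsScalarTower ℝ 𝕜 V]
  [FiniteDimensional 𝕜 V]
  [NormedAddCommGroup W] [NormedSpace ℝ W] [NormedSpace 𝕜 W] [IsScalarTower ℝ 𝕜 W]
  [FiniteDimensional 𝕜 W]
  [NormedAddCommGroup U] [NormedSpace ℝ U] [NormedSpace 𝕜 U] [IsScalarTower ℝ 𝕜 U]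
  [FiniteDimensional 𝕜 U]
  (g : Metric I M) (o : Orient I M)

theorem wedge_eq_zero_left (B : V →ₗ[𝕜] W →ₗ[𝕜] U) {θ : DForm n M V} {x : M}
    (h : ∀ p, θ p x = 0) (η : DForm n M W) (r : ℕ) : wedge B θ η r x = 0 := by
  refine Finset.sum_eq_zero fun i _ => ?_
  rw [h, wedgeAlt_zero_left, castDeg_zero]

theorem supp_wedge_subset (B : V →ₗ[𝕜] W →ₗ[𝕜] U) (θ : DForm n M V) (η : DForm n M W) :
    supp (wedge B θ η) ⊆ supp θ :=
  supp_subset_of_eq_zero isClosed_closure fun _ hx r =>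
    wedge_eq_zero_left B (eq_zero_of_notMem_supp hx) η r

/-- The fundamental lemma of the calculus of variations. -/
theorem eq_zero_of_forall_variation (B : V →ₗ[𝕜] W →ₗ[𝕜] U) (hB : ∀ y, (∀ x, B x y = 0) → y = 0)
    {p : ℤ} {E : DForm n M W} (hE : IsForm I (n - p) E)
    (h : ∀ K : Set M, IsCompact K → ∀ δ : DForm n M V, IsVariation I K p δ →
      formIntegral g o K (wedge B δ E) = 0) : E = 0 := by
  -- Outside 0 ≤ p ≤ n there are no nonzero variations, but then `E` has degree above n or below 0
  -- and is zero anyway.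
  rcases lt_or_ge p 0 with hp | hp
  · exact hE.isHom.eq_zero_of_gt (by omega)
  rcases lt_or_ge (n : ℤ) p with hn | hn
  · exact hE.isHom.eq_zero_of_neg (by omega)
  lift p to ℕ using hp
  have hpn : p + (n - p) = n := by omega
  have : FiniteDimensional ℝ V := FiniteDimensional.trans ℝ 𝕜 V
  have : FiniteDimensional ℝ W := FiniteDimensional.trans ℝ 𝕜 W
  have : FiniteDimensional ℝ U := FiniteDimensional.trans ℝ 𝕜 U
  refine IsHom.ext (p := n - p) (by rw [Nat.cast_sub (by omega)]; exact hE.isHom)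
    (isHom_zero _) fun x₀ => ?_
  obtain ⟨N, hN, hNo, hxN⟩ := eventually_nhds_iff.1 (eventually_good o x₀)
  -- a part of the chart at `x₀` away from the boundary
  let T' : Set (Euc n) := I.symm ⁻¹' (chartAt H x₀).target ∩ interior (range I)
  have hT'o : IsOpen T' :=
    ((chartAt H x₀).open_target.preimage I.continuous_symm).inter isOpen_interior
  have hT'T : T' ⊆ (extChartAt I x₀).target := by
    rw [extChartAt_target]
    exact inter_subset_inter_right _ interior_subset
  let O : Set (Euc n) := T' ∩ (extChartAt I x₀).symm ⁻¹' N
  have hO : IsOpen O :=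
    ((continuousOn_extChartAt_symm x₀).mono hT'T).isOpen_inter_preimage hT'o hNo
  have hOT : O ⊆ (extChartAt I x₀).target := inter_subset_left.trans hT'T
  have hsmooth : ContDiffOn ℝ ∞ (inChart I (E (n - p)) x₀) (extChartAt I x₀).target := hE.2 _ _
  have hint : ∀ y ∈ O, (extChartAt I x₀).symm y ∈ I.interior M := by
    intro y hy
    have hx := (extChartAt I x₀).map_target (hOT hy)
    rw [extChartAt_source] at hx
    refine (ModelWithCorners.isInteriorPoint_iff_of_mem_atlas
      (n := ∞) (by simp) (chart_mem_atlas H x₀) hx).2 ?_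
    change extChartAt I x₀ _ ∈ interior (extChartAt I x₀).target
    rw [(extChartAt I x₀).right_inv (hOT hy)]
    exact interior_maximal hT'T hT'o hy.1
  have key : ∀ (c : (Euc n) [⋀^Fin p]→L[ℝ] V), ∀ y ∈ O,
      wedgeAlt (realBilinear B) c (inChart I (E (n - p)) x₀ y) (frame ∘ Fin.cast hpn) = 0 := by
    intro c
    have hcont : ContinuousOn (fun y => wedgeAlt (realBilinear B) c
        (inChart I (E (n - p)) x₀ y) (frame ∘ Fin.cast hpn)) O := fun y hy =>
      ((contDiffWithinAt_alternating_apply (contDiffWithinAt_wedgeAlt (realBilinear B)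
        contDiffWithinAt_const (hsmooth y (hOT hy))) _).continuousWithinAt).mono hOT
    -- The variation with chart expression f • c turns the hypothesis into the vanishing of the
    -- integral of `f` times the coefficient, for every bump function `f` on `O`. The coefficient is
    -- then zero almost everywhere, and everywhere on `O` by continuity.
    have hae := hO.ae_eq_zero_of_integral_contDiff_smul_eq_zero
      (hcont.locallyIntegrableOn (μ := volume) hO.measurableSet) fun f hf hfc hfO => ?_
    · have h0 := Measure.eqOn_open_of_ae_eq (μ := volume)
        ((ae_restrict_iff' hO.measurableSet).2 hae) hO hcont continuousOn_const
      exact fun y hy => h0 hy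
    · let δ : DForm n M V := Pi.single p (chartForm I x₀ f c)
      have hδp : δ p = chartForm I x₀ f c := Pi.single_eq_same _ _
      have hδ : IsHom p δ := fun q hq => Pi.single_eq_of_ne (by exact_mod_cast hq) _
      let K := (extChartAt I x₀).symm '' tsupport f
      have hK : IsCompact K := isCompact_image_tsupport hfc (hfO.trans hOT)
      have hδ0 : ∀ x ∉ K, ∀ q, δ q x = 0 := by
        intro x hx q
        by_cases hq : q = p
        · subst hq
          rw [hδp]
          exact chartForm_eq_zero c hx
        · rw [hδ q (by exact_mod_cast hq)]; rfl
      have hδv : IsVariation I K p δ := by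
        refine ⟨.of_smoothAt hδ fun q x => ?_, subset_inter
          (supp_subset_of_eq_zero hK.isClosed hδ0)
          ((supp_subset_of_eq_zero hK.isClosed hδ0).trans ?_)⟩
        · by_cases hq : q = p
          · subst hq
            rw [hδp]
            exact smoothAt_chartForm c hf hfc (hfO.trans hOT) x
          · rw [hδ q (by exact_mod_cast hq)]
            exact smoothAt_zero x
        · rintro _ ⟨y, hy, rfl⟩
          exact hint y (hfO hy)
      have h1 := h K hK δ hδv
      have hw0 : ∀ x ∉ K, wedge B δ E n x = 0 := fun x hx =>
        wedge_eq_zero_left B (hδ0 x hx) E n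
      rw [formIntegral_eq, setIntegral_eq_integral_of_forall_compl_eq_zero fun x hx =>
        density_zero g o (hw0 x hx), integral_density_chart g o
        (density_continuous g o ((hδv.1.wedge B hE).smoothAt n)) (x₀ := x₀) ?_] at h1
      · have h2 := (smul_eq_zero.1 h1).resolve_left (sign_ne_zero o x₀)
        rw [← h2, ← setIntegral_eq_integral_of_forall_compl_eq_zero
          (s := (extChartAt I x₀).target)]
        · refine setIntegral_congr_fun (measurableSet_target I x₀) fun y hy => ?_
          have h3 : inChart I (wedge B δ E n) x₀ y = castDeg hpn
              (wedgeAlt (realBilinear B) (f y • c) (inChart I (E (n - p)) x₀ y)) := by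
            rw [← inChart_chartForm c hy, ← hδp]
            rw [inChart, wedge_degree B E hpn hδ, castDeg_compContinuousLinearMap,
              wedgeAlt_compContinuousLinearMap]
            rfl
          beta_reduce
          rw [h3, castDeg_apply]
          exact congrArg (fun a => a (frame ∘ Fin.cast hpn))
            (((wedgeAltL (realBilinear B) p (n - p)).map_smul₂ (f y) c _).symm)
        · intro y hy
          rw [image_eq_zero_of_notMem_tsupport fun ht => hy (hOT (hfO ht)), zero_smul]
      · intro x hx
        refine hw0 x ?_
        rintro ⟨y, hy, rfl⟩
        exact hx (hN _ (hfO hy).2)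
  have hzero : ∀ y ∈ O, inChart I (E (n - p)) x₀ y = 0 := fun y hy =>
    wedgeAlt_nondegenerate (realBilinear B) hB hpn _ fun c => key c y hy
  -- If `x₀` is a boundary point, its image is not in `O`. It is still a limit of points of `O`,
  -- because the interior of `range I` is dense in `range I`, and continuity carries the vanishing
  -- to `x₀`.
  have hfreq : ∃ᶠ y in 𝓝[range I] (extChartAt I x₀ x₀), inChart I (E (n - p)) x₀ y = 0 := by
    have h1 : ∃ᶠ y in 𝓝 (extChartAt I x₀ x₀), y ∈ interior (range I) :=
      mem_closure_iff_frequently.1 (I.range_subset_closure_interior (mem_range_self _))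
    have h2 : ∃ᶠ y in 𝓝[range I] (extChartAt I x₀ x₀), y ∈ interior (range I) := by
      rw [frequently_nhdsWithin_iff]
      exact h1.mono fun y hy => ⟨hy, interior_subset hy⟩
    have h3 := (eventually_mem_target (mem_extChartAt_source (I := I) x₀)).and
      ((tendsto_symm (mem_extChartAt_source (I := I) x₀)).eventually (hNo.mem_nhds hxN))
    refine (h2.and_eventually h3).mono fun y hy => hzero y ⟨⟨?_, hy.1⟩, hy.2.2⟩
    have := hy.2.1
    rw [extChartAt_target] at this
    exact this.1
  have hcw : ContinuousWithinAt (inChart I (E (n - p)) x₀) (range I) (extChartAt I x₀ x₀) :=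
    ContDiffWithinAt.continuousWithinAt (hE.smoothAt (n - p) x₀)
  have hcl := mem_closure_of_frequently_of_tendsto (s := {0}) hfreq hcw
  rw [closure_singleton, mem_singleton_iff, inChart_self] at hcl
  exact hcl

end Fundamental

/-! ### Infinitesimal form of invariance under exponentials. -/

section Skew

variable {𝕜 : Type*} [RCLike 𝕜] {V : Type*} [NormedAddCommGroup V] [NormedSpace 𝕜 V]
  [FiniteDimensional 𝕜 V]

/-- The function t ↦ B(exp(tT)x, exp(tT)y) is constant; its derivative at 0 is B(Tx, y) + B(x, Ty).
-/
theorem skew_of_exp_invariant (B : LinearMap.BilinForm 𝕜 V) (T : V →ₗ[𝕜] V)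
    (h : ∀ (t : 𝕜) (x y : V), B (expOp (t • T) x) (expOp (t • T) y) = B x y) (x y : V) :
    B (T x) y = -B x (T y) := by
  have : CompleteSpace V := FiniteDimensional.complete 𝕜 V
  let T' : V →L[𝕜] V := LinearMap.toContinuousLinearMap T
  have he : ∀ z, HasDerivAt (fun t : 𝕜 => expOp (t • T) z) (T z) 0 := by
    intro z
    have h1 := (hasDerivAt_exp_smul_const (𝕂 := 𝕜) T' (0 : 𝕜)).clm_apply (hasDerivAt_const (0 : 𝕜) z)
    have h2 : (fun t : 𝕜 => expOp (t • T) z) = fun t : 𝕜 => NormedSpace.exp (t • T') z := by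
      funext t
      rw [expOp, map_smul]
    rw [h2]
    convert h1 using 1
    simp [T']
  have h1 := ((((LinearMap.toContinuousBilinearMap B).hasFDerivAt.comp_hasDerivAt (0 : 𝕜)
    (he x)).clm_apply (he y)))
  have h2 : HasDerivAt (fun t : 𝕜 => B (expOp (t • T) x) (expOp (t • T) y)) 0 0 := by
    simp_rw [h]
    exact hasDerivAt_const _ _
  have h3 := h1.unique h2
  have h0 : ∀ z, expOp ((0 : 𝕜) • T) z = z := by
    intro z
    simp [expOp]
  simp only [h0, Function.comp_apply] at h3
  exact eq_neg_of_add_eq_zero_left h3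

end Skew

/-! ### Skewness of the adjoint action, of ▷ and of the bracket. -/

section Invariance

variable {𝕜 : Type*} [RCLike 𝕜] {𝔤 𝔥 : Type*}
  [NormedAddCommGroup 𝔤] [NormedSpace 𝕜 𝔤] [FiniteDimensional 𝕜 𝔤]
  [NormedAddCommGroup 𝔥] [NormedSpace 𝕜 𝔥] [FiniteDimensional 𝕜 𝔥]
  {C : DifferentialCrossedModule 𝕜 𝔤 𝔥} (S : InvariantForms C)

theorem InvariantForms.skewG (Z X X' : 𝔤) :
    S.formG (C.brG Z X) X' = -S.formG X (C.brG Z X') :=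
  skew_of_exp_invariant S.formG (C.brG Z) (fun t x y => by
    rw [← LinearMap.map_smul]; exact S.invG (t • Z) x y) X X'

theorem InvariantForms.skewH (Z : 𝔤) (Y Y' : 𝔥) :
    S.formH (C.act Z Y) Y' = -S.formH Y (C.act Z Y') :=
  skew_of_exp_invariant S.formH (C.act Z) (fun t x y => by
    rw [← LinearMap.map_smul]; exact S.invH (t • Z) x y) Y Y'

theorem DifferentialCrossedModule.brG_skew (C : DifferentialCrossedModule 𝕜 𝔤 𝔥) (X X' : 𝔤) :
    C.brG X X' = -C.brG X' X := by
  have h := C.brG_self (X + X')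
  simp only [map_add, LinearMap.add_apply, C.brG_self, zero_add, add_zero] at h
  exact eq_neg_of_add_eq_zero_right h

end Invariance

/-! ### Moving a skew action across a wedge product, and the covariant Leibniz rule. -/

section Forms

variable {𝕜 : Type*} [RCLike 𝕜] {n : ℕ} {M : Type*}

theorem neg_one_zpow_congr {a b : ℤ} (h : Even (a - b)) : (-1 : 𝕜) ^ a = (-1 : 𝕜) ^ b := by
  rw [← sub_add_cancel a b, zpow_add₀ (by simp), h.neg_one_zpow, one_mul]

theorem wedge_assoc_neg {V₁ V₂ V₃ V₁₂ V₂₃ U : Type*}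
    [NormedAddCommGroup V₁] [NormedSpace ℝ V₁] [NormedSpace 𝕜 V₁] [IsScalarTower ℝ 𝕜 V₁]
    [FiniteDimensional 𝕜 V₁]
    [NormedAddCommGroup V₂] [NormedSpace ℝ V₂] [NormedSpace 𝕜 V₂] [IsScalarTower ℝ 𝕜 V₂]
    [FiniteDimensional 𝕜 V₂]
    [NormedAddCommGroup V₃] [NormedSpace ℝ V₃] [NormedSpace 𝕜 V₃] [IsScalarTower ℝ 𝕜 V₃]
    [FiniteDimensional 𝕜 V₃]
    [NormedAddCommGroup V₁₂] [NormedSpace ℝ V₁₂] [NormedSpace 𝕜 V₁₂] [IsScalarTower ℝ 𝕜 V₁₂]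
    [FiniteDimensional 𝕜 V₁₂]
    [NormedAddCommGroup V₂₃] [NormedSpace ℝ V₂₃] [NormedSpace 𝕜 V₂₃] [IsScalarTower ℝ 𝕜 V₂₃]
    [FiniteDimensional 𝕜 V₂₃]
    [NormedAddCommGroup U] [NormedSpace ℝ U] [NormedSpace 𝕜 U] [IsScalarTower ℝ 𝕜 U]
    (B₁₂ : V₁ →ₗ[𝕜] V₂ →ₗ[𝕜] V₁₂) (B : V₁₂ →ₗ[𝕜] V₃ →ₗ[𝕜] U)
    (B₂₃ : V₂ →ₗ[𝕜] V₃ →ₗ[𝕜] V₂₃) (B' : V₁ →ₗ[𝕜] V₂₃ →ₗ[𝕜] U)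
    (hB : ∀ x y z, B (B₁₂ x y) z = -B' x (B₂₃ y z)) {a : DForm n M V₁} {b : DForm n M V₂}
    {c : DForm n M V₃} {p q r : ℤ} (ha : IsHom p a) (hb : IsHom q b) (hc : IsHom r c) :
    wedge B (wedge B₁₂ a b) c = -wedge B' a (wedge B₂₃ b c) := by
  rw [wedge_assoc B₁₂ B B₂₃ (-B') hB ha hb hc]
  exact wedge_congr_bilin (-B') B' (fun _ _ => rfl) _ _

variable {𝔤 V : Type*}
  [NormedAddCommGroup 𝔤] [NormedSpace ℝ 𝔤] [NormedSpace 𝕜 𝔤] [IsScalarTower ℝ 𝕜 𝔤]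
  [FiniteDimensional 𝕜 𝔤]
  [NormedAddCommGroup V] [NormedSpace ℝ V] [NormedSpace 𝕜 V] [IsScalarTower ℝ 𝕜 V]
  [FiniteDimensional 𝕜 V] (B : V →ₗ[𝕜] V →ₗ[𝕜] 𝕜) (ac : 𝔤 →ₗ[𝕜] V →ₗ[𝕜] V)
  (hB : ∀ Z Y Y', B (ac Z Y) Y' = -B Y (ac Z Y'))

include hB

/-- An action that is skew for the form `B` moves to the other factor of a wedge product. -/
theorem wedge_act_left {p q r : ℤ} {A : DForm n M 𝔤} {b c : DForm n M V} (hA : IsHom p A)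
    (hb : IsHom q b) (hc : IsHom r c) :
    wedge B (wedge ac A b) c = -((-1 : 𝕜) ^ (p * q) • wedge B b (wedge ac A c)) := by
  rw [wedge_comm ac hA hb, wedge_smul_left,
    wedge_assoc_neg ac.flip B ac B (fun x y z => hB y x z) hb hA hc, smul_neg]

/-- The covariant Leibniz rule. -/
theorem wedge_covariant_left {H : Type*} [TopologicalSpace H]
    {I : ModelWithCorners ℝ (Euc n) H} {M : Type*} [TopologicalSpace M] [ChartedSpace H M]
    [IsManifold I ∞ M] {q r : ℤ} {A : DForm n M 𝔤}
    {b c : DForm n M V} (hA : IsForm I 1 A) (hb : IsForm I q b) (hc : IsForm I r c) :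
    wedge B (d I b + wedge ac A b) c =
      d I (wedge B b c) - (-1 : 𝕜) ^ q • wedge B b (d I c + wedge ac A c) := by
  rw [d_wedge B hb hc, wedge_add_left, wedge_add_right,
    wedge_act_left B ac hB hA.isHom hb.isHom hc.isHom, one_mul]
  module

end Forms

/-! ### Integration by parts of the first variation. -/

section FirstVariation

variable {𝕜 : Type*} [RCLike 𝕜] {𝔤 𝔥 : Type*}
  [NormedAddCommGroup 𝔤] [NormedSpace ℝ 𝔤] [NormedSpace 𝕜 𝔤] [IsScalarTower ℝ 𝕜 𝔤]
  [FiniteDimensional 𝕜 𝔤]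
  [NormedAddCommGroup 𝔥] [NormedSpace ℝ 𝔥] [NormedSpace 𝕜 𝔥] [IsScalarTower ℝ 𝕜 𝔥]
  [FiniteDimensional 𝕜 𝔥]
  {n : ℕ} {H : Type*} [TopologicalSpace H] {I : ModelWithCorners ℝ (Euc n) H}
  {M : Type*} [TopologicalSpace M] [ChartedSpace H M] [IsManifold I ∞ M]
  {C : DifferentialCrossedModule 𝕜 𝔤 𝔥} (S : InvariantForms C)

/-- Moving `σ`: `⟨X ▷ Y, Y'⟩ = -⟨X, σ(Y', Y)⟩`. -/
theorem wedge_act_sigma {p q r : ℤ} {a : DForm n M 𝔤} {b c : DForm n M 𝔥} (ha : IsHom p a)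
    (hb : IsHom q b) (hc : IsHom r c) :
    wedge S.formH (wedge C.act a b) c =
      -((-1 : 𝕜) ^ (q * r) • wedge S.formG a (wedge S.sigma c b)) := by
  rw [wedge_assoc_neg C.act S.formH S.sigma.flip S.formG
    (fun x y z => by
      rw [LinearMap.flip_apply, S.symmG, S.sigma_spec, neg_neg, S.symmH]) ha hb hc,
    wedge_comm S.sigma.flip hb hc, wedge_smul_right]
  rfl

/-- The first variation of the Lagrangian, integrated by parts. -/
theorem firstVariation_eq {k : 𝕜} {A₁ A₂ a₁ a₂ : DForm n M 𝔤} {B₂ B₃ b₂ b₃ : DForm n M 𝔥}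
    (hA₁ : IsForm I 1 A₁) (hA₂ : IsForm I 2 A₂) (hB₂ : IsForm I 2 B₂) (hB₃ : IsForm I 3 B₃)
    (ha₁ : IsForm I 1 a₁) (ha₂ : IsForm I 2 a₂) (hb₂ : IsForm I 2 b₂) (hb₃ : IsForm I 3 b₃)
    {f f' : DForm n M 𝔤} {h h' : DForm n M 𝔥} (hf : IsForm I (n - 2) f)
    (hf' : IsForm I (n - 3) f') (hh : IsForm I (n - 3) h) (hh' : IsForm I (n - 4) h') :
    wedge S.formG (DG I C A₁ a₁ + k • a₂ - mapForm C.al b₂) f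
      + wedge S.formG (DG I C A₁ a₂ + wedge C.brG a₁ A₂ - mapForm C.al b₃) f'
      + wedge S.formH (DH I C A₁ b₂ + wedge C.act a₁ B₂ - k • b₃) h
      + wedge S.formH (DH I C A₁ b₃ + wedge C.act a₁ B₃ + wedge C.act a₂ B₂ + wedge C.act A₂ b₂) h'
    = d I (wedge S.formG a₁ f) + d I (wedge S.formG a₂ f') + d I (wedge S.formH b₂ h)
      + d I (wedge S.formH b₃ h')
      + wedge S.formG a₁ (DG I C A₁ f + wedge C.brG A₂ f' - wedge S.sigma h B₂
          + (-1 : 𝕜) ^ (n + 1) • wedge S.sigma h' B₃)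
      - wedge S.formG a₂ (DG I C A₁ f' - k • f + wedge S.sigma h' B₂)
      - wedge S.formH b₂ (DH I C A₁ h + mapForm S.alStar f + wedge C.act A₂ h')
      + wedge S.formH b₃ (DH I C A₁ h' - mapForm S.alStar f' - k • h) := by
  have e1 := wedge_covariant_left S.formG C.brG S.skewG hA₁ ha₁ hf
  have e2 := wedge_covariant_left S.formG C.brG S.skewG hA₁ ha₂ hf'
  have e3 := wedge_covariant_left S.formH C.act S.skewH hA₁ hb₂ hh
  have e4 := wedge_covariant_left S.formH C.act S.skewH hA₁ hb₃ hh'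
  -- Invariance in the form ⟨[X, Y], Z⟩ = ⟨X, [Y, Z]⟩: associativity of the wedge applies and no
  -- sign arises.
  have e5 : wedge S.formG (wedge C.brG a₁ A₂) f' = wedge S.formG a₁ (wedge C.brG A₂ f') :=
    wedge_assoc C.brG S.formG C.brG S.formG (fun x y z => by
      rw [C.brG_skew, map_neg, LinearMap.neg_apply, S.skewG, neg_neg])
      ha₁.isHom hA₂.isHom hf'.isHom
  have e6 := wedge_act_sigma S ha₁.isHom hB₂.isHom hh.isHom
  have e7 := wedge_act_sigma S ha₁.isHom hB₃.isHom hh'.isHom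
  have e8 := wedge_act_sigma S ha₂.isHom hB₂.isHom hh'.isHom
  have e9 := wedge_act_left S.formH C.act S.skewH hA₂.isHom hb₂.isHom hh'.isHom
  have e10 : ∀ (b : DForm n M 𝔥) (f : DForm n M 𝔤),
      wedge S.formG (mapForm C.al b) f = wedge S.formH b (mapForm S.alStar f) := fun b f =>
    wedge_mapForm_left S.formG S.formH C.al S.alStar (fun Y X => (S.alStar_spec X Y).symm) b f
  -- The variations have degrees 1, 2, 2, 3. The Leibniz signs of these degrees give the pattern +,
  -- -, -, + in front of the four Euler expressions.
  have s1 : (-1 : 𝕜) ^ (1 : ℤ) = -1 := zpow_one _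
  have s2 : (-1 : 𝕜) ^ (2 : ℤ) = 1 := Even.neg_one_zpow (by decide)
  have s3 : (-1 : 𝕜) ^ (3 : ℤ) = -1 := Odd.neg_one_zpow (by decide)
  have s4 : (-1 : 𝕜) ^ (2 * ((n : ℤ) - 3)) = 1 := Even.neg_one_zpow (by simp)
  have s5 : (-1 : 𝕜) ^ (2 * ((n : ℤ) - 4)) = 1 := Even.neg_one_zpow (by simp)
  -- The one sign depending on the dimension: B³ of degree 3 passes a form of degree n - 4. This is
  -- the origin of (-1)^(n+1) in the first field equation.
  have s6 : (-1 : 𝕜) ^ (3 * ((n : ℤ) - 4)) = (-1 : 𝕜) ^ n := by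
    rw [← zpow_natCast]
    exact neg_one_zpow_congr ⟨n - 6, by ring⟩
  have s7 : (-1 : 𝕜) ^ ((2 : ℤ) * 2) = 1 := Even.neg_one_zpow (by decide)
  rw [s1] at e1
  rw [s2] at e2 e3
  rw [s3] at e4
  rw [s4] at e6
  rw [s6] at e7
  rw [s5] at e8
  rw [s7] at e9
  simp only [DG, DH]
  -- Sums are split only as far as d b + A ∧ b, which must stay together for the covariant Leibniz
  -- rule to apply.
  simp only [wedge_sub_left, wedge_add_left _ (d I _ + _), wedge_add_left _ (d I _ + _ + _),
    wedge_add_left _ (d I _ + _ + _ + _), wedge_smul_left, e1, e2, e3, e4, e5, e6, e7, e8, e9, e10]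
  simp only [wedge_add_right, wedge_sub_right, wedge_smul_right, pow_succ]
  module

end FirstVariation

/-! ### Derivative of the integral of ⟨X, ∗X⟩ along a quadratic path. -/

section Quadratic

variable {𝕜 : Type*} [RCLike 𝕜] {n : ℕ} {H : Type*} [TopologicalSpace H]
  {I : ModelWithCorners ℝ (Euc n) H}
  {M : Type*} [TopologicalSpace M] [ChartedSpace H M] [IsManifold I ∞ M]
  [T2Space M] [SecondCountableTopology M] [MeasurableSpace M] [BorelSpace M] {V : Type*}
  [NormedAddCommGroup V] [NormedSpace ℝ V] [NormedSpace 𝕜 V] [IsScalarTower ℝ 𝕜 V]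
  [FiniteDimensional 𝕜 V]
  (g : Metric I M) (o : Orient I M) (B : V →ₗ[𝕜] V →ₗ[𝕜] 𝕜)

/-- The form `⟨X, ∗Y⟩`. -/
def starPair (X Y : DForm n M V) : DForm n M 𝕜 := wedge B X (hodgeStar g o Y)

variable {g o B}

theorem IsForm.starPair {p : ℤ} {X Y : DForm n M V} (hX : IsForm I p X) (hY : IsForm I p Y) :
    IsForm I n (starPair g o B X Y) := by
  have : FiniteDimensional ℝ V := FiniteDimensional.trans ℝ 𝕜 V
  have h := hX.wedge B (hY.hodgeStar g o)
  rwa [add_sub_cancel] at h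

theorem starPair_quadratic (hB : ∀ x y, B x y = B y x) {p : ℤ} {X X₁ X₂ : DForm n M V}
    (hX : IsForm I p X) (hX₁ : IsForm I p X₁) (hX₂ : IsForm I p X₂) (c : 𝕜) :
    starPair g o B (X + c • X₁ + c ^ 2 • X₂) (X + c • X₁ + c ^ 2 • X₂) =
      starPair g o B X X + c • ((2 : 𝕜) • starPair g o B X₁ X) +
      c ^ 2 • (starPair g o B X₁ X₁ + (2 : 𝕜) • starPair g o B X₂ X) +
      c ^ 3 • ((2 : 𝕜) • starPair g o B X₁ X₂) + c ^ 4 • starPair g o B X₂ X₂ := by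
  have h1 := wedge_hodgeStar_comm g o B hB hX.isHom hX₁.isHom
  have h2 := wedge_hodgeStar_comm g o B hB hX.isHom hX₂.isHom
  have h3 := wedge_hodgeStar_comm g o B hB hX₂.isHom hX₁.isHom
  simp only [starPair, hodgeStar_add, hodgeStar_smul, wedge_add_left, wedge_add_right,
    wedge_smul_left, wedge_smul_right, h1, h2, h3]
  module

theorem hasDerivAt_quartic (c₀ c₁ c₂ c₃ c₄ : 𝕜) :
    HasDerivAt (fun t : ℝ => c₀ + (t : 𝕜) * c₁ + (t : 𝕜) ^ 2 * c₂ + (t : 𝕜) ^ 3 * c₃ +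
      (t : 𝕜) ^ 4 * c₄) c₁ 0 := by
  have h : HasDerivAt (fun t : ℝ => (t : 𝕜)) 1 0 := by
    simpa using (RCLike.ofRealCLM (K := 𝕜)).hasDerivAt (x := (0 : ℝ))
  exact (((((hasDerivAt_const (0 : ℝ) c₀).add (h.mul_const c₁)).add
    ((h.pow 2).mul_const c₂)).add ((h.pow 3).mul_const c₃)).add
    ((h.pow 4).mul_const c₄)).congr_deriv (by simp)

/-- Expanding by bilinearity gives a quartic polynomial in `t` whose coefficients are integrals of
smooth forms over a compact set. By symmetry the two mixed terms in the linear coefficient agree;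
`X₂` enters only from order t² on. -/
theorem hasDerivAt_starPair (hB : ∀ x y, B x y = B y x) {p : ℤ} {X X₁ X₂ : DForm n M V}
    (hX : IsForm I p X) (hX₁ : IsForm I p X₁) (hX₂ : IsForm I p X₂) {K : Set M}
    (hK : IsCompact K) :
    HasDerivAt (fun t : ℝ => formIntegral g o K
      (starPair g o B (X + (t : 𝕜) • X₁ + (t : 𝕜) ^ 2 • X₂)
        (X + (t : 𝕜) • X₁ + (t : 𝕜) ^ 2 • X₂)))
      (2 * formIntegral g o K (starPair g o B X₁ X)) 0 := by
  have h00 : IsForm I n (starPair g o B X X) := hX.starPair hX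
  have h10 : IsForm I n (starPair g o B X₁ X) := hX₁.starPair hX
  have h11 : IsForm I n (starPair g o B X₁ X₁) := hX₁.starPair hX₁
  have h20 : IsForm I n (starPair g o B X₂ X) := hX₂.starPair hX
  have h12 : IsForm I n (starPair g o B X₁ X₂) := hX₁.starPair hX₂
  have h22 : IsForm I n (starPair g o B X₂ X₂) := hX₂.starPair hX₂
  refine (hasDerivAt_quartic (formIntegral g o K (starPair g o B X X))
    (2 * formIntegral g o K (starPair g o B X₁ X))
    (formIntegral g o K (starPair g o B X₁ X₁) + 2 * formIntegral g o K (starPair g o B X₂ X))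
    (2 * formIntegral g o K (starPair g o B X₁ X₂))
    (formIntegral g o K (starPair g o B X₂ X₂))).congr_of_eventuallyEq
    (Filter.Eventually.of_forall fun t => ?_)
  have k1 := h10.smul (2 : 𝕜)
  have k2 := h11.add (h20.smul (2 : 𝕜))
  have k3 := h12.smul (2 : 𝕜)
  have j1 := h00.add (k1.smul (t : 𝕜))
  have j2 := j1.add (k2.smul ((t : 𝕜) ^ 2))
  have j3 := j2.add (k3.smul ((t : 𝕜) ^ 3))
  beta_reduce
  rw [starPair_quadratic hB hX hX₁ hX₂, formIntegral_add g o hK j3 (h22.smul _),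
    formIntegral_add g o hK j2 (k3.smul _), formIntegral_add g o hK j1 (k2.smul _),
    formIntegral_add g o hK h00 (k1.smul _)]
  simp only [formIntegral_smul, formIntegral_add g o hK h11 (h20.smul (2 : 𝕜)), smul_eq_mul]

end Quadratic

/-! ### Components of the generalized curvatures, their variations, and the action. -/

section Curvature

variable {𝕜 : Type*} [RCLike 𝕜] {𝔤 𝔥 : Type*}
  [NormedAddCommGroup 𝔤] [NormedSpace ℝ 𝔤] [NormedSpace 𝕜 𝔤] [IsScalarTower ℝ 𝕜 𝔤]
  [FiniteDimensional 𝕜 𝔤]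
  [NormedAddCommGroup 𝔥] [NormedSpace ℝ 𝔥] [NormedSpace 𝕜 𝔥] [IsScalarTower ℝ 𝕜 𝔥]
  [FiniteDimensional 𝕜 𝔥]
  {n : ℕ} {H : Type*} [TopologicalSpace H] {I : ModelWithCorners ℝ (Euc n) H}
  {M : Type*} [TopologicalSpace M] [ChartedSpace H M] [IsManifold I ∞ M]
  {C : DifferentialCrossedModule 𝕜 𝔤 𝔥} {k : 𝕜}
  {A₁ A₂ a₁ a₂ : DForm n M 𝔤} {B₂ B₃ b₂ b₃ : DForm n M 𝔥}

theorem wedge_brG_comm {p q : ℤ} {a b : DForm n M 𝔤} (ha : IsHom p a) (hb : IsHom q b) :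
    wedge C.brG a b = -((-1 : 𝕜) ^ (p * q) • wedge C.brG b a) := by
  rw [wedge_comm C.brG ha hb, wedge_congr_bilin C.brG.flip C.brG fun x y => C.brG_skew y x,
    smul_neg]

-- The cross terms A¹ ∧ A² and -A² ∧ A¹ of the generalized product coincide, as the bracket is skew
-- and the degrees 1 and 2 commute. The factor 1/2 therefore disappears from the second component.
variable (C k) in
theorem gcurvF_eq (hA₁ : IsForm I 1 A₁) (hA₂ : IsForm I 2 A₂) :
    gcurvF I C k (A₁, A₂) (B₂, B₃) =
      (curvF I C A₁ B₂ + k • A₂, DG I C A₁ A₂ - mapForm C.al B₃) := by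
  have h := wedge_brG_comm (C := C) hA₂.isHom hA₁.isHom
  rw [Even.neg_one_zpow (by decide), one_smul] at h
  have s1 : (-1 : 𝕜) ^ ((1 : ℤ) + 1) = 1 := Even.neg_one_zpow (by decide)
  ext1
  · change d I A₁ + ((-1 : 𝕜) ^ ((1 : ℤ) + 1) * k) • A₂ + (1 / 2 : 𝕜) • wedge C.brG A₁ A₁
      - mapForm C.al B₂ = d I A₁ + (1 / 2 : 𝕜) • wedge C.brG A₁ A₁ - mapForm C.al B₂ + k • A₂
    rw [s1]
    module
  · change d I A₂ + (1 / 2 : 𝕜) • (wedge C.brG A₁ A₂ + (-1 : 𝕜) ^ (1 : ℤ) • wedge C.brG A₂ A₁)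
      - mapForm C.al B₃ = d I A₂ + wedge C.brG A₁ A₂ - mapForm C.al B₃
    rw [h, zpow_one]
    module

variable (C k) in
theorem gcurvG_eq : gcurvG I C k (A₁, A₂) (B₂, B₃) =
    (curvG I C A₁ B₂ - k • B₃, DH I C A₁ B₃ + wedge C.act A₂ B₂) := by
  have s1 : (-1 : 𝕜) ^ ((2 : ℤ) + 1) = -1 := Odd.neg_one_zpow (by decide)
  have s2 : (-1 : 𝕜) ^ (2 : ℤ) = 1 := Even.neg_one_zpow (by decide)
  ext1
  · change d I B₂ + ((-1 : 𝕜) ^ ((2 : ℤ) + 1) * k) • B₃ + wedge C.act A₁ B₂ =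
      d I B₂ + wedge C.act A₁ B₂ - k • B₃
    rw [s1]
    module
  · change d I B₃ + (wedge C.act A₁ B₃ + (-1 : 𝕜) ^ (2 : ℤ) • wedge C.act A₂ B₂) =
      d I B₃ + wedge C.act A₁ B₃ + wedge C.act A₂ B₂
    rw [s2]
    module

theorem isForm_curvF (hA₁ : IsForm I 1 A₁) (hA₂ : IsForm I 2 A₂) (hB₂ : IsForm I 2 B₂) :
    IsForm I 2 (curvF I C A₁ B₂ + k • A₂) := by
  have : FiniteDimensional ℝ 𝔤 := FiniteDimensional.trans ℝ 𝕜 𝔤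
  exact ((hA₁.d.add ((hA₁.wedge C.brG hA₁).smul _)).sub (hB₂.mapForm C.al)).add (hA₂.smul k)

theorem isForm_DG {p : ℤ} {θ : DForm n M 𝔤} (hA₁ : IsForm I 1 A₁) (hθ : IsForm I p θ) :
    IsForm I (p + 1) (DG I C A₁ θ) := by
  have : FiniteDimensional ℝ 𝔤 := FiniteDimensional.trans ℝ 𝕜 𝔤
  exact hθ.d.add (add_comm 1 p ▸ hA₁.wedge C.brG hθ)

theorem isForm_DH {p : ℤ} {θ : DForm n M 𝔥} (hA₁ : IsForm I 1 A₁) (hθ : IsForm I p θ) :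
    IsForm I (p + 1) (DH I C A₁ θ) := by
  have : FiniteDimensional ℝ 𝔥 := FiniteDimensional.trans ℝ 𝕜 𝔥
  exact hθ.d.add (add_comm 1 p ▸ hA₁.wedge C.act hθ)

theorem isForm_curvF' (hA₁ : IsForm I 1 A₁) (hA₂ : IsForm I 2 A₂) (hB₃ : IsForm I 3 B₃) :
    IsForm I 3 (DG I C A₁ A₂ - mapForm C.al B₃) := by
  have : FiniteDimensional ℝ 𝔤 := FiniteDimensional.trans ℝ 𝕜 𝔤
  exact (isForm_DG hA₁ hA₂).sub (hB₃.mapForm C.al)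

theorem isForm_curvG (hA₁ : IsForm I 1 A₁) (hB₂ : IsForm I 2 B₂) (hB₃ : IsForm I 3 B₃) :
    IsForm I 3 (curvG I C A₁ B₂ - k • B₃) := by
  have : FiniteDimensional ℝ 𝔥 := FiniteDimensional.trans ℝ 𝕜 𝔥
  exact (isForm_DH hA₁ hB₂).sub (hB₃.smul k)

theorem isForm_curvG' (hA₁ : IsForm I 1 A₁) (hA₂ : IsForm I 2 A₂) (hB₂ : IsForm I 2 B₂)
    (hB₃ : IsForm I 3 B₃) : IsForm I 4 (DH I C A₁ B₃ + wedge C.act A₂ B₂) := by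
  have : FiniteDimensional ℝ 𝔥 := FiniteDimensional.trans ℝ 𝕜 𝔥
  exact (isForm_DH hA₁ hB₃).add (hA₂.wedge C.act hB₂)

theorem curvF_vary (hA₁ : IsForm I 1 A₁) (ha₁ : IsForm I 1 a₁) (c : 𝕜) :
    curvF I C (A₁ + c • a₁) (B₂ + c • b₂) + k • (A₂ + c • a₂) = curvF I C A₁ B₂ + k • A₂ +
      c • (DG I C A₁ a₁ + k • a₂ - mapForm C.al b₂) +
      c ^ 2 • ((1 / 2 : 𝕜) • wedge C.brG a₁ a₁) := by
  -- For one-forms the bracket product is symmetric, so the two halves of the linear term combine to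
  -- the covariant derivative of the variation.
  have h := wedge_brG_comm (C := C) ha₁.isHom hA₁.isHom
  rw [one_mul, zpow_one] at h
  simp only [curvF, DG, d_add hA₁ (ha₁.smul c), d_smul c ha₁, wedge_add_left, wedge_add_right,
    wedge_smul_left, wedge_smul_right, mapForm_add, mapForm_smul, h]
  module

theorem curvF'_vary (hA₂ : IsForm I 2 A₂) (ha₂ : IsForm I 2 a₂) (c : 𝕜) :
    DG I C (A₁ + c • a₁) (A₂ + c • a₂) - mapForm C.al (B₃ + c • b₃) =
      DG I C A₁ A₂ - mapForm C.al B₃ +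
      c • (DG I C A₁ a₂ + wedge C.brG a₁ A₂ - mapForm C.al b₃) + c ^ 2 • wedge C.brG a₁ a₂ := by
  simp only [DG, d_add hA₂ (ha₂.smul c), d_smul c ha₂, wedge_add_left, wedge_add_right,
    wedge_smul_left, wedge_smul_right, mapForm_add, mapForm_smul]
  module

theorem curvG_vary (hB₂ : IsForm I 2 B₂) (hb₂ : IsForm I 2 b₂) (c : 𝕜) :
    curvG I C (A₁ + c • a₁) (B₂ + c • b₂) - k • (B₃ + c • b₃) = curvG I C A₁ B₂ - k • B₃ +
      c • (DH I C A₁ b₂ + wedge C.act a₁ B₂ - k • b₃) + c ^ 2 • wedge C.act a₁ b₂ := by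
  simp only [curvG, DH, d_add hB₂ (hb₂.smul c), d_smul c hb₂, wedge_add_left, wedge_add_right,
    wedge_smul_left, wedge_smul_right]
  module

theorem curvG'_vary (hB₃ : IsForm I 3 B₃) (hb₃ : IsForm I 3 b₃) (c : 𝕜) :
    DH I C (A₁ + c • a₁) (B₃ + c • b₃) + wedge C.act (A₂ + c • a₂) (B₂ + c • b₂) =
      DH I C A₁ B₃ + wedge C.act A₂ B₂ +
      c • (DH I C A₁ b₃ + wedge C.act a₁ B₃ + wedge C.act a₂ B₂ + wedge C.act A₂ b₂) +
      c ^ 2 • (wedge C.act a₁ b₃ + wedge C.act a₂ b₂) := by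
  simp only [DH, d_add hB₃ (hb₃.smul c), d_smul c hb₃, wedge_add_left, wedge_add_right,
    wedge_smul_left, wedge_smul_right]
  module

variable (S : InvariantForms C) (g : Metric I M) (o : Orient I M)

theorem neg_one_zpow_real_smul {V : Type*} [NormedAddCommGroup V] [NormedSpace ℝ V]
    [NormedSpace 𝕜 V] [IsScalarTower ℝ 𝕜 V] (m : ℤ) (θ : DForm n M V) :
    (-1 : ℝ) ^ m • θ = (-1 : 𝕜) ^ m • θ := by
  rcases Int.even_or_odd m with h | h <;> simp [h.neg_one_zpow]

theorem neg_one_zpow_mul_self (m : ℤ) : (-1 : 𝕜) ^ m * (-1 : 𝕜) ^ m = 1 := by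
  rcases Int.even_or_odd m with h | h <;> simp [h.neg_one_zpow]

/-- Integration sees only the second component of the product. There the sign (-1)^(n-p-1) in ⋆
meets the sign (-1)^q of the product with q = n - p - 1, and their product is 1. -/
theorem gAction_eq [MeasurableSpace M] (hA₁ : IsForm I 1 A₁) (hA₂ : IsForm I 2 A₂) (K : Set M) :
    gAction S g o k K A₁ A₂ B₂ B₃ = formIntegral g o K
      (starPair g o S.formG (curvF I C A₁ B₂ + k • A₂) (curvF I C A₁ B₂ + k • A₂)
      + starPair g o S.formG (DG I C A₁ A₂ - mapForm C.al B₃) (DG I C A₁ A₂ - mapForm C.al B₃)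
      + starPair g o S.formH (curvG I C A₁ B₂ - k • B₃) (curvG I C A₁ B₂ - k • B₃)
      + starPair g o S.formH (DH I C A₁ B₃ + wedge C.act A₂ B₂)
        (DH I C A₁ B₃ + wedge C.act A₂ B₂)) := by
  rw [gAction, gcurvF_eq C k hA₁ hA₂, gcurvG_eq C k, gintegral]
  congr 1
  simp only [gwedge, gstar, Prod.snd_add, starPair]
  rw [neg_one_zpow_real_smul (𝕜 := 𝕜), neg_one_zpow_real_smul (𝕜 := 𝕜), wedge_smul_right,
    wedge_smul_right, smul_smul, smul_smul,
    show (n : ℤ) - 2 - 1 = n - 3 by ring, show (n : ℤ) - 3 - 1 = n - 4 by ring,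
    neg_one_zpow_mul_self, neg_one_zpow_mul_self, one_smul, one_smul]
  abel

end Curvature

/-! ### Euler expressions and the first variation of the action. -/

section Variation

variable {𝕜 : Type*} [RCLike 𝕜] {𝔤 𝔥 : Type*}
  [NormedAddCommGroup 𝔤] [NormedSpace ℝ 𝔤] [NormedSpace 𝕜 𝔤] [IsScalarTower ℝ 𝕜 𝔤]
  [FiniteDimensional 𝕜 𝔤]
  [NormedAddCommGroup 𝔥] [NormedSpace ℝ 𝔥] [NormedSpace 𝕜 𝔥] [IsScalarTower ℝ 𝕜 𝔥]
  [FiniteDimensional 𝕜 𝔥]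
  {n : ℕ} {H : Type*} [TopologicalSpace H] {I : ModelWithCorners ℝ (Euc n) H}
  {M : Type*} [TopologicalSpace M] [ChartedSpace H M] [IsManifold I ∞ M]
  {C : DifferentialCrossedModule 𝕜 𝔤 𝔥} (S : InvariantForms C) (g : Metric I M) (o : Orient I M)
  (k : 𝕜) (A₁ A₂ : DForm n M 𝔤) (B₂ B₃ : DForm n M 𝔥)

/-- The left-hand side of the field equation of `A¹`. -/
def eulerA₁ : DForm n M 𝔤 :=
  DG I C A₁ (hodgeStar g o (curvF I C A₁ B₂ + k • A₂))
    + wedge C.brG A₂ (hodgeStar g o (DG I C A₁ A₂ - mapForm C.al B₃))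
    - wedge S.sigma (hodgeStar g o (curvG I C A₁ B₂ - k • B₃)) B₂
    + (-1 : 𝕜) ^ (n + 1) • wedge S.sigma (hodgeStar g o (DH I C A₁ B₃ + wedge C.act A₂ B₂)) B₃

/-- The left-hand side of the field equation of `A²`. -/
def eulerA₂ : DForm n M 𝔤 :=
  DG I C A₁ (hodgeStar g o (DG I C A₁ A₂ - mapForm C.al B₃))
    - k • hodgeStar g o (curvF I C A₁ B₂ + k • A₂)
    + wedge S.sigma (hodgeStar g o (DH I C A₁ B₃ + wedge C.act A₂ B₂)) B₂

/-- The left-hand side of the field equation of `B²`. -/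
def eulerB₂ : DForm n M 𝔥 :=
  DH I C A₁ (hodgeStar g o (curvG I C A₁ B₂ - k • B₃))
    + mapForm S.alStar (hodgeStar g o (curvF I C A₁ B₂ + k • A₂))
    + wedge C.act A₂ (hodgeStar g o (DH I C A₁ B₃ + wedge C.act A₂ B₂))

/-- The left-hand side of the field equation of `B³`. -/
def eulerB₃ : DForm n M 𝔥 :=
  DH I C A₁ (hodgeStar g o (DH I C A₁ B₃ + wedge C.act A₂ B₂))
    - mapForm S.alStar (hodgeStar g o (DG I C A₁ A₂ - mapForm C.al B₃))
    - k • hodgeStar g o (curvG I C A₁ B₂ - k • B₃)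

variable {A₁ A₂ B₂ B₃}
  (hA₁ : IsForm I 1 A₁) (hA₂ : IsForm I 2 A₂) (hB₂ : IsForm I 2 B₂) (hB₃ : IsForm I 3 B₃)

include hA₁ hA₂ hB₂ hB₃

theorem isForm_eulerA₁ : IsForm I (n - 1) (eulerA₁ S g o k A₁ A₂ B₂ B₃) := by
  have : FiniteDimensional ℝ 𝔤 := FiniteDimensional.trans ℝ 𝕜 𝔤
  have : FiniteDimensional ℝ 𝔥 := FiniteDimensional.trans ℝ 𝕜 𝔥
  have h1 := isForm_DG (C := C) hA₁ ((isForm_curvF (k := k) (C := C) hA₁ hA₂ hB₂).hodgeStar g o)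
  have h2 := hA₂.wedge C.brG ((isForm_curvF' (C := C) hA₁ hA₂ hB₃).hodgeStar g o)
  have h3 := ((isForm_curvG (k := k) (C := C) hA₁ hB₂ hB₃).hodgeStar g o).wedge S.sigma hB₂
  have h4 := ((isForm_curvG' (C := C) hA₁ hA₂ hB₂ hB₃).hodgeStar g o).wedge S.sigma hB₃
  rw [show (n : ℤ) - 2 + 1 = n - 1 by ring] at h1
  rw [show 2 + ((n : ℤ) - 3) = n - 1 by ring] at h2
  rw [show (n : ℤ) - 3 + 2 = n - 1 by ring] at h3
  rw [show (n : ℤ) - 4 + 3 = n - 1 by ring] at h4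
  exact ((h1.add h2).sub h3).add (h4.smul _)

theorem isForm_eulerA₂ : IsForm I (n - 2) (eulerA₂ S g o k A₁ A₂ B₂ B₃) := by
  have : FiniteDimensional ℝ 𝔤 := FiniteDimensional.trans ℝ 𝕜 𝔤
  have : FiniteDimensional ℝ 𝔥 := FiniteDimensional.trans ℝ 𝕜 𝔥
  have h1 := isForm_DG (C := C) hA₁ ((isForm_curvF' (C := C) hA₁ hA₂ hB₃).hodgeStar g o)
  have h2 := (isForm_curvF (k := k) (C := C) hA₁ hA₂ hB₂).hodgeStar g o
  have h3 := ((isForm_curvG' (C := C) hA₁ hA₂ hB₂ hB₃).hodgeStar g o).wedge S.sigma hB₂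
  rw [show (n : ℤ) - 3 + 1 = n - 2 by ring] at h1
  rw [show (n : ℤ) - 4 + 2 = n - 2 by ring] at h3
  exact (h1.sub (h2.smul k)).add h3

theorem isForm_eulerB₂ : IsForm I (n - 2) (eulerB₂ S g o k A₁ A₂ B₂ B₃) := by
  have : FiniteDimensional ℝ 𝔤 := FiniteDimensional.trans ℝ 𝕜 𝔤
  have : FiniteDimensional ℝ 𝔥 := FiniteDimensional.trans ℝ 𝕜 𝔥
  have h1 := isForm_DH (C := C) hA₁
    ((isForm_curvG (k := k) (C := C) hA₁ hB₂ hB₃).hodgeStar g o)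
  have h2 := ((isForm_curvF (k := k) (C := C) hA₁ hA₂ hB₂).hodgeStar g o).mapForm S.alStar
  have h3 := hA₂.wedge C.act ((isForm_curvG' (C := C) hA₁ hA₂ hB₂ hB₃).hodgeStar g o)
  rw [show (n : ℤ) - 3 + 1 = n - 2 by ring] at h1
  rw [show 2 + ((n : ℤ) - 4) = n - 2 by ring] at h3
  exact (h1.add h2).add h3

theorem isForm_eulerB₃ : IsForm I (n - 3) (eulerB₃ S g o k A₁ A₂ B₂ B₃) := by
  have : FiniteDimensional ℝ 𝔤 := FiniteDimensional.trans ℝ 𝕜 𝔤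
  have : FiniteDimensional ℝ 𝔥 := FiniteDimensional.trans ℝ 𝕜 𝔥
  have h1 := isForm_DH (C := C) hA₁ ((isForm_curvG' (C := C) hA₁ hA₂ hB₂ hB₃).hodgeStar g o)
  have h2 := ((isForm_curvF' (C := C) hA₁ hA₂ hB₃).hodgeStar g o).mapForm S.alStar
  have h3 := (isForm_curvG (k := k) (C := C) hA₁ hB₂ hB₃).hodgeStar g o
  rw [show (n : ℤ) - 4 + 1 = n - 3 by ring] at h1
  exact (h1.sub h2).sub (h3.smul k)

variable [T2Space M] [SecondCountableTopology M] [MeasurableSpace M] [BorelSpace M]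

omit hA₁ hA₂ hB₂ hB₃ in
theorem formIntegral_d_wedge {V : Type*} [NormedAddCommGroup V] [NormedSpace ℝ V]
    [NormedSpace 𝕜 V] [IsScalarTower ℝ 𝕜 V] [FiniteDimensional 𝕜 V] (B : V →ₗ[𝕜] V →ₗ[𝕜] 𝕜)
    {K : Set M} (hK : IsCompact K) {p q : ℤ} {a f : DForm n M V} (ha : IsVariation I K p a)
    (hf : IsForm I q f) (hpq : p + q = n - 1) :
    IsForm I n (d I (wedge B a f)) ∧ formIntegral g o K (d I (wedge B a f)) = 0 := by
  have h := ha.1.wedge B hf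
  rw [hpq] at h
  refine ⟨?_, formIntegral_d g o hK h ((supp_wedge_subset B a f).trans ha.2)⟩
  have := h.d
  rwa [sub_add_cancel] at this

/-- The first variation of the action. -/
theorem hasDerivAt_gAction {K : Set M} (hK : IsCompact K) {a₁ a₂ : DForm n M 𝔤}
    {b₂ b₃ : DForm n M 𝔥} (ha₁ : IsVariation I K 1 a₁) (ha₂ : IsVariation I K 2 a₂)
    (hb₂ : IsVariation I K 2 b₂) (hb₃ : IsVariation I K 3 b₃) :
    HasDerivAt (fun t : ℝ =>
      gAction S g o k K (A₁ + t • a₁) (A₂ + t • a₂) (B₂ + t • b₂) (B₃ + t • b₃))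
      (2 * (formIntegral g o K (wedge S.formG a₁ (eulerA₁ S g o k A₁ A₂ B₂ B₃))
        - formIntegral g o K (wedge S.formG a₂ (eulerA₂ S g o k A₁ A₂ B₂ B₃))
        - formIntegral g o K (wedge S.formH b₂ (eulerB₂ S g o k A₁ A₂ B₂ B₃))
        + formIntegral g o K (wedge S.formH b₃ (eulerB₃ S g o k A₁ A₂ B₂ B₃)))) 0 := by
  have : FiniteDimensional ℝ 𝔤 := FiniteDimensional.trans ℝ 𝕜 𝔤
  have : FiniteDimensional ℝ 𝔥 := FiniteDimensional.trans ℝ 𝕜 𝔥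
  have hF := isForm_curvF (k := k) (C := C) hA₁ hA₂ hB₂
  have hF' := isForm_curvF' (C := C) hA₁ hA₂ hB₃
  have hG := isForm_curvG (k := k) (C := C) hA₁ hB₂ hB₃
  have hG' := isForm_curvG' (C := C) hA₁ hA₂ hB₂ hB₃
  have hF1 : IsForm I 2 (DG I C A₁ a₁ + k • a₂ - mapForm C.al b₂) :=
    ((isForm_DG hA₁ ha₁.1).add (ha₂.1.smul k)).sub (hb₂.1.mapForm C.al)
  have hF1' : IsForm I 3 (DG I C A₁ a₂ + wedge C.brG a₁ A₂ - mapForm C.al b₃) :=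
    ((isForm_DG hA₁ ha₂.1).add (ha₁.1.wedge C.brG hA₂)).sub (hb₃.1.mapForm C.al)
  have hG1 : IsForm I 3 (DH I C A₁ b₂ + wedge C.act a₁ B₂ - k • b₃) :=
    ((isForm_DH hA₁ hb₂.1).add (ha₁.1.wedge C.act hB₂)).sub (hb₃.1.smul k)
  have hG1' : IsForm I 4 (DH I C A₁ b₃ + wedge C.act a₁ B₃ + wedge C.act a₂ B₂
      + wedge C.act A₂ b₂) :=
    (((isForm_DH hA₁ hb₃.1).add (ha₁.1.wedge C.act hB₃)).add (ha₂.1.wedge C.act hB₂)).add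
      (hA₂.wedge C.act hb₂.1)
  -- The t² coefficients of the varied curvatures. They do not contribute to the derivative, but are
  -- part of the exact polynomial expression.
  have hF2 : IsForm I 2 ((1 / 2 : 𝕜) • wedge C.brG a₁ a₁) := (ha₁.1.wedge C.brG ha₁.1).smul _
  have hF2' : IsForm I 3 (wedge C.brG a₁ a₂) := ha₁.1.wedge C.brG ha₂.1
  have hG2 : IsForm I 3 (wedge C.act a₁ b₂) := ha₁.1.wedge C.act hb₂.1
  have hG2' : IsForm I 4 (wedge C.act a₁ b₃ + wedge C.act a₂ b₂) :=
    (ha₁.1.wedge C.act hb₃.1).add (ha₂.1.wedge C.act hb₂.1)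
  have hD := (((hasDerivAt_starPair (g := g) (o := o) S.symmG hF hF1 hF2 hK).add
    (hasDerivAt_starPair (g := g) (o := o) S.symmG hF' hF1' hF2' hK)).add
    (hasDerivAt_starPair (g := g) (o := o) S.symmH hG hG1 hG2 hK)).add
    (hasDerivAt_starPair (g := g) (o := o) S.symmH hG' hG1' hG2' hK)
  refine (hD.congr_of_eventuallyEq (Filter.Eventually.of_forall fun t => ?_)).congr_deriv ?_
  · have hFt := (hF.add (hF1.smul (t : 𝕜))).add (hF2.smul ((t : 𝕜) ^ 2))
    have hFt' := (hF'.add (hF1'.smul (t : 𝕜))).add (hF2'.smul ((t : 𝕜) ^ 2))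
    have hGt := (hG.add (hG1.smul (t : 𝕜))).add (hG2.smul ((t : 𝕜) ^ 2))
    have hGt' := (hG'.add (hG1'.smul (t : 𝕜))).add (hG2'.smul ((t : 𝕜) ^ 2))
    simp only [real_smul_eq (𝕜 := 𝕜) t, Pi.add_apply]
    rw [gAction_eq S g o (hA₁.add (ha₁.1.smul _)) (hA₂.add (ha₂.1.smul _)),
      curvF_vary hA₁ ha₁.1, curvF'_vary hA₂ ha₂.1, curvG_vary hB₂ hb₂.1, curvG'_vary hB₃ hb₃.1,
      formIntegral_add g o hK (((hFt.starPair hFt).add (hFt'.starPair hFt')).add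
        (hGt.starPair hGt)) (hGt'.starPair hGt'),
      formIntegral_add g o hK ((hFt.starPair hFt).add (hFt'.starPair hFt')) (hGt.starPair hGt),
      formIntegral_add g o hK (hFt.starPair hFt) (hFt'.starPair hFt')]
  · have hf := hF.hodgeStar g o
    have hf' := hF'.hodgeStar g o
    have hh := hG.hodgeStar g o
    have hh' := hG'.hodgeStar g o
    rw [← mul_add, ← mul_add, ← mul_add,
      ← formIntegral_add g o hK (hF1.starPair hF) (hF1'.starPair hF'),
      ← formIntegral_add g o hK ((hF1.starPair hF).add (hF1'.starPair hF')) (hG1.starPair hG),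
      ← formIntegral_add g o hK (((hF1.starPair hF).add (hF1'.starPair hF')).add
        (hG1.starPair hG)) (hG1'.starPair hG')]
    congr 1
    refine (congrArg (formIntegral g o K) (firstVariation_eq S hA₁ hA₂ hB₂ hB₃ ha₁.1 ha₂.1 hb₂.1
      hb₃.1 hf hf' hh hh')).trans ?_
    -- Each exact term is the derivative of a form supported where the variation is, so Stokes
    -- removes it.
    obtain ⟨i1, z1⟩ := formIntegral_d_wedge g o S.formG hK ha₁ hf (by ring)
    obtain ⟨i2, z2⟩ := formIntegral_d_wedge g o S.formG hK ha₂ hf' (by ring)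
    obtain ⟨i3, z3⟩ := formIntegral_d_wedge g o S.formH hK hb₂ hh (by ring)
    obtain ⟨i4, z4⟩ := formIntegral_d_wedge g o S.formH hK hb₃ hh' (by ring)
    have j1 := ha₁.1.wedge S.formG (isForm_eulerA₁ S g o k hA₁ hA₂ hB₂ hB₃)
    have j2 := ha₂.1.wedge S.formG (isForm_eulerA₂ S g o k hA₁ hA₂ hB₂ hB₃)
    have j3 := hb₂.1.wedge S.formH (isForm_eulerB₂ S g o k hA₁ hA₂ hB₂ hB₃)
    have j4 := hb₃.1.wedge S.formH (isForm_eulerB₃ S g o k hA₁ hA₂ hB₂ hB₃)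
    rw [add_sub_cancel] at j1 j2 j3 j4
    change formIntegral g o K (_ + _ + _ + _
      + wedge S.formG a₁ (eulerA₁ S g o k A₁ A₂ B₂ B₃)
      - wedge S.formG a₂ (eulerA₂ S g o k A₁ A₂ B₂ B₃)
      - wedge S.formH b₂ (eulerB₂ S g o k A₁ A₂ B₂ B₃)
      + wedge S.formH b₃ (eulerB₃ S g o k A₁ A₂ B₂ B₃)) = _
    rw [sub_eq_add_neg, sub_eq_add_neg,
      formIntegral_add g o hK (((((((i1.add i2).add i3).add i4).add j1).add j2.neg).add j3.neg)) j4,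
      formIntegral_add g o hK ((((((i1.add i2).add i3).add i4).add j1).add j2.neg)) j3.neg,
      formIntegral_add g o hK (((((i1.add i2).add i3).add i4).add j1)) j2.neg,
      formIntegral_add g o hK ((((i1.add i2).add i3).add i4)) j1,
      formIntegral_add g o hK ((i1.add i2).add i3) i4,
      formIntegral_add g o hK (i1.add i2) i3, formIntegral_add g o hK i1 i2,
      formIntegral_neg, formIntegral_neg, z1, z2, z3, z4]
    ring

end Variation

/-! ### Stationarity, and comparison with the field equations. -/

section Equations

variable {𝕜 : Type*} [RCLike 𝕜] {𝔤 𝔥 : Type*}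
  [NormedAddCommGroup 𝔤] [NormedSpace ℝ 𝔤] [NormedSpace 𝕜 𝔤] [IsScalarTower ℝ 𝕜 𝔤]
  [FiniteDimensional 𝕜 𝔤]
  [NormedAddCommGroup 𝔥] [NormedSpace ℝ 𝔥] [NormedSpace 𝕜 𝔥] [IsScalarTower ℝ 𝕜 𝔥]
  [FiniteDimensional 𝕜 𝔥]
  {n : ℕ} {H : Type*} [TopologicalSpace H] {I : ModelWithCorners ℝ (Euc n) H}
  {M : Type*} [TopologicalSpace M] [ChartedSpace H M] [IsManifold I ∞ M]

theorem isVariation_zero (𝕜 : Type*) [RCLike 𝕜] {V : Type*} [NormedAddCommGroup V]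
    [NormedSpace ℝ V] [NormedSpace 𝕜 V] [IsScalarTower ℝ 𝕜 V] [FiniteDimensional 𝕜 V] (K : Set M)
    (p : ℤ) : IsVariation I K p (0 : DForm n M V) := by
  have : FiniteDimensional ℝ V := FiniteDimensional.trans ℝ 𝕜 V
  refine ⟨isForm_zero p, ?_⟩
  have : supp (0 : DForm n M V) = ∅ := by simp [supp]
  rw [this]
  exact empty_subset _

variable {C : DifferentialCrossedModule 𝕜 𝔤 𝔥} (S : InvariantForms C) (g : Metric I M)
  (o : Orient I M) (k : 𝕜) {A₁ A₂ : DForm n M 𝔤} {B₂ B₃ : DForm n M 𝔥}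
  (hA₁ : IsForm I 1 A₁) (hA₂ : IsForm I 2 A₂) (hB₂ : IsForm I 2 B₂) (hB₃ : IsForm I 3 B₃)

section Stationarity

variable [T2Space M] [SecondCountableTopology M] [MeasurableSpace M] [BorelSpace M]

include hA₁ hA₂ hB₂ hB₃

/-- With the other three variations zero, the first variation is twice a single pairing, and the
fundamental lemma applies to it. The other three fields are handled in the same way, up to the sign
of the pairing. -/
theorem stationary_A₁ : Stationary I 1 (fun K a => gAction S g o k K a A₂ B₂ B₃) A₁ ↔
    EqA₁ S g o k A₁ A₂ B₂ B₃ := by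
  have key : ∀ (K : Set M), IsCompact K → ∀ δ, IsVariation I K 1 δ →
      HasDerivAt (fun t : ℝ => gAction S g o k K (A₁ + t • δ) A₂ B₂ B₃)
        (2 * formIntegral g o K (wedge S.formG δ (eulerA₁ S g o k A₁ A₂ B₂ B₃))) 0 := by
    intro K hK δ hδ
    simpa only [smul_zero, add_zero, wedge_zero_left, formIntegral_zero, sub_zero] using
      hasDerivAt_gAction S g o k hA₁ hA₂ hB₂ hB₃ hK hδ (isVariation_zero 𝕜 K 2)
        (isVariation_zero 𝕜 K 2) (isVariation_zero 𝕜 K 3)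
  constructor
  · intro h
    exact eq_zero_of_forall_variation (E := eulerA₁ S g o k A₁ A₂ B₂ B₃) g o S.formG S.nondegG.2
      (isForm_eulerA₁ S g o k hA₁ hA₂ hB₂ hB₃) fun K hK δ hδ => by
        simpa using (key K hK δ hδ).unique (h K hK δ hδ)
  · intro h K hK δ hδ
    have h1 := key K hK δ hδ
    rwa [show eulerA₁ S g o k A₁ A₂ B₂ B₃ = 0 from h, wedge_zero_right, formIntegral_zero,
      mul_zero] at h1

theorem stationary_A₂ : Stationary I 2 (fun K a => gAction S g o k K A₁ a B₂ B₃) A₂ ↔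
    EqA₂ S g o k A₁ A₂ B₂ B₃ := by
  have key : ∀ (K : Set M), IsCompact K → ∀ δ, IsVariation I K 2 δ →
      HasDerivAt (fun t : ℝ => gAction S g o k K A₁ (A₂ + t • δ) B₂ B₃)
        (2 * -formIntegral g o K (wedge S.formG δ (eulerA₂ S g o k A₁ A₂ B₂ B₃))) 0 := by
    intro K hK δ hδ
    simpa only [smul_zero, add_zero, wedge_zero_left, formIntegral_zero, sub_zero, zero_sub] using
      hasDerivAt_gAction S g o k hA₁ hA₂ hB₂ hB₃ hK (isVariation_zero 𝕜 K 1) hδ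
        (isVariation_zero 𝕜 K 2) (isVariation_zero 𝕜 K 3)
  constructor
  · intro h
    exact eq_zero_of_forall_variation (E := eulerA₂ S g o k A₁ A₂ B₂ B₃) g o S.formG S.nondegG.2
      (isForm_eulerA₂ S g o k hA₁ hA₂ hB₂ hB₃) fun K hK δ hδ => by
        simpa using (key K hK δ hδ).unique (h K hK δ hδ)
  · intro h K hK δ hδ
    have h1 := key K hK δ hδ
    rwa [show eulerA₂ S g o k A₁ A₂ B₂ B₃ = 0 from h, wedge_zero_right, formIntegral_zero,
      neg_zero, mul_zero] at h1

theorem stationary_B₂ : Stationary I 2 (fun K b => gAction S g o k K A₁ A₂ b B₃) B₂ ↔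
    EqB₂ S g o k A₁ A₂ B₂ B₃ := by
  have key : ∀ (K : Set M), IsCompact K → ∀ δ, IsVariation I K 2 δ →
      HasDerivAt (fun t : ℝ => gAction S g o k K A₁ A₂ (B₂ + t • δ) B₃)
        (2 * -formIntegral g o K (wedge S.formH δ (eulerB₂ S g o k A₁ A₂ B₂ B₃))) 0 := by
    intro K hK δ hδ
    simpa only [smul_zero, add_zero, wedge_zero_left, formIntegral_zero, sub_zero, zero_sub] using
      hasDerivAt_gAction S g o k hA₁ hA₂ hB₂ hB₃ hK (isVariation_zero 𝕜 K 1)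
        (isVariation_zero 𝕜 K 2) hδ (isVariation_zero 𝕜 K 3)
  constructor
  · intro h
    exact eq_zero_of_forall_variation (E := eulerB₂ S g o k A₁ A₂ B₂ B₃) g o S.formH S.nondegH.2
      (isForm_eulerB₂ S g o k hA₁ hA₂ hB₂ hB₃) fun K hK δ hδ => by
        simpa using (key K hK δ hδ).unique (h K hK δ hδ)
  · intro h K hK δ hδ
    have h1 := key K hK δ hδ
    rwa [show eulerB₂ S g o k A₁ A₂ B₂ B₃ = 0 from h, wedge_zero_right, formIntegral_zero,
      neg_zero, mul_zero] at h1

theorem stationary_B₃ : Stationary I 3 (fun K b => gAction S g o k K A₁ A₂ B₂ b) B₃ ↔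
    EqB₃ S g o k A₁ A₂ B₂ B₃ := by
  have key : ∀ (K : Set M), IsCompact K → ∀ δ, IsVariation I K 3 δ →
      HasDerivAt (fun t : ℝ => gAction S g o k K A₁ A₂ B₂ (B₃ + t • δ))
        (2 * formIntegral g o K (wedge S.formH δ (eulerB₃ S g o k A₁ A₂ B₂ B₃))) 0 := by
    intro K hK δ hδ
    simpa only [smul_zero, add_zero, wedge_zero_left, formIntegral_zero, sub_zero, zero_add] using
      hasDerivAt_gAction S g o k hA₁ hA₂ hB₂ hB₃ hK (isVariation_zero 𝕜 K 1)
        (isVariation_zero 𝕜 K 2) (isVariation_zero 𝕜 K 2) hδ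
  constructor
  · intro h
    exact eq_zero_of_forall_variation (E := eulerB₃ S g o k A₁ A₂ B₂ B₃) g o S.formH S.nondegH.2
      (isForm_eulerB₃ S g o k hA₁ hA₂ hB₂ hB₃) fun K hK δ hδ => by
        simpa using (key K hK δ hδ).unique (h K hK δ hδ)
  · intro h K hK δ hδ
    have h1 := key K hK δ hδ
    rwa [show eulerB₃ S g o k A₁ A₂ B₂ B₃ = 0 from h, wedge_zero_right, formIntegral_zero,
      mul_zero] at h1

/-- Single-field variations are special simultaneous ones. Conversely, the first variation is a sum
of four pairings, each of which vanishes with its Euler expression. -/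
theorem gStationary_iff : gStationary S g o k A₁ A₂ B₂ B₃ ↔
    EqA₁ S g o k A₁ A₂ B₂ B₃ ∧ EqA₂ S g o k A₁ A₂ B₂ B₃ ∧
      EqB₂ S g o k A₁ A₂ B₂ B₃ ∧ EqB₃ S g o k A₁ A₂ B₂ B₃ := by
  constructor
  · intro h
    rw [← stationary_A₁ S g o k hA₁ hA₂ hB₂ hB₃, ← stationary_A₂ S g o k hA₁ hA₂ hB₂ hB₃,
      ← stationary_B₂ S g o k hA₁ hA₂ hB₂ hB₃, ← stationary_B₃ S g o k hA₁ hA₂ hB₂ hB₃]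
    refine ⟨fun K hK δ hδ => ?_, fun K hK δ hδ => ?_, fun K hK δ hδ => ?_, fun K hK δ hδ => ?_⟩
    · simpa only [smul_zero, add_zero] using h K hK δ 0 0 0 hδ (isVariation_zero 𝕜 K 2)
        (isVariation_zero 𝕜 K 2) (isVariation_zero 𝕜 K 3)
    · simpa only [smul_zero, add_zero] using h K hK 0 δ 0 0 (isVariation_zero 𝕜 K 1) hδ
        (isVariation_zero 𝕜 K 2) (isVariation_zero 𝕜 K 3)
    · simpa only [smul_zero, add_zero] using h K hK 0 0 δ 0 (isVariation_zero 𝕜 K 1)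
        (isVariation_zero 𝕜 K 2) hδ (isVariation_zero 𝕜 K 3)
    · simpa only [smul_zero, add_zero] using h K hK 0 0 0 δ (isVariation_zero 𝕜 K 1)
        (isVariation_zero 𝕜 K 2) (isVariation_zero 𝕜 K 2) hδ
  · rintro ⟨e1, e2, e3, e4⟩ K hK a₁ a₂ b₂ b₃ ha₁ ha₂ hb₂ hb₃
    have h := hasDerivAt_gAction S g o k hA₁ hA₂ hB₂ hB₃ hK ha₁ ha₂ hb₂ hb₃
    rw [show eulerA₁ S g o k A₁ A₂ B₂ B₃ = 0 from e1,
      show eulerA₂ S g o k A₁ A₂ B₂ B₃ = 0 from e2,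
      show eulerB₂ S g o k A₁ A₂ B₂ B₃ = 0 from e3,
      show eulerB₃ S g o k A₁ A₂ B₂ B₃ = 0 from e4] at h
    simpa only [wedge_zero_right, formIntegral_zero, sub_zero, add_zero, mul_zero] using h

end Stationarity

theorem eq_iff_of_sub_eq {E : Type*} [AddCommGroup E] [Module 𝕜 E] {a b c : E} {u : 𝕜}
    (hu : u ≠ 0) (h : a - b = u • c) : a = b ↔ c = 0 := by
  rw [← sub_eq_zero, h, smul_eq_zero, or_iff_right hu]

-- The second component of the generalized equation is the equation of A¹, and the first is that of
-- A² up to the factor -(-1)^n. The components appear in reverse order because ⋆ exchanges them.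
include hA₁ hA₂ hB₃ in
theorem gEqF_iff : GEqF S g o k (A₁, A₂) (B₂, B₃) ↔
    EqA₁ S g o k A₁ A₂ B₂ B₃ ∧ EqA₂ S g o k A₁ A₂ B₂ B₃ := by
  have : FiniteDimensional ℝ 𝔤 := FiniteDimensional.trans ℝ 𝕜 𝔤
  have hf' := (isForm_curvF' (C := C) hA₁ hA₂ hB₃).hodgeStar g o
  rw [GEqF, gcurvF_eq C k hA₁ hA₂, gcurvG_eq C k, Prod.ext_iff, and_comm]
  simp only [gd, gstar, gwedge, Prod.fst_add, Prod.snd_add,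
    neg_one_zpow_real_smul (𝕜 := 𝕜), d_smul _ hf', wedge_smul_left, wedge_smul_right,
    show (n : ℤ) - 2 - 1 = n - 3 by ring, show (n : ℤ) - 3 - 1 = n - 4 by ring]
  have s1 : (-1 : 𝕜) ^ (n + 1) = -(-1 : 𝕜) ^ (n : ℤ) := by rw [zpow_natCast, pow_succ]; ring
  have s2 : (-1 : 𝕜) ^ ((n : ℤ) - 3) = -(-1 : 𝕜) ^ (n : ℤ) := by
    rw [neg_one_zpow_congr (b := n + 1) ⟨-2, by ring⟩, zpow_add_one₀ (by simp)]; ring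
  have s3 : (-1 : 𝕜) ^ ((n : ℤ) - 4) = (-1 : 𝕜) ^ (n : ℤ) :=
    neg_one_zpow_congr ⟨-2, by ring⟩
  have s4 : (-1 : 𝕜) ^ ((n : ℤ) - 3 + 1) = (-1 : 𝕜) ^ (n : ℤ) :=
    neg_one_zpow_congr ⟨-1, by ring⟩
  have s5 : (-1 : 𝕜) ^ (2 : ℤ) = 1 := Even.neg_one_zpow (by decide)
  have s6 := neg_one_zpow_mul_self (𝕜 := 𝕜) (n : ℤ)
  rw [EqA₁, EqA₂, s1, s2, s3, s4, s5]
  -- All signs have been reduced to this one, and only its square being 1 matters from here on.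
  generalize (-1 : 𝕜) ^ (n : ℤ) = e at *
  have he : e ≠ 0 := left_ne_zero_of_mul_eq_one s6
  refine and_congr (eq_iff_of_sub_eq (one_ne_zero (α := 𝕜)) ?_) (eq_iff_of_sub_eq (neg_ne_zero.2 he) ?_)
  · simp only [DG, smul_smul, neg_mul_neg, s6]
    module
  · simp only [DG]
    module

-- As for 𝓕: the second component is the equation of B², the first that of B³ up to the factor
-- (-1)^n.
include hA₁ hA₂ hB₂ hB₃ in
theorem gEqG_iff : GEqG S g o k (A₁, A₂) (B₂, B₃) ↔
    EqB₂ S g o k A₁ A₂ B₂ B₃ ∧ EqB₃ S g o k A₁ A₂ B₂ B₃ := by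
  have : FiniteDimensional ℝ 𝔥 := FiniteDimensional.trans ℝ 𝕜 𝔥
  have hh' := (isForm_curvG' (C := C) hA₁ hA₂ hB₂ hB₃).hodgeStar g o
  rw [GEqG, gcurvF_eq C k hA₁ hA₂, gcurvG_eq C k, Prod.ext_iff, and_comm]
  simp only [gd, gstar, gwedge, gmap, Prod.fst_add, Prod.snd_add, Prod.fst_neg, Prod.snd_neg,
    neg_one_zpow_real_smul (𝕜 := 𝕜), d_smul _ hh', wedge_smul_right, mapForm_smul,
    show (n : ℤ) - 2 - 1 = n - 3 by ring, show (n : ℤ) - 3 - 1 = n - 4 by ring]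
  have s2 : (-1 : 𝕜) ^ ((n : ℤ) - 3) = -(-1 : 𝕜) ^ (n : ℤ) := by
    rw [neg_one_zpow_congr (b := n + 1) ⟨-2, by ring⟩, zpow_add_one₀ (by simp)]; ring
  have s3 : (-1 : 𝕜) ^ ((n : ℤ) - 4) = (-1 : 𝕜) ^ (n : ℤ) :=
    neg_one_zpow_congr ⟨-2, by ring⟩
  have s4 : (-1 : 𝕜) ^ ((n : ℤ) - 4 + 1) = -(-1 : 𝕜) ^ (n : ℤ) := by
    rw [show (n : ℤ) - 4 + 1 = n - 3 by ring, s2]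
  have s6 := neg_one_zpow_mul_self (𝕜 := 𝕜) (n : ℤ)
  rw [EqB₂, EqB₃, s2, s3, s4]
  generalize (-1 : 𝕜) ^ (n : ℤ) = e at *
  have he : e ≠ 0 := left_ne_zero_of_mul_eq_one s6
  refine and_congr (eq_iff_of_sub_eq (one_ne_zero (α := 𝕜)) ?_) (eq_iff_of_sub_eq he ?_)
  · simp only [DH, smul_smul, s6]
    module
  · simp only [DH]
    module

/-! ### The case A² = 0 and B³ = 0. -/

section Reduction

theorem DG_zero : DG I C A₁ (0 : DForm n M 𝔤) = 0 := by
  rw [DG, d_zero, wedge_zero_right, add_zero]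

theorem DH_zero : DH I C A₁ (0 : DForm n M 𝔥) = 0 := by
  rw [DH, d_zero, wedge_zero_right, add_zero]

include hA₁ in
theorem gAction_zero [MeasurableSpace M] (K : Set M) :
    gAction S g o k K A₁ 0 B₂ 0 = ordAction S g o K A₁ B₂ := by
  have : FiniteDimensional ℝ 𝔤 := FiniteDimensional.trans ℝ 𝕜 𝔤
  rw [gAction_eq S g o hA₁ (isForm_zero 2), ordAction]
  simp only [starPair, smul_zero, add_zero, sub_zero, DG_zero, DH_zero, mapForm_zero,
    wedge_zero_left]

theorem eqA₁_zero_iff : EqA₁ S g o k A₁ 0 B₂ 0 ↔ OrdEqF S g o A₁ B₂ := by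
  simp only [EqA₁, OrdEqF, smul_zero, add_zero, sub_zero, wedge_zero_left, wedge_zero_right]
  exact sub_eq_zero

theorem eqB₂_zero_iff : EqB₂ S g o k A₁ 0 B₂ 0 ↔ OrdEqG S g o A₁ B₂ := by
  simp only [EqB₂, OrdEqG, smul_zero, add_zero, sub_zero, wedge_zero_left]
  exact add_eq_zero_iff_eq_neg

-- All terms but -k∗𝔽 vanish with A² and B³. Since k ≠ 0 and the Hodge star is injective, the
-- curvature itself is zero.
include hA₁ hB₂ in
theorem eqA₂_zero_iff (hk : k ≠ 0) : EqA₂ S g o k A₁ 0 B₂ 0 ↔ curvF I C A₁ B₂ = 0 := by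
  have : FiniteDimensional ℝ 𝔤 := FiniteDimensional.trans ℝ 𝕜 𝔤
  simp only [EqA₂, smul_zero, add_zero, sub_zero, zero_sub, wedge_zero_left, mapForm_zero,
    DG_zero, DH_zero, hodgeStar_zero, neg_eq_zero, smul_eq_zero, hk, false_or]
  refine ⟨fun h => hodgeStar_injective g o (p := 2) ?_ h, fun h => by rw [h, hodgeStar_zero]⟩
  have := (isForm_curvF (k := k) (C := C) hA₁ (isForm_zero 2) hB₂).isHom
  rwa [smul_zero, add_zero] at this

include hA₁ hB₂ in
theorem eqB₃_zero_iff (hk : k ≠ 0) : EqB₃ S g o k A₁ 0 B₂ 0 ↔ curvG I C A₁ B₂ = 0 := by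
  simp only [EqB₃, smul_zero, add_zero, sub_zero, zero_sub, wedge_zero_left, mapForm_zero,
    DG_zero, DH_zero, hodgeStar_zero, neg_eq_zero, smul_eq_zero, hk, false_or]
  exact ⟨fun h => hodgeStar_injective g o (p := 3) (isForm_DH hA₁ hB₂).isHom h,
    fun h => by rw [h, hodgeStar_zero]⟩

variable [T2Space M] [SecondCountableTopology M] [MeasurableSpace M] [BorelSpace M]

include hA₁ hB₂

theorem ordStationary_A₁ :
    Stationary I 1 (fun K a => ordAction S g o K a B₂) A₁ ↔ OrdEqF S g o A₁ B₂ := by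
  have : FiniteDimensional ℝ 𝔤 := FiniteDimensional.trans ℝ 𝕜 𝔤
  have : FiniteDimensional ℝ 𝔥 := FiniteDimensional.trans ℝ 𝕜 𝔥
  -- The ordinary theory is the generalized one with A² = B³ = 0, for every value of the constant.
  -- The value 0 is chosen here, as the ordinary action contains no constant.
  rw [← eqA₁_zero_iff S g o 0, ← stationary_A₁ S g o 0 hA₁ (isForm_zero 2) hB₂ (isForm_zero 3)]
  refine forall₄_congr fun K hK δ hδ => ?_
  simp_rw [gAction_zero S g o (0 : 𝕜) (hA₁.add (hδ.1.smul _)) K]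

theorem ordStationary_B₂ :
    Stationary I 2 (fun K b => ordAction S g o K A₁ b) B₂ ↔ OrdEqG S g o A₁ B₂ := by
  have : FiniteDimensional ℝ 𝔤 := FiniteDimensional.trans ℝ 𝕜 𝔤
  have : FiniteDimensional ℝ 𝔥 := FiniteDimensional.trans ℝ 𝕜 𝔥
  rw [← eqB₂_zero_iff S g o 0, ← stationary_B₂ S g o 0 hA₁ (isForm_zero 2) hB₂ (isForm_zero 3)]
  refine forall₄_congr fun K hK δ hδ => ?_
  simp_rw [gAction_zero S g o (0 : 𝕜) hA₁ K]

theorem ordStationary_iff :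
    ordStationary S g o A₁ B₂ ↔ OrdEqF S g o A₁ B₂ ∧ OrdEqG S g o A₁ B₂ := by
  have : FiniteDimensional ℝ 𝔤 := FiniteDimensional.trans ℝ 𝕜 𝔤
  have : FiniteDimensional ℝ 𝔥 := FiniteDimensional.trans ℝ 𝕜 𝔥
  constructor
  · intro h
    rw [← ordStationary_A₁ S g o hA₁ hB₂, ← ordStationary_B₂ S g o hA₁ hB₂]
    refine ⟨fun K hK δ hδ => ?_, fun K hK δ hδ => ?_⟩
    · simpa only [smul_zero, add_zero] using h K hK δ 0 hδ (isVariation_zero 𝕜 K 2)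
    · simpa only [smul_zero, add_zero] using h K hK 0 δ (isVariation_zero 𝕜 K 1) hδ
  · rintro ⟨e1, e2⟩ K hK a b ha hb
    -- Varying only A¹ and B² keeps A² = B³ = 0, so the path stays within the ordinary theory.
    have h := hasDerivAt_gAction S g o 0 hA₁ (isForm_zero 2) hB₂ (isForm_zero 3) hK ha
      (isVariation_zero 𝕜 K 2) hb (isVariation_zero 𝕜 K 3)
    rw [show eulerA₁ S g o 0 A₁ 0 B₂ 0 = 0 from (eqA₁_zero_iff S g o 0).2 e1,
      show eulerB₂ S g o 0 A₁ 0 B₂ 0 = 0 from (eqB₂_zero_iff S g o 0).2 e2] at h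
    simp only [wedge_zero_right, wedge_zero_left, formIntegral_zero, sub_zero, add_zero, mul_zero,
      smul_zero] at h
    simpa only [gAction_zero S g o (0 : 𝕜) (hA₁.add (ha.1.smul (_ : ℝ))) K] using h

end Reduction

end Equations

end HigherYM

end

theorem mainTheorem4 {𝕜 : Type*} [RCLike 𝕜]
    {𝔤 : Type*} [NormedAddCommGroup 𝔤] [NormedSpace ℝ 𝔤] [NormedSpace 𝕜 𝔤] [IsScalarTower ℝ 𝕜 𝔤]
    [FiniteDimensional 𝕜 𝔤]
    {𝔥 : Type*} [NormedAddCommGroup 𝔥] [NormedSpace ℝ 𝔥] [NormedSpace 𝕜 𝔥] [IsScalarTower ℝ 𝕜 𝔥]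
    [FiniteDimensional 𝕜 𝔥]
    {n : ℕ} {H : Type*} [TopologicalSpace H] {I : ModelWithCorners ℝ (Euc n) H}
    {M : Type*} [TopologicalSpace M] [ChartedSpace H M] [IsManifold I ∞ M]
    [T2Space M] [SecondCountableTopology M] [MeasurableSpace M] [BorelSpace M]
    (g : Metric I M) (o : Orient I M)
    {C : DifferentialCrossedModule 𝕜 𝔤 𝔥} (S : InvariantForms C) {k : 𝕜} (hk : k ≠ 0)
    (A₁ A₂ : DForm n M 𝔤) (B₂ B₃ : DForm n M 𝔥)
    (hA₁ : IsForm I 1 A₁) (hA₂ : IsForm I 2 A₂) (hB₂ : IsForm I 2 B₂) (hB₃ : IsForm I 3 B₃) :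
    -- varying the action with respect to each of the four fields, and to all of them
    (Stationary I 1 (fun K a => gAction S g o k K a A₂ B₂ B₃) A₁ ↔ EqA₁ S g o k A₁ A₂ B₂ B₃) ∧
    (Stationary I 2 (fun K a => gAction S g o k K A₁ a B₂ B₃) A₂ ↔ EqA₂ S g o k A₁ A₂ B₂ B₃) ∧
    (Stationary I 2 (fun K b => gAction S g o k K A₁ A₂ b B₃) B₂ ↔ EqB₂ S g o k A₁ A₂ B₂ B₃) ∧
    (Stationary I 3 (fun K b => gAction S g o k K A₁ A₂ B₂ b) B₃ ↔ EqB₃ S g o k A₁ A₂ B₂ B₃) ∧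
    (gStationary S g o k A₁ A₂ B₂ B₃ ↔
      EqA₁ S g o k A₁ A₂ B₂ B₃ ∧ EqA₂ S g o k A₁ A₂ B₂ B₃ ∧
        EqB₂ S g o k A₁ A₂ B₂ B₃ ∧ EqB₃ S g o k A₁ A₂ B₂ B₃) ∧
    -- the four equations are equivalent to the two generalized equations
    ((EqA₁ S g o k A₁ A₂ B₂ B₃ ∧ EqA₂ S g o k A₁ A₂ B₂ B₃ ∧
        EqB₂ S g o k A₁ A₂ B₂ B₃ ∧ EqB₃ S g o k A₁ A₂ B₂ B₃) ↔
      GEqF S g o k (A₁, A₂) (B₂, B₃) ∧ GEqG S g o k (A₁, A₂) (B₂, B₃)) ∧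
    -- reduction to the ordinary theory when `A² = 0` and `B³ = 0`
    (∀ K : Set M, gAction S g o k K A₁ 0 B₂ 0 = ordAction S g o K A₁ B₂) ∧
    (Stationary I 1 (fun K a => ordAction S g o K a B₂) A₁ ↔ OrdEqF S g o A₁ B₂) ∧
    (Stationary I 2 (fun K b => ordAction S g o K A₁ b) B₂ ↔ OrdEqG S g o A₁ B₂) ∧
    (ordStationary S g o A₁ B₂ ↔ OrdEqF S g o A₁ B₂ ∧ OrdEqG S g o A₁ B₂) ∧
    (EqA₁ S g o k A₁ 0 B₂ 0 ↔ OrdEqF S g o A₁ B₂) ∧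
    (EqB₂ S g o k A₁ 0 B₂ 0 ↔ OrdEqG S g o A₁ B₂) ∧
    (EqA₂ S g o k A₁ 0 B₂ 0 ↔ curvF I C A₁ B₂ = 0) ∧
    (EqB₃ S g o k A₁ 0 B₂ 0 ↔ curvG I C A₁ B₂ = 0) := by
  refine ⟨stationary_A₁ S g o k hA₁ hA₂ hB₂ hB₃, stationary_A₂ S g o k hA₁ hA₂ hB₂ hB₃,
    stationary_B₂ S g o k hA₁ hA₂ hB₂ hB₃, stationary_B₃ S g o k hA₁ hA₂ hB₂ hB₃,
    gStationary_iff S g o k hA₁ hA₂ hB₂ hB₃, ?_, gAction_zero S g o k hA₁,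
    ordStationary_A₁ S g o hA₁ hB₂, ordStationary_B₂ S g o hA₁ hB₂,
    ordStationary_iff S g o hA₁ hB₂, eqA₁_zero_iff S g o k, eqB₂_zero_iff S g o k,
    eqA₂_zero_iff S g o k hA₁ hB₂ hk, eqB₃_zero_iff S g o k hA₁ hB₂ hk⟩
  rw [gEqF_iff S g o k hA₁ hA₂ hB₃, gEqG_iff S g o k hA₁ hA₂ hB₂ hB₃, and_assoc]
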